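/- Let $t>1$ be a fixed integer. For $k>t$, let the $(k,t)$-Johnson group $S_k^{(t)}$ be the permutation group that $\mathrm{Sym}(k)$ induces on the set $\Omega=\binom{[k]}{t}$ of $t$-element subsets of $[k]=\{1,\dots,k\}$. A complete symmetry breaking predicate for a permutation group $G\le\mathrm{Sym}(\Omega)$ is a CNF formula $\psi$ with variables in $\Omega$ such that every orbit of $G$ on the set of assignments $\Omega\to\{0,1\}$ contains exactly one assignment that satisfies $\psi$. Suppose that there is an algorithm which, given any $k>t$ (in unary), outputs a complete symmetry breaking predicate for $S_k^{(t)}$ in time polynomial in the domain size $\binom{k}{t}$. Then the graph isomorphism problem $\mathrm{GI}$ (given two finite undirected graphs by their adjacency matrices, are they isomorphic?) is in $\mathsf{coNP}$. -/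

import Mathlib

namespace SymBreak

/-! ### Polynomial time, `NP` and `coNP`

The machine model is Mathlib's multi-stack Turing machine `Turing.FinTM2`, whose running time
is its number of steps. -/

/-- Words over the binary alphabet, as inputs of machines. -/
abbrev Word : Type := List Bool

/-- A pair of binary words is written on the input tape of a verifier as the concatenation of the
two words, the letters of the first and of the second being marked as such. -/
def encodeWordPair : Word × Word → List (Bool ⊕ Bool) :=
  (Computability.encodingProd (Computability.encodingList Bool)
    (Computability.encodingList Bool)).encode

/-- The class `NP`, through polynomial-time verifiers and certificates of polynomial length. -/
def NP : Set (Set Word) :=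
  {L | ∃ V : Word × Word → Bool, ∃ p : Polynomial ℕ,
    Nonempty (Turing.TM2ComputableInPolyTime encodeWordPair Computability.encodeBool V) ∧
    ∀ x : Word, x ∈ L ↔ ∃ y : Word, y.length ≤ p.eval x.length ∧ V (x, y) = true}

/-- The class `coNP`: the complement of the language is in `NP`. -/
def coNP : Set (Set Word) :=
  {L | Lᶜ ∈ NP}

/-! ### The graph isomorphism problem -/

open Classical in
/-- A graph on `n` vertices as a word: `n` in unary, a zero, and then the adjacency matrix, read
row by row. -/
noncomputable def encodeGraph {n : ℕ} (Γ : SimpleGraph (Fin n)) : Word :=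
  List.replicate n true ++ false ::
    (List.finRange n).flatMap fun i => (List.finRange n).map fun j => decide (Γ.Adj i j)

/-- The graph isomorphism problem: the set of (encodings of) pairs of isomorphic graphs. -/
def GI : Set Word :=
  {w | ∃ (n m : ℕ) (Γ : SimpleGraph (Fin n)) (Δ : SimpleGraph (Fin m)),
    w = encodeGraph Γ ++ encodeGraph Δ ∧ Nonempty (Γ ≃g Δ)}

/-! ### Complete symmetry breaking predicates -/

/-- The orbit of a complete Boolean assignment `θ` to `Ω` under a permutation group `G` on `Ω`. -/
def assignmentOrbit {Ω : Type} (G : Subgroup (Equiv.Perm Ω)) (θ : Ω → Bool) : Set (Ω → Bool) :=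
  {τ | ∃ g ∈ G, τ = fun ω => θ (g⁻¹ ω)}

/-- A CNF formula `ψ` with variables in `Ω` is a complete symmetry breaking predicate for `G` if
in each orbit of complete assignments it is satisfied by one assignment and falsified by
all others. -/
def IsCompleteSBP {Ω : Type} (G : Subgroup (Equiv.Perm Ω)) (ψ : Std.Sat.CNF Ω) : Prop :=
  ∀ θ : Ω → Bool, ∃ τ ∈ assignmentOrbit G θ, ψ.eval τ = true ∧
    ∀ τ' ∈ assignmentOrbit G θ, τ' ≠ τ → ψ.eval τ' = false

/-! ### Johnson groups -/

/-- The domain of the Johnson action: the `t`-element subsets of a `k`-element set. -/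
abbrev JohnsonDomain (k t : ℕ) : Type := Set.powersetCard (Fin k) t

/-- The `(k, t)`-Johnson group: the permutation group on the `t`-element subsets
of a `k`-element set that is induced by the symmetric group on the `k`-element set. -/
def johnsonGroup (k t : ℕ) : Subgroup (Equiv.Perm (JohnsonDomain k t)) :=
  (MulAction.toPermHom (Equiv.Perm (Fin k)) (JohnsonDomain k t)).range

/-! ### Generating symmetry breaking predicates for Johnson groups -/

/-- A literal over the `t`-subsets of a `k`-set as a word: its sign (`true` for a positive
literal), and then the characteristic vector of the `t`-subset, of length `k`. -/
def encodeLiteral {k t : ℕ} (l : JohnsonDomain k t × Bool) : List (Option Bool) :=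
  some l.2 :: List.ofFn fun i : Fin k => some (decide (i ∈ (l.1 : Finset (Fin k))))

/-- A CNF formula as a word: the literals of each clause one after the other, each clause being
ended by the letter `none`. -/
def encodeCNF {k t : ℕ} (ψ : Std.Sat.CNF (JohnsonDomain k t)) : List (Option Bool) :=
  ψ.clauses.toList.flatMap fun c => c.flatMap encodeLiteral ++ [none]

/-- Complete symmetry breaking predicates for all `(k, t)`-Johnson groups can be generated in
polynomial time: one machine, given any `k > t` (in unary), outputs such a predicate for the
`(k, t)`-Johnson group within a number of steps that is polynomial in the size
`k.choose t` of the domain. -/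
def JohnsonSBPInPolyTime (t : ℕ) : Prop :=
  ∃ (M : Turing.TM2ComputableAux Bool (Option Bool)) (p : Polynomial ℕ),
    ∀ k : ℕ, t < k → ∃ ψ : Std.Sat.CNF (JohnsonDomain k t),
      IsCompleteSBP (johnsonGroup k t) ψ ∧
      Nonempty (Turing.TM2OutputsInTime M.tm
        ((Computability.unaryEncodeNat k).map M.inputAlphabet.symm)
        (some ((encodeCNF ψ).map M.outputAlphabet.symm))
        (p.eval (k.choose t)))

end SymBreak

/-! The task is to give short certificates for non-isomorphism. A graph on `n` vertices becomes an
assignment to the `t`-subsets of `n + t + 1` points. These points are the `n` vertices, three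
padding points, and `t - 2` core points. A `t`-set is true iff it consists of the two ends of an
edge and all core points. The padding makes the number of points exceed `t` even when `n ≤ 2`, so
the generator is applicable for every `n`. Two graphs are isomorphic iff their assignments lie in
one orbit of the Johnson group (`iso_iff_mem_orbit`). For the nontrivial direction, core points lie
in all edge sets and padding points in none. A permutation that matches the edge sets can therefore
be corrected by transpositions until it fixes all added points, and then it restricts to the
vertices.

Let `ψ` be the predicate generated for `n + t + 1` points. It selects one assignment from each
orbit. If the graphs are not isomorphic, the certificate consists of two permutations that carry
their assignments to the selected ones, together with a `t`-set on which the results differ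
(`exists_certificate`). If the graphs are isomorphic, any two satisfying assignments reached in this
way lie in one orbit and coincide, so no such `t`-set exists (`not_differ_of_iso`). Since `t` is
fixed, `(n + t + 1).choose t` is polynomial in `n`, and hence so are the generator's running time
and the length of `ψ`.

The verifier handles an assignment as a table of signed 0/1-words, which are characteristic vectors
with a sign. Entries for pairs of vertices are read off the adjacency matrix. Negative entries for
sets that cannot represent an edge are guessed, and only words whose last `t + 1` letters show this
are allowed. A guessed word need not have `t` ones; this is harmless, since positive entries always
come from the matrix, and one of two opposite entries is positive. Permuting the points means
rearranging all words of a table in the same way. This is done by a sequence of two kinds of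
rotations, which reach every permutation (`exists_rotates`). The formula is checked literal by
literal against the table (`scanFormula_sound`, `to_scanFormula`). Matrices that are not symmetric
or have a nonzero diagonal betray themselves by opposite entries within one table. Inputs not of the
form "`n`, matrix, `n`, matrix" are detected separately.

Everything must finally be a Turing machine. To avoid writing one by hand, the verifier is a program
in a small nondeterministic language over stacks. One generic machine runs any such program and
takes the nondeterministic choices from the certificate; this gives `mem_NP`. Two separate calculi
serve for the programs: `Rel` forgets the running time and is used for soundness, where all runs
matter; `To` asserts one run within a bound and is used for completeness. Since guesses are free,
programs may guess a letter or a number of repetitions and let a later test block the wrong guesses.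
-/

namespace SymBreak

/-! ### Nondeterministic stack programs -/

/-- Nondeterministic programs over finitely many tapes. -/
inductive Prog (K Γ : Type) : Type
  | push (k : K) (a : Γ)
  | drop (k : K)
  | test (k : K) (p : Option Γ → Bool)
  | seq (P Q : Prog K Γ)
  | alt (P Q : Prog K Γ)
  | star (P : Prog K Γ)

namespace Prog

variable {K Γ : Type}

/-- The subprograms of a program. -/
def sub : Prog K Γ → List (Prog K Γ)
  | push k a => [push k a]
  | drop k => [drop k]
  | test k p => [test k p]
  | seq P Q => seq P Q :: (P.sub ++ Q.sub)
  | alt P Q => alt P Q :: (P.sub ++ Q.sub)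
  | star P => star P :: P.sub

theorem self_mem_sub (P : Prog K Γ) : P ∈ P.sub := by
  cases P <;> simp [sub]

theorem sub_trans {P Q R : Prog K Γ} (h₁ : P ∈ Q.sub) (h₂ : Q ∈ R.sub) : P ∈ R.sub := by
  induction R with
  | push | drop | test => simp only [sub, List.mem_singleton] at h₂; subst h₂; exact h₁
  | seq A B ihA ihB | alt A B ihA ihB =>
    simp only [sub, List.mem_cons, List.mem_append] at h₂ ⊢
    rcases h₂ with rfl | h₂ | h₂
    · simpa [sub] using h₁
    · exact .inr (.inl (ihA h₂))
    · exact .inr (.inr (ihB h₂))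
  | star A ih =>
    simp only [sub, List.mem_cons] at h₂ ⊢
    rcases h₂ with rfl | h₂
    · simpa [sub] using h₁
    · exact .inr (ih h₂)

/-- The type of subprograms of a program. -/
abbrev Sub (P : Prog K Γ) : Type := {Q : Prog K Γ // Q ∈ P.sub}

variable [DecidableEq K]

/-- `P.Run n s s'`: the program `P` can lead from the tapes `s` to the tapes `s'`
in `n` steps. -/
inductive Run : Prog K Γ → ℕ → (K → List Γ) → (K → List Γ) → Prop
  | push (k a s) : Run (push k a) 1 s (Function.update s k (a :: s k))
  | drop (k s) : Run (drop k) 1 s (Function.update s k (s k).tail)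
  | test (k p s) : p (s k).head? = true → Run (test k p) 1 s s
  | seq {P Q m n s s' s''} : Run P m s s' → Run Q n s' s'' → Run (seq P Q) (m + n + 1) s s''
  | altl {P Q n s s'} : Run P n s s' → Run (alt P Q) (n + 1) s s'
  | altr {P Q n s s'} : Run Q n s s' → Run (alt P Q) (n + 1) s s'
  | nil {P s} : Run (star P) 1 s s
  | cons {P m n s s' s''} :
      Run P m s s' → Run (star P) n s' s'' → Run (star P) (m + n + 1) s s''

/-- Run a list of programs on tapes, with the nondeterministic choices being read off a word;
each step consumes one letter of it. -/
def interp : List (Prog K Γ) → List Bool → (K → List Γ) → Bool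
  | [], _, _ => true
  | _ :: _, [], _ => false
  | push k a :: c, _ :: y, s => interp c y (Function.update s k (a :: s k))
  | drop k :: c, _ :: y, s => interp c y (Function.update s k (s k).tail)
  | test k p :: c, _ :: y, s => if p (s k).head? then interp c y s else false
  | seq P Q :: c, _ :: y, s => interp (P :: Q :: c) y s
  | alt P Q :: c, b :: y, s => interp ((if b then P else Q) :: c) y s
  | star P :: c, b :: y, s => interp (if b then P :: star P :: c else c) y s

/-- The continuation `c` and the remaining choices `y` are arbitrary so that the choices of
consecutive subprograms can be concatenated. The word has one letter per step, so time bounds become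
bounds on certificates. -/
theorem Run.interp {P : Prog K Γ} {n : ℕ} {s s' : K → List Γ} (h : P.Run n s s')
    {c : List (Prog K Γ)} {y : List Bool} (hc : interp c y s' = true) :
    ∃ w : List Bool, w.length = n ∧ Prog.interp (P :: c) (w ++ y) s = true := by
  induction h generalizing c y with
  | push k a s => exact ⟨[true], rfl, by simpa [Prog.interp] using hc⟩
  | drop k s => exact ⟨[true], rfl, by simpa [Prog.interp] using hc⟩
  | test k p s hp => exact ⟨[true], rfl, by simpa [Prog.interp, hp] using hc⟩
  | seq _ _ ih₁ ih₂ =>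
    obtain ⟨w₂, h₂, h₂'⟩ := ih₂ hc
    obtain ⟨w₁, h₁, h₁'⟩ := ih₁ h₂'
    exact ⟨true :: (w₁ ++ w₂), by simp [h₁, h₂], by simpa [Prog.interp] using h₁'⟩
  | altl _ ih =>
    obtain ⟨w, h, h'⟩ := ih hc
    exact ⟨true :: w, by simp [h], by simpa [Prog.interp] using h'⟩
  | altr _ ih =>
    obtain ⟨w, h, h'⟩ := ih hc
    exact ⟨false :: w, by simp [h], by simpa [Prog.interp] using h'⟩
  | nil => exact ⟨[false], rfl, by simpa [Prog.interp] using hc⟩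
  | cons _ _ ih₁ ih₂ =>
    obtain ⟨w₂, h₂, h₂'⟩ := ih₂ hc
    obtain ⟨w₁, h₁, h₁'⟩ := ih₁ h₂'
    exact ⟨true :: (w₁ ++ w₂), by simp [h₁, h₂], by simpa [Prog.interp] using h₁'⟩

/-- Run a list of programs one after the other. -/
inductive RunList : List (Prog K Γ) → (K → List Γ) → Prop
  | nil (s) : RunList [] s
  | cons {P c n s s'} : Run P n s s' → RunList c s' → RunList (P :: c) s

/-- Every equation of `interp` consumes a letter, so induction on `y` suffices. The numbers of steps
are forgotten because soundness does not need them. -/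
theorem runList_of_interp {c : List (Prog K Γ)} {y : List Bool} {s : K → List Γ}
    (h : interp c y s = true) : RunList c s := by
  induction y generalizing c s with
  | nil =>
    cases c with
    | nil => exact .nil s
    | cons P c => simp [interp] at h
  | cons b y ih =>
    cases c with
    | nil => exact .nil s
    | cons P c =>
      cases P with
      | push k a => exact .cons (.push k a s) (ih (by simpa [interp] using h))
      | drop k => exact .cons (.drop k s) (ih (by simpa [interp] using h))
      | test k p =>
        simp only [interp, Bool.if_false_right, Bool.and_eq_true] at h
        exact .cons (.test k p s (by simpa using h.1)) (ih h.2)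
      | seq P Q =>
        rcases ih (by simpa [interp] using h) with _ | ⟨h₁, _ | ⟨h₂, h₃⟩⟩
        exact .cons (.seq h₁ h₂) h₃
      | alt P Q =>
        cases b with
        | false =>
          rcases ih (by simpa [interp] using h) with _ | ⟨h₁, h₂⟩
          exact .cons (.altr h₁) h₂
        | true =>
          rcases ih (by simpa [interp] using h) with _ | ⟨h₁, h₂⟩
          exact .cons (.altl h₁) h₂
      | star P =>
        cases b with
        | false => exact .cons .nil (ih (by simpa [interp] using h))
        | true =>
          rcases ih (by simpa [interp] using h) with _ | ⟨h₁, _ | ⟨h₂, h₃⟩⟩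
          exact .cons (.cons h₁ h₂) h₃

/-! ### A machine that runs a program -/

/-- The tapes of the machine that runs a program. -/
inductive Tape (K : Type) : Type
  | inp
  | out
  | tmp
  | ctl
  | wrk (k : K)
  deriving DecidableEq, Fintype

/-- The stack alphabets of the machine that runs a program. -/
abbrev Alphabet (P : Prog K Γ) : Tape K → Type
  | .inp => Bool ⊕ Bool
  | .out => Bool
  | .tmp => Bool
  | .ctl => P.Sub
  | .wrk _ => Γ

/-- The labels of the machine that runs a program. -/
inductive Label (P : Prog K Γ) : Type
  | load
  | unload
  | main
  | exec (Q : P.Sub)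
  | fin (b : Bool)

noncomputable instance (P : Prog K Γ) : Fintype P.Sub :=
  (List.finite_toSet P.sub).fintype

open Classical in
noncomputable instance (P : Prog K Γ) : Fintype (Label P) :=
  Fintype.ofSurjective
    (fun l : Option (Option (Option (P.Sub ⊕ Bool))) =>
      match l with
      | none => .load
      | some none => .unload
      | some (some none) => .main
      | some (some (some (.inl Q))) => .exec Q
      | some (some (some (.inr b))) => .fin b)
    (by
      rintro (_ | _ | _ | Q | b)
      · exact ⟨none, rfl⟩
      · exact ⟨some none, rfl⟩
      · exact ⟨some (some none), rfl⟩
      · exact ⟨some (some (some (.inl Q))), rfl⟩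
      · exact ⟨some (some (some (.inr b))), rfl⟩)

/-- The internal memory of the machine that runs a program: the current program, and a bit. -/
abbrev Mem (P : Prog K Γ) : Type := Option P.Sub × Option Bool

open Turing.TM2 (Stmt)

/-- One step of a subprogram; the bit in memory decides the nondeterministic choices. -/
def execStmt (P : Prog K Γ) : (Q : Prog K Γ) → Q ∈ P.sub → Stmt (Alphabet P) (Label P) (Mem P)
  | push k a, _ => .push (.wrk k) (fun _ => a) (.goto fun _ => .main)
  | drop k, _ => .pop (.wrk k) (fun v _ => v) (.goto fun _ => .main)
  | test k p, _ => .peek (.wrk k) (fun v o => (v.1, some (p o)))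
      (.branch (fun v => v.2 == some true) (.goto fun _ => .main) (.goto fun _ => .fin false))
  | seq A B, h => .push .ctl (fun _ => ⟨B, sub_trans (by simp [sub, self_mem_sub]) h⟩)
      (.push .ctl (fun _ => ⟨A, sub_trans (by simp [sub, self_mem_sub]) h⟩)
        (.goto fun _ => .main))
  | alt A B, h => .branch (fun v => v.2 == some true)
      (.push .ctl (fun _ => ⟨A, sub_trans (by simp [sub, self_mem_sub]) h⟩)
        (.goto fun _ => .main))
      (.push .ctl (fun _ => ⟨B, sub_trans (by simp [sub, self_mem_sub]) h⟩)
        (.goto fun _ => .main))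
  | star A, h => .branch (fun v => v.2 == some true)
      (.push .ctl (fun _ => ⟨star A, h⟩)
        (.push .ctl (fun _ => ⟨A, sub_trans (by simp [sub, self_mem_sub]) h⟩)
          (.goto fun _ => .main)))
      (.goto fun _ => .main)

/-- Pop once from each stack of a list, and note in the memory whether one was nonempty. -/
def popEach (P : Prog K Γ) : List (Tape K) → Stmt (Alphabet P) (Label P) (Mem P) →
    Stmt (Alphabet P) (Label P) (Mem P)
  | [], q => q
  | k :: ks, q => .pop k (fun v o => if o.isSome then (none, some true) else v) (popEach P ks q)

/-- The code of the machine that runs a program, with a word written on the work stack `X` in the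
beginning. -/
noncomputable def code [Fintype K] (P : Prog K Γ) (X : K) (e : Bool → Γ) :
    Label P → Stmt (Alphabet P) (Label P) (Mem P)
  | .load => .peek .inp (fun _ o => (none, o.bind fun a => a.elim some fun _ => none))
      (.branch (fun v => v.2.isSome)
        (.pop .inp (fun v _ => v)
          (.push .tmp (fun v => v.2.getD false) (.goto fun _ => .load)))
        (.goto fun _ => .unload))
  | .unload => .pop .tmp (fun _ o => (none, o))
      (.branch (fun v => v.2.isSome)
        (.push (.wrk X) (fun v => e (v.2.getD false)) (.goto fun _ => .unload))
        (.push .ctl (fun _ => ⟨P, self_mem_sub P⟩) (.goto fun _ => .main)))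
  | .main => .pop .ctl (fun _ o => (o, none))
      (.branch (fun v => v.1.isSome)
        (.pop .inp (fun v o => (v.1, o.map (Sum.elim id id)))
          (.branch (fun v => v.2.isSome)
            (.goto fun v => .exec (v.1.getD ⟨P, self_mem_sub P⟩))
            (.goto fun _ => .fin false)))
        (.goto fun _ => .fin true))
  | .exec Q => execStmt P Q.1 Q.2
  | .fin b => .load (fun _ => (none, none))
      (popEach P Finset.univ.toList
        (.branch (fun v => v.2.isSome) (.goto fun _ => .fin b)
          (.push .out (fun _ => b) .halt)))

/-- The contents of the tapes of the machine that runs a program. -/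
def tapes {P : Prog K Γ} (i : List (Bool ⊕ Bool)) (o t : List Bool) (c : List P.Sub)
    (s : K → List Γ) : ∀ k, List (Alphabet P k)
  | .inp => i
  | .out => o
  | .tmp => t
  | .ctl => c
  | .wrk k => s k

section

variable {P : Prog K Γ} (i : List (Bool ⊕ Bool)) (o t : List Bool) (c : List P.Sub)
  (s : K → List Γ)

theorem update_tapes_inp (l) :
    Function.update (tapes i o t c s) .inp l = tapes l o t c s := by
  funext k; cases k <;> simp [tapes]

theorem update_tapes_out (l) :
    Function.update (tapes i o t c s) .out l = tapes i l t c s := by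
  funext k; cases k <;> simp [tapes]

theorem update_tapes_tmp (l) :
    Function.update (tapes i o t c s) .tmp l = tapes i o l c s := by
  funext k; cases k <;> simp [tapes]

theorem update_tapes_ctl (l) :
    Function.update (tapes i o t c s) .ctl l = tapes i o t l s := by
  funext k; cases k <;> simp [tapes]

theorem update_tapes_wrk (k) (l : List Γ) :
    Function.update (tapes i o t c s) (.wrk k) l = tapes i o t c (Function.update s k l) := by
  funext k'
  cases k' with
  | wrk k' =>
    by_cases h : k' = k
    · subst h; simp [tapes]
    · simp [tapes, h]
  | _ => simp [tapes]

end

-- Without repetitions each stack is popped once, so the pops do not interfere, and the memory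
-- afterwards tells whether any stack was nonempty.
open Classical in
theorem stepAux_popEach {P : Prog K Γ} (ks : List (Tape K)) (hks : ks.Nodup) (q v)
    (S : ∀ k, List (Alphabet P k)) :
    Turing.TM2.stepAux (popEach P ks q) v S =
      Turing.TM2.stepAux q (if ∀ k ∈ ks, S k = [] then v else (none, some true))
        (fun k => if k ∈ ks then (S k).tail else S k) := by
  induction ks generalizing v S with
  | nil => simp [popEach]
  | cons k ks ih =>
    rw [List.nodup_cons] at hks
    simp only [popEach, Turing.TM2.stepAux]
    rw [ih hks.2]
    congr 1
    · have h₁ : ∀ k' ∈ ks, Function.update S k (S k).tail k' = S k' := fun k' hk' =>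
        Function.update_of_ne (fun h => hks.1 (h.subst (motive := (· ∈ ks)) hk')) _ _
      by_cases h₂ : ∀ k' ∈ ks, S k' = []
      · rw [if_pos (fun k' hk' => (h₁ k' hk').trans (h₂ k' hk'))]
        have h₄ : (∀ k' ∈ k :: ks, S k' = []) ↔ S k = [] := by simpa using fun _ => h₂
        simp only [h₄]
        cases h₃ : S k <;> simp
      · rw [if_neg (fun h => h₂ fun k' hk' => (h₁ k' hk').symm.trans (h k' hk')),
          if_neg (fun h => h₂ fun k' hk' => h k' (List.mem_cons_of_mem _ hk'))]
    · funext k'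
      by_cases h : k' = k
      · subst h; simp [hks.1]
      · simp [h]

/-! ### Correctness and running time of the machine -/

variable [Fintype K] {P : Prog K Γ} {X : K} {e : Bool → Γ}

/-- The configurations of the machine that runs a program. -/
abbrev Cfg (P : Prog K Γ) : Type := Turing.TM2.Cfg (Alphabet P) (Label P) (Mem P)

/-- The machine gets from one configuration to another one in a number of steps. -/
def Steps (P : Prog K Γ) (X : K) (e : Bool → Γ) (n : ℕ) (a b : Cfg P) : Prop :=
  (flip bind (Turing.TM2.step (code P X e)))^[n] (some a) = some b

theorem Steps.head {n : ℕ} {a b c : Cfg P} (h : Turing.TM2.step (code P X e) a = some b)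
    (h' : Steps P X e n b c) : Steps P X e (n + 1) a c := by
  rw [Steps, Function.iterate_succ_apply]
  have : flip bind (Turing.TM2.step (code P X e)) (some a) = some b := h
  rw [this]; exact h'

/-- The final configuration of the machine that runs a program. -/
def haltCfg (P : Prog K Γ) (b : Bool) : Cfg P :=
  ⟨none, (none, none), tapes (P := P) [] [b] [] [] fun _ => []⟩

-- The output convention asks for the initial memory and for empty stacks apart from the output, so
-- the machine has to clean up. Each round shortens all nonempty stacks by one letter, and one more
-- round finds them empty.
open Classical in
theorem steps_fin (b : Bool) (N : ℕ) (v : Mem P) (S : ∀ k, List (Alphabet P k))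
    (hS : ∀ k, (S k).length ≤ N) :
    ∃ n ≤ N + 1, Steps P X e n ⟨some (.fin b), v, S⟩ (haltCfg P b) := by
  have key : ∀ v S, Turing.TM2.step (code P X e) ⟨some (.fin b), v, S⟩ =
      some (if ∀ k, S k = [] then haltCfg P b
        else ⟨some (.fin b), (none, some true), fun k => (S k).tail⟩) := by
    intro v S
    simp only [code, Turing.TM2.step, Turing.TM2.stepAux]
    rw [stepAux_popEach _ (Finset.nodup_toList _)]
    by_cases h : ∀ k, S k = []
    · have h' : (fun k => [] : ∀ k, List (Alphabet P k)) = tapes [] [] [] [] fun _ => [] := by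
        funext k; cases k <;> rfl
      have h'' : S = fun k => [] := funext h
      subst h''
      simp only [implies_true, if_true, Turing.TM2.stepAux, Option.isSome_none, cond_false,
        List.tail_nil, ite_self]
      rw [h', update_tapes_out]
      rfl
    · simp [Finset.mem_toList, h, Turing.TM2.stepAux]
  induction N generalizing v S with
  | zero =>
    refine ⟨1, le_rfl, Steps.head (key v S) ?_⟩
    rw [if_pos (fun k => List.length_eq_zero_iff.1 (Nat.le_zero.1 (hS k)))]
    rfl
  | succ N ih =>
    by_cases h : ∀ k, S k = []
    · refine ⟨1, by omega, Steps.head (key v S) ?_⟩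
      rw [if_pos h]; rfl
    · obtain ⟨n, hn, hn'⟩ := ih (none, some true) (fun k => (S k).tail)
        (fun k => by simpa using hS k)
      refine ⟨n + 1, by omega, Steps.head (key v S) ?_⟩
      rwa [if_neg h]

/-- Each choice letter costs two machine steps, fetching a subprogram and executing it, and lets a
stack grow by at most one letter. Hence the height bounds, with the number of remaining choices as
slack, are preserved, and `N` also bounds the cost of the final clean-up. -/
theorem steps_main (y : List Bool) (c : List P.Sub) (s : K → List Γ) (v : Mem P) (N : ℕ)
    (hc : c.length + y.length ≤ N) (hs : ∀ k, (s k).length + y.length ≤ N) :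
    ∃ n ≤ 2 * y.length + N + 2, Steps P X e n
      ⟨some .main, v, tapes (y.map .inr) [] [] c s⟩
      (haltCfg P (interp (c.map Subtype.val) y s)) := by
  have fin : ∀ b v i c s, i.length ≤ N → c.length ≤ N → (∀ k, (s k).length ≤ N) →
      ∃ n ≤ N + 1, Steps P X e n ⟨some (.fin b), v, tapes i [] [] c s⟩ (haltCfg P b) := by
    intro b v i c s h₁ h₂ h₃
    refine steps_fin b N v _ fun k => ?_
    cases k <;> simp [tapes, h₁, h₂, h₃]
  induction y generalizing c s v with
  | nil =>
    cases c with
    | nil =>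
      obtain ⟨n, hn, h⟩ := fin true (none, none) [] [] s (by simp) (by simp)
        (fun k => by simpa using hs k)
      refine ⟨n + 1, by simp; omega, Steps.head ?_ (by simpa [interp] using h)⟩
      simp [code, Turing.TM2.step, update_tapes_ctl, tapes]
    | cons Q c =>
      obtain ⟨n, hn, h⟩ := fin false (some Q, none) [] c s (by simp) (by simp at hc; omega)
        (fun k => by simpa using hs k)
      refine ⟨n + 1, by simp; omega, Steps.head ?_ (by simpa [interp] using h)⟩
      simp [code, Turing.TM2.step, update_tapes_ctl, update_tapes_inp, tapes]
  | cons b y ih =>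
    cases c with
    | nil =>
      obtain ⟨n, hn, h⟩ := fin true (none, none) ((b :: y).map .inr) [] s
        (by simpa using hc) (by simp) (fun k => by have := hs k; omega)
      refine ⟨n + 1, by simp; omega, Steps.head ?_ (by simpa [interp] using h)⟩
      simp [code, Turing.TM2.step, update_tapes_ctl, tapes]
    | cons Q c =>
      simp only [List.length_cons] at hc hs
      have step₁ : Turing.TM2.step (code P X e)
          ⟨some .main, v, tapes ((b :: y).map .inr) [] [] (Q :: c) s⟩ =
          some ⟨some (.exec Q), (some Q, some b), tapes (y.map .inr) [] [] c s⟩ := by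
        simp [code, Turing.TM2.step, update_tapes_ctl, update_tapes_inp, tapes]
      -- All steps that do not block are alike: the cases below only have to supply the new control
      -- stack `c'` and the new work stacks `s'`.
      have go : ∀ v' c' s',
          Turing.TM2.step (code P X e)
            ⟨some (.exec Q), (some Q, some b), tapes (y.map .inr) [] [] c s⟩ =
            some ⟨some .main, v', tapes (y.map .inr) [] [] c' s'⟩ →
          c'.length ≤ c.length + 2 → (∀ k, (s' k).length ≤ (s k).length + 1) →
          interp ((Q :: c).map Subtype.val) (b :: y) s = interp (c'.map Subtype.val) y s' →
          ∃ n ≤ 2 * (y.length + 1) + N + 2, Steps P X e n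
            ⟨some .main, v, tapes ((b :: y).map .inr) [] [] (Q :: c) s⟩
            (haltCfg P (interp ((Q :: c).map Subtype.val) (b :: y) s)) := by
        intro v' c' s' h₁ h₂ h₃ h₄
        obtain ⟨n, hn, h⟩ := ih c' s' v' (by omega)
          (fun k => by have := hs k; have := h₃ k; omega)
        exact ⟨n + 1 + 1, by omega, Steps.head step₁ (Steps.head h₁ (h₄ ▸ h))⟩
      have upd : ∀ k l, l.length ≤ (s k).length + 1 →
          ∀ k', (Function.update s k l k').length ≤ (s k').length + 1 := by
        intro k l h k'
        by_cases hk : k' = k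
        · subst hk; simpa using h
        · simp [hk]
      obtain ⟨Q, hQ⟩ := Q
      cases Q with
      | push k a =>
        refine go (some ⟨push k a, hQ⟩, some b) c (Function.update s k (a :: s k)) ?_ (by omega)
          (upd _ _ (by simp)) (by simp [interp])
        simp [code, Turing.TM2.step, execStmt, update_tapes_wrk, tapes]
      | drop k =>
        refine go (some ⟨drop k, hQ⟩, some b) c (Function.update s k (s k).tail) ?_ (by omega)
          (upd _ _ (by simp; omega)) (by simp [interp])
        simp [code, Turing.TM2.step, execStmt, update_tapes_wrk, tapes]
      | test k p =>
        by_cases hp : p (s k).head? = true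
        · refine go (some ⟨test k p, hQ⟩, some true) c s ?_ (by omega)
            (fun _ => by omega) (by simp [interp, hp])
          simp [code, Turing.TM2.step, execStmt, tapes, hp]
        · obtain ⟨n, hn, h⟩ := fin false (some ⟨test k p, hQ⟩, some false) (y.map .inr) c s
            (by simp; omega) (by omega) (fun k => by have := hs k; omega)
          refine ⟨n + 1 + 1, by simp; omega, Steps.head step₁ (Steps.head ?_
            (by simpa [interp, hp] using h))⟩
          simp [code, Turing.TM2.step, execStmt, tapes, hp]
      | seq A B =>
        refine go (some ⟨seq A B, hQ⟩, some b)
          (⟨A, sub_trans (by simp [sub, self_mem_sub]) hQ⟩ ::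
            ⟨B, sub_trans (by simp [sub, self_mem_sub]) hQ⟩ :: c) s ?_ (by simp)
          (fun _ => by omega) (by simp [interp])
        simp [code, Turing.TM2.step, execStmt, update_tapes_ctl, tapes]
      | alt A B =>
        cases b with
        | true =>
          refine go (some ⟨alt A B, hQ⟩, some true) (⟨A, sub_trans (by simp [sub, self_mem_sub]) hQ⟩ :: c) s ?_ (by simp)
            (fun _ => by omega) (by simp [interp])
          simp [code, Turing.TM2.step, execStmt, update_tapes_ctl, tapes]
        | false =>
          refine go (some ⟨alt A B, hQ⟩, some false) (⟨B, sub_trans (by simp [sub, self_mem_sub]) hQ⟩ :: c) s ?_ (by simp)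
            (fun _ => by omega) (by simp [interp])
          simp [code, Turing.TM2.step, execStmt, update_tapes_ctl, tapes]
      | star A =>
        cases b with
        | true =>
          refine go (some ⟨star A, hQ⟩, some true) 
            (⟨A, sub_trans (by simp [sub, self_mem_sub]) hQ⟩ :: ⟨star A, hQ⟩ :: c) s ?_ (by simp)
            (fun _ => by omega) (by simp [interp])
          simp [code, Turing.TM2.step, execStmt, update_tapes_ctl, tapes]
        | false =>
          refine go (some ⟨star A, hQ⟩, some false) c s ?_ (by simp)
            (fun _ => by omega) (by simp [interp])
          simp [code, Turing.TM2.step, execStmt, tapes]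

/-- By `hi` the letters of the first word end where `i` begins. The letters of the certificate stay
on the input stack and later serve as choices. -/
theorem steps_load (x : List Bool) (i : List (Bool ⊕ Bool)) (t : List Bool) (v : Mem P)
    (hi : ∀ a i', i ≠ .inl a :: i') {m : ℕ} {c : Cfg P}
    (h : Steps P X e m ⟨some .unload, (none, none), tapes i [] (x.reverse ++ t) [] fun _ => []⟩ c) :
    Steps P X e (m + x.length + 1)
      ⟨some .load, v, tapes (x.map .inl ++ i) [] t [] fun _ => []⟩ c := by
  induction x generalizing t v with
  | nil =>
    refine Steps.head ?_ h
    rcases i with _ | ⟨a | a, i⟩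
    · simp [code, Turing.TM2.step, tapes]
    · exact absurd rfl (hi a i)
    · simp [code, Turing.TM2.step, tapes]
  | cons a x ih =>
    refine Steps.head ?_ (ih (a :: t) (none, some a) (by simpa using h))
    simp [code, Turing.TM2.step, tapes, update_tapes_inp, update_tapes_tmp]

/-- This second reversal restores the order of the input word. -/
theorem steps_unload (t : List Bool) (i : List (Bool ⊕ Bool)) (s : K → List Γ) (v : Mem P)
    {m : ℕ} {c : Cfg P}
    (h : Steps P X e m ⟨some .main, (none, none), tapes i [] [] [⟨P, self_mem_sub P⟩]
      (Function.update s X (t.reverse.map e ++ s X))⟩ c) :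
    Steps P X e (m + t.length + 1) ⟨some .unload, v, tapes i [] t [] s⟩ c := by
  induction t generalizing s v with
  | nil =>
    refine Steps.head ?_ h
    simp [code, Turing.TM2.step, tapes, update_tapes_tmp, update_tapes_ctl]
  | cons a t ih =>
    refine Steps.head ?_ (ih (Function.update s X (e a :: s X)) (none, some a)
      (by simpa using h))
    simp [code, Turing.TM2.step, tapes, update_tapes_tmp, update_tapes_wrk]

/-- The machine that runs a program, with a word written on the work stack `X` in the beginning. -/
noncomputable def machine (P : Prog K Γ) (X : K) (e : Bool → Γ) : Turing.FinTM2 where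
  K := Tape K
  k₀ := .inp
  k₁ := .out
  Γ := Alphabet P
  Λ := Label P
  main := .load
  σ := Mem P
  initialState := (none, none)
  Γk₀Fin := inferInstanceAs (Fintype (Bool ⊕ Bool))
  m := code P X e

/-- The stacks in the beginning of the run of a program on a word. -/
def initStacks (X : K) (e : Bool → Γ) (x : List Bool) : K → List Γ :=
  Function.update (fun _ => []) X (x.map e)

/-- The verifier given by a program. -/
def verifier (P : Prog K Γ) (X : K) (e : Bool → Γ) (w : Word × Word) : Bool :=
  interp [P] w.2 (initStacks X e w.1)

theorem steps_verifier (P : Prog K Γ) (X : K) (e : Bool → Γ) (x y : Word) :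
    ∃ n ≤ 8 * (x.length + y.length) + 8, Steps P X e n
      ⟨some .load, (none, none), tapes (x.map .inl ++ y.map .inr) [] [] [] fun _ => []⟩
      (haltCfg P (verifier P X e (x, y))) := by
  obtain ⟨n, hn, h⟩ := steps_main (P := P) (X := X) (e := e) y [⟨P, self_mem_sub P⟩]
    (initStacks X e x) (none, none) (x.length + y.length + 1) (by simp; omega)
    (fun k => by
      by_cases hk : k = X
      · subst hk; simp [initStacks]
      · simp [initStacks, hk]; omega)
  refine ⟨_, ?_, steps_load x (y.map .inr) [] (none, none)
    (by rintro a i' h; cases y <;> simp at h)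
    (steps_unload (x.reverse ++ []) _ _ _ (by simpa [initStacks, verifier] using h))⟩
  simp; omega

theorem verifier_computable (P : Prog K Γ) (X : K) (e : Bool → Γ) :
    Nonempty (Turing.TM2ComputableInPolyTime encodeWordPair Computability.encodeBool
      (verifier P X e)) := by
  have h : ∀ w : Word × Word, Nonempty (Turing.TM2OutputsInTime (machine P X e)
      ((encodeWordPair w).map (Equiv.refl (Bool ⊕ Bool)).invFun)
      (some ((Computability.encodeBool (verifier P X e w)).map (Equiv.refl Bool).invFun))
      ((8 * Polynomial.X + 8 : Polynomial ℕ).eval (encodeWordPair w).length)) := by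
    rintro ⟨x, y⟩
    obtain ⟨n, hn, h⟩ := steps_verifier P X e x y
    refine ⟨⟨⟨n, ?_⟩, ?_⟩⟩
    · have h₁ : Turing.initList (machine P X e)
          ((encodeWordPair (x, y)).map (Equiv.refl (Bool ⊕ Bool)).invFun) =
          ⟨some .load, (none, none),
            tapes (x.map .inl ++ y.map .inr) [] [] [] fun _ => []⟩ := by
        simp only [Turing.initList, machine]
        congr 1
        funext k
        cases k <;> simp [tapes, encodeWordPair, Computability.encodingProd,
          Computability.encodingList]
        rfl
      have h₂ : Turing.haltList (machine P X e)
          ((Computability.encodeBool (verifier P X e (x, y))).map (Equiv.refl Bool).invFun) =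
          haltCfg P (verifier P X e (x, y)) := by
        simp only [Turing.haltList, machine, haltCfg]
        congr 1
        funext k
        cases k <;> simp [tapes, Computability.encodeBool]
        rfl
      rw [Option.map_some, h₁, h₂]
      exact h
    · simpa [encodeWordPair, Computability.encodingProd, Computability.encodingList] using hn
  exact ⟨{ tm := machine P X e
           inputAlphabet := Equiv.refl _
           outputAlphabet := Equiv.refl _
           time := 8 * Polynomial.X + 8
           outputsFun := fun w => (h w).some }⟩

/-- Membership in `NP` by means of a nondeterministic stack program. -/
theorem mem_NP (P : Prog K Γ) (X : K) (e : Bool → Γ) (L : Set Word) (p : Polynomial ℕ)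
    (complete : ∀ x ∈ L, ∃ n ≤ p.eval x.length, ∃ s', P.Run n (initStacks X e x) s')
    (sound : ∀ x n s', P.Run n (initStacks X e x) s' → x ∈ L) : L ∈ NP := by
  refine ⟨verifier P X e, p, verifier_computable P X e, fun x => ⟨fun hx => ?_, ?_⟩⟩
  · obtain ⟨n, hn, s', h⟩ := complete x hx
    obtain ⟨w, hw, h'⟩ := h.interp (c := []) (y := []) (by simp [interp])
    exact ⟨w, hw ▸ hn, by simpa [verifier] using h'⟩
  · rintro ⟨y, -, hy⟩
    rcases runList_of_interp hy with _ | ⟨h, -⟩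
    exact sound x _ _ h

end Prog
end SymBreak

namespace SymBreak
namespace Prog

variable {K Γ : Type} [DecidableEq K]

/-! ### Reasoning about programs -/

/-- The program can lead from the stacks `s` to the stacks `s'`. -/
def Rel (P : Prog K Γ) (s s' : K → List Γ) : Prop := ∃ n, P.Run n s s'

/-- The program can lead from the stacks `s` to the stacks `s'` within `c` steps. -/
def To (P : Prog K Γ) (c : ℕ) (s s' : K → List Γ) : Prop := ∃ n ≤ c, P.Run n s s'

/-- Sequential composition of programs. -/
infixr:65 " ;; " => Prog.seq

section Basic

variable {P Q : Prog K Γ} {c d : ℕ} {k : K} {a : Γ} {p : Option Γ → Bool} {s s' s'' : K → List Γ}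

theorem rel_push : Rel (push k a) s s' ↔ s' = Function.update s k (a :: s k) :=
  ⟨fun ⟨_, h⟩ => by cases h; rfl, fun h => h ▸ ⟨1, .push k a s⟩⟩

theorem rel_drop : Rel (drop k) s s' ↔ s' = Function.update s k (s k).tail :=
  ⟨fun ⟨_, h⟩ => by cases h; rfl, fun h => h ▸ ⟨1, .drop k s⟩⟩

theorem rel_test : Rel (test k p) s s' ↔ p (s k).head? = true ∧ s' = s :=
  ⟨fun ⟨_, h⟩ => by cases h; exact ⟨‹_›, rfl⟩, fun ⟨h, h'⟩ => by subst h'; exact ⟨1, .test k p s' h⟩⟩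

theorem rel_seq : Rel (P ;; Q) s s'' ↔ ∃ s', Rel P s s' ∧ Rel Q s' s'' :=
  ⟨fun ⟨_, h⟩ => by cases h; exact ⟨_, ⟨_, ‹_›⟩, ⟨_, ‹_›⟩⟩,
    fun ⟨_, ⟨_, h⟩, ⟨_, h'⟩⟩ => ⟨_, .seq h h'⟩⟩

theorem rel_alt : Rel (alt P Q) s s' ↔ Rel P s s' ∨ Rel Q s s' :=
  ⟨fun ⟨_, h⟩ => by
    cases h
    · exact .inl ⟨_, ‹_›⟩
    · exact .inr ⟨_, ‹_›⟩,
    fun h => by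
      rcases h with ⟨_, h⟩ | ⟨_, h⟩
      · exact ⟨_, .altl h⟩
      · exact ⟨_, .altr h⟩⟩

theorem rel_star : Rel (star P) s s' ↔ Relation.ReflTransGen (Rel P) s s' := by
  constructor
  · rintro ⟨n, h⟩
    generalize hQ : star P = Q at h
    induction h with
    | nil => exact .refl
    | cons h₁ _ _ ih =>
      cases hQ
      exact .head ⟨_, h₁⟩ (ih rfl)
    | _ => cases hQ
  · intro h
    induction h using Relation.ReflTransGen.head_induction_on with
    | refl => exact ⟨_, .nil⟩
    | head h₁ _ ih =>
      obtain ⟨_, h₁⟩ := h₁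
      obtain ⟨_, h₂⟩ := ih
      exact ⟨_, .cons h₁ h₂⟩

theorem star_induction {Inv : (K → List Γ) → Prop} (h : Rel (star P) s s') (h₀ : Inv s)
    (hP : ∀ s s', Inv s → Rel P s s' → Inv s') : Inv s' := by
  rw [rel_star] at h
  induction h with
  | refl => exact h₀
  | tail _ h ih => exact hP _ _ ih h

theorem To.mono (h : To P c s s') (hcd : c ≤ d) : To P d s s' :=
  let ⟨n, hn, h⟩ := h; ⟨n, hn.trans hcd, h⟩

theorem To.cast (h : To P c s s') (hcd : c ≤ d) (hs : s' = s'') : To P d s s'' :=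
  hs ▸ h.mono hcd

theorem to_push : To (push k a) 1 s (Function.update s k (a :: s k)) := ⟨1, le_rfl, .push k a s⟩

theorem to_drop : To (drop k) 1 s (Function.update s k (s k).tail) := ⟨1, le_rfl, .drop k s⟩

theorem to_test (h : p (s k).head? = true) : To (test k p) 1 s s := ⟨1, le_rfl, .test k p s h⟩

theorem To.seq (h : To P c s s') (h' : To Q d s' s'') : To (P ;; Q) (c + d + 1) s s'' :=
  let ⟨_, hm, h⟩ := h
  let ⟨_, hn, h'⟩ := h'
  ⟨_, by omega, .seq h h'⟩

theorem To.altl (h : To P c s s') : To (alt P Q) (c + 1) s s' :=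
  let ⟨_, hm, h⟩ := h; ⟨_, by omega, .altl h⟩

theorem To.altr (h : To Q c s s') : To (alt P Q) (c + 1) s s' :=
  let ⟨_, hm, h⟩ := h; ⟨_, by omega, .altr h⟩

theorem to_star_nil : To (star P) 1 s s := ⟨1, le_rfl, .nil⟩

theorem To.star_cons (h : To P c s s') (h' : To (star P) d s' s'') :
    To (star P) (c + d + 1) s s'' :=
  let ⟨_, hm, h⟩ := h
  let ⟨_, hn, h'⟩ := h'
  ⟨_, by omega, .cons h h'⟩

theorem to_star (n : ℕ) (σ : ℕ → K → List Γ) (h : ∀ i < n, To P c (σ i) (σ (i + 1))) :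
    To (star P) (n * (c + 1) + 1) (σ 0) (σ n) := by
  induction n generalizing σ with
  | zero => simpa using to_star_nil
  | succ n ih =>
    refine ((h 0 (by omega)).star_cons
      (ih (fun i => σ (i + 1)) fun i hi => h (i + 1) (by omega))).mono ?_
    rw [Nat.succ_mul]; omega

/-- One step pushes at most one letter. This later bounds the length of a generated formula by the
time of its generation. -/
theorem Run.length_le {n : ℕ} (h : P.Run n s s') (k : K) : (s' k).length ≤ (s k).length + n := by
  induction h with
  | push k' a s =>
    by_cases hk : k = k'
    · subst hk; simp
    · simp [hk]
  | drop k' s =>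
    by_cases hk : k = k'
    · subst hk; simp; omega
    · simp [hk]
  | test | nil => omega
  | altl | altr => omega
  | seq | cons => omega

end Basic

/-! ### Composite programs -/

variable {c d n : ℕ} {k u v : K} {a : Γ} {A l l' r : List Γ} {s s' : K → List Γ}

/-- The program that is always blocked. -/
def fail (k : K) : Prog K Γ := test k fun _ => false

/-- The program that does nothing. -/
def skip (k : K) : Prog K Γ := test k fun _ => true

/-- Check that a stack is empty. -/
def emp (k : K) : Prog K Γ := test k Option.isNone

/-- Check that a stack is not empty. -/
def nonemp (k : K) : Prog K Γ := test k Option.isSome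

open Classical in
/-- Pop a given letter. -/
noncomputable def pop (k : K) (a : Γ) : Prog K Γ := test k (fun o => decide (o = some a)) ;; drop k

/-- The alternative between the programs in a list. -/
def altL (k : K) (L : List (Prog K Γ)) : Prog K Γ := L.foldr alt (fail k)

/-- Push the letters of a list, the last one first. -/
def pushL (k : K) : List Γ → Prog K Γ
  | [] => skip k
  | a :: l => pushL k l ;; push k a

/-- Move one letter out of a list from the stack `u` to the stack `v`. -/
noncomputable def move (A : List Γ) (u v : K) : Prog K Γ :=
  altL u (A.map fun a => pop u a ;; push v a)

/-- Move letters out of a list from the stack `u` to the stack `v`. -/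
noncomputable def transfer (A : List Γ) (u v : K) : Prog K Γ := star (move A u v)

theorem rel_fail : ¬ Rel (fail k) s s' := by simp [fail, rel_test]

theorem rel_skip : Rel (skip k) s s' ↔ s' = s := by simp [skip, rel_test]

theorem rel_emp : Rel (emp k) s s' ↔ s k = [] ∧ s' = s := by
  cases h : s k <;> simp [emp, rel_test, h]

theorem to_emp (h : s k = []) : To (emp k) 1 s s := to_test (by simp [h])

theorem rel_nonemp : Rel (nonemp k) s s' ↔ s k ≠ [] ∧ s' = s := by
  cases h : s k <;> simp [nonemp, rel_test, h]

theorem to_nonemp (h : s k ≠ []) : To (nonemp k) 1 s s :=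
  to_test (by cases h' : s k <;> simp_all)

theorem rel_pop : Rel (pop k a) s s' ↔ ∃ l, s k = a :: l ∧ s' = Function.update s k l := by
  cases h : s k <;> simp [pop, rel_seq, rel_test, rel_drop, h]

theorem to_pop (h : s k = a :: l) : To (pop k a) 3 s (Function.update s k l) := by
  have h' := (to_drop (k := k) (s := s))
  rw [h] at h'
  exact (to_test (by simp [h])).seq h'

theorem rel_altL {L : List (Prog K Γ)} : Rel (altL k L) s s' ↔ ∃ P ∈ L, Rel P s s' := by
  induction L with
  | nil => simp [altL, rel_fail]
  | cons P L ih =>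
    rw [altL] at ih
    simp [altL, rel_alt, ih]

theorem to_altL {L : List (Prog K Γ)} {P : Prog K Γ} (hP : P ∈ L) (h : To P c s s') :
    To (altL k L) (c + L.length) s s' := by
  induction L with
  | nil => simp at hP
  | cons Q L ih =>
    rcases List.mem_cons.1 hP with rfl | hP
    · exact h.altl.mono (by simp)
    · exact (ih hP).altr

theorem rel_pushL : Rel (pushL k l) s s' ↔ s' = Function.update s k (l ++ s k) := by
  induction l generalizing s' with
  | nil => simp [pushL, rel_skip]
  | cons a l ih => simp [pushL, rel_seq, ih, rel_push]

theorem to_pushL : To (pushL k l) (2 * l.length + 1) s (Function.update s k (l ++ s k)) := by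
  induction l with
  | nil => exact (to_test rfl).mono le_rfl |> fun h => by simpa [pushL, skip] using h
  | cons a l ih =>
    have h := ih.seq (to_push (k := k) (a := a))
    simp only [Function.update_self, Function.update_idem] at h
    exact h.mono (by simp; omega)

theorem rel_move : Rel (move A u v) s s' ↔ ∃ a ∈ A, ∃ l, s u = a :: l ∧
    s' = Function.update (Function.update s u l) v (a :: Function.update s u l v) := by
  simp only [move, rel_altL, List.mem_map, exists_exists_and_eq_and, rel_seq, rel_pop, rel_push]
  constructor
  · rintro ⟨a, ha, _, ⟨l, h, rfl⟩, rfl⟩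
    exact ⟨a, ha, l, h, rfl⟩
  · rintro ⟨a, ha, l, h, rfl⟩
    exact ⟨a, ha, _, ⟨l, h, rfl⟩, rfl⟩

theorem to_move (huv : u ≠ v) (h : s u = a :: l) (ha : a ∈ A) : To (move A u v) (A.length + 5) s
    (Function.update (Function.update s u l) v (a :: s v)) := by
  have h' := (to_pop h).seq (to_push (k := v) (a := a))
  rw [Function.update_of_ne huv.symm] at h'
  exact (to_altL (List.mem_map_of_mem ha) h').mono (by simp; omega)

/-- The number of moved letters is a free choice, so only some prefix is known to have moved.
Programs fix it by a test of the next letter on `u`. -/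
theorem rel_transfer (huv : u ≠ v) (h : Rel (transfer A u v) s s') :
    ∃ l r, s u = l ++ r ∧ (∀ a ∈ l, a ∈ A) ∧
      s' = Function.update (Function.update s u r) v (l.reverse ++ s v) := by
  refine star_induction (Inv := fun s' => ∃ l r, s u = l ++ r ∧ (∀ a ∈ l, a ∈ A) ∧
      s' = Function.update (Function.update s u r) v (l.reverse ++ s v)) h ⟨[], s u, by simp⟩ ?_
  rintro s₁ s₂ ⟨l, r, h₁, h₂, rfl⟩ h₃
  obtain ⟨a, ha, r', h₄, rfl⟩ := rel_move.1 h₃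
  simp only [ne_eq, huv, not_false_eq_true, Function.update_of_ne, Function.update_self] at h₄
  subst h₄
  refine ⟨l ++ [a], r', by simp [h₁], ?_, ?_⟩
  · intro b hb
    rcases List.mem_append.1 hb with hb | hb
    · exact h₂ b hb
    · rw [List.mem_singleton.1 hb]; exact ha
  · funext k
    by_cases hv : k = v
    · subst hv; simp [huv.symm]
    · by_cases hu : k = u
      · subst hu; simp [hv]
      · simp [hv, hu]

theorem to_transfer (huv : u ≠ v) (h : s u = l ++ r) (hl : ∀ a ∈ l, a ∈ A) :
    To (transfer A u v) ((A.length + 6) * l.length + 1) s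
      (Function.update (Function.update s u r) v (l.reverse ++ s v)) := by
  induction l generalizing s with
  | nil =>
    have : Function.update (Function.update s u r) v (([] : List Γ).reverse ++ s v) = s := by
      rw [List.nil_append] at h
      simp [← h]
    rw [this]
    exact to_star_nil
  | cons a l ih =>
    have h₁ := to_move huv h (hl a (by simp))
    have h₂ := ih (s := Function.update (Function.update s u (l ++ r)) v (a :: s v))
      (by simp [huv]) (fun b hb => hl b (List.mem_cons_of_mem _ hb))
    have h₃ := h₁.star_cons h₂
    have h₄ : Function.update (Function.update
        (Function.update (Function.update s u (l ++ r)) v (a :: s v)) u r) v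
        (l.reverse ++ Function.update (Function.update s u (l ++ r)) v (a :: s v) v) =
        Function.update (Function.update s u r) v ((a :: l).reverse ++ s v) := by
      funext k
      by_cases hv : k = v
      · subst hv; simp
      · by_cases hu : k = u
        · subst hu; simp [hv]
        · simp [hv, hu]
    rw [h₄] at h₃
    exact h₃.mono (by simp only [List.length_cons]; ring_nf; omega)

/-- Move all letters, which have to be from a list, from the stack `u` to the stack `v`. -/
noncomputable def moveAll (A : List Γ) (u v : K) : Prog K Γ := transfer A u v ;; emp u

theorem rel_moveAll (huv : u ≠ v) (h : Rel (moveAll A u v) s s') :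
    (∀ a ∈ s u, a ∈ A) ∧
      s' = Function.update (Function.update s u []) v ((s u).reverse ++ s v) := by
  obtain ⟨s₁, h₁, h₂⟩ := rel_seq.1 h
  obtain ⟨l, r, h₃, h₄, rfl⟩ := rel_transfer huv h₁
  obtain ⟨h₅, rfl⟩ := rel_emp.1 h₂
  have : r = [] := by simpa [huv] using h₅
  subst this
  rw [List.append_nil] at h₃
  rw [h₃]
  exact ⟨h₄, rfl⟩

theorem to_moveAll (huv : u ≠ v) (h : ∀ a ∈ s u, a ∈ A) :
    To (moveAll A u v) ((A.length + 6) * (s u).length + 3) s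
      (Function.update (Function.update s u []) v ((s u).reverse ++ s v)) :=
  ((to_transfer huv (List.append_nil _).symm h).seq (to_emp (by simp [huv]))).mono (by omega)

end Prog
end SymBreak

/-! ### Alphabet, stacks and counters of the verifier -/

namespace SymBreak

/-- The letters of the programs that use a machine. -/
inductive Letter (tm : Turing.FinTM2) : Type
  | bit (b : Bool)
  | sgn (b : Bool)
  | sep
  | st (l : Option tm.Λ) (v : tm.σ)
  | m (k : tm.K) (a : tm.Γ k)

/-- The stacks of the programs that use a machine with stacks `K`. -/
inductive Reg (K : Type) : Type
  | x
  | i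
  | i'
  | j
  | j'
  | t
  | c
  | c'
  | w (b : Bool)
  | ctl
  | m (k : K)
  deriving DecidableEq, Fintype

namespace Prog

open Letter

variable {tm : Turing.FinTM2} {K : Type} [DecidableEq K]

/-! ### Loops -/

/-- A word as a list of letters. -/
abbrev bits (l : List Bool) : List (Letter tm) := l.map bit

/-- A counter with the value `n`. -/
abbrev zeros (n : ℕ) : List (Letter tm) := List.replicate n (bit false)

/-- The position `i` in a range of length `n`. -/
abbrev oneHot (n i : ℕ) : List (Letter tm) := zeros i ++ bit true :: zeros (n - 1 - i)

/-- The contents of two stacks is changed. -/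
def upd (s : K → List (Letter tm)) (u v : K) (l l' : List (Letter tm)) : K → List (Letter tm) :=
  Function.update (Function.update s u l) v l'

section upd

variable {u v k : K} {s : K → List (Letter tm)} {l l' r r' : List (Letter tm)}

theorem upd_left (huv : u ≠ v) : upd s u v l l' u = l := by simp [upd, huv]

theorem upd_right : upd s u v l l' v = l' := by simp [upd]

theorem update_upd_left (huv : u ≠ v) :
    Function.update (upd s u v l l') u r = upd s u v r l' := by
  rw [upd, upd, Function.update_comm huv.symm, Function.update_idem]

theorem update_upd_right : Function.update (upd s u v l l') v r = upd s u v l r := by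
  rw [upd, upd, Function.update_idem]

theorem upd_eq_self (h : s u = l) (h' : s v = l') : upd s u v l l' = s := by
  subst h; subst h'; simp [upd]

end upd

/-- Run a program for each position in the range given by the counter on the stack `u`; in each
round the position is on this stack. -/
noncomputable def loop (u v : K) (B : Prog K (Letter tm)) : Prog K (Letter tm) :=
  star (pop u (bit false) ;; push u (bit true) ;; moveAll [bit false] v u ;; B ;;
    transfer [bit false] u v ;; pop u (bit true) ;; push v (bit false)) ;;
  emp u ;; moveAll [bit false] v u

variable {u v : K} {B : Prog K (Letter tm)} {n c : ℕ}

/-- The transfer of zeros in `loop` may stop anywhere, but the letter popped next has to be the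
unique one. -/
theorem zeros_split {i m : ℕ} {l r : List (Letter tm)}
    (h : zeros i ++ bit true :: zeros m = l ++ bit true :: r) (hl : ∀ a ∈ l, a = bit false) :
    l = zeros i ∧ r = zeros m := by
  induction i generalizing l with
  | zero =>
    cases l with
    | nil => simpa using h.symm
    | cons a l => simp [hl a (by simp)] at h
  | succ i ih =>
    cases l with
    | nil => simp [List.replicate_succ] at h
    | cons a l =>
      simp only [zeros, List.replicate_succ, List.cons_append, List.cons.injEq] at h
      obtain ⟨h₁, h₂⟩ := ih h.2 fun b hb => hl b (List.mem_cons_of_mem _ hb)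
      rw [h₁, h₂, ← h.1]
      exact ⟨by simp [zeros, List.replicate_succ], rfl⟩

/-- The invariant is evaluated at stacks whose contents at `u` and `v` are overridden by `upd`. The
body may read the position on `u`, but has to leave it there and to leave `v` empty. -/
theorem loop_sound (huv : u ≠ v) (Inv : ℕ → (K → List (Letter tm)) → Prop)
    {s s' : K → List (Letter tm)}
    (hB : ∀ i < n, ∀ s s', Inv i s → Rel B (upd s u v (oneHot n i) []) s' →
      ∃ s'', Inv (i + 1) s'' ∧ s' = upd s'' u v (oneHot n i) [])
    (h₀ : Inv 0 s) (h : Rel (loop u v B) (upd s u v (zeros n) []) s') :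
    ∃ s'', Inv n s'' ∧ s' = upd s'' u v (zeros n) [] := by
  obtain ⟨s₁, h₁, h⟩ := rel_seq.1 h
  -- Between two rounds the completed rounds are counted by zeros on `v` and the outstanding ones by
  -- zeros on `u`.
  obtain ⟨i, hi, s₂, h₂, rfl⟩ : ∃ i ≤ n, ∃ s₂, Inv i s₂ ∧
      s₁ = upd s₂ u v (zeros (n - i)) (zeros i) := by
    refine star_induction (Inv := fun s₁ => ∃ i ≤ n, ∃ s₂, Inv i s₂ ∧
      s₁ = upd s₂ u v (zeros (n - i)) (zeros i)) h₁ ⟨0, by omega, s, h₀, by simp⟩ ?_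
    rintro _ s₃ ⟨i, hi, s₂, h₂, rfl⟩ h₃
    simp only [rel_seq, rel_pop, rel_push] at h₃
    obtain ⟨_, ⟨l, h₄, rfl⟩, _, rfl, _, h₅, s₄, h₆, s₅, h₇, _, ⟨r, h₈, rfl⟩, rfl⟩ := h₃
    obtain ⟨m, hm⟩ : ∃ m, n - i = m + 1 := by
      refine ⟨n - i - 1, ?_⟩
      by_contra hc
      have : n - i = 0 := by omega
      simp [this, upd_left huv] at h₄
    rw [upd_left huv, hm, zeros, List.replicate_succ] at h₄
    obtain rfl := (List.cons.inj h₄).2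
    obtain ⟨-, rfl⟩ := rel_moveAll huv.symm h₅
    simp only [update_upd_left huv, update_upd_right, upd_left huv, upd_right,
      List.reverse_replicate] at h₆
    obtain ⟨s₆, h₉, rfl⟩ := hB i (by omega) s₂ s₄ h₂
      (by rwa [show oneHot n i = zeros i ++ bit true :: List.replicate m (bit false) by
        rw [oneHot, show n - 1 - i = m by omega]])
    obtain ⟨l, r', h₁₀, h₁₁, rfl⟩ := rel_transfer huv h₇
    simp only [update_upd_left huv, update_upd_right, upd_left huv, upd_right] at h₈ h₁₀ ⊢
    subst h₈
    obtain ⟨rfl, rfl⟩ := zeros_split h₁₀ (by simpa using h₁₁)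
    refine ⟨i + 1, by omega, s₆, h₉, ?_⟩
    simp [zeros, List.replicate_succ, show n - 1 - i = n - (i + 1) by omega]
  simp only [rel_seq, rel_emp] at h
  obtain ⟨_, ⟨h₃, rfl⟩, h₄⟩ := h
  obtain ⟨-, rfl⟩ := rel_moveAll huv.symm h₄
  rw [upd_left huv] at h₃
  have : i = n := by simp [zeros] at h₃; omega
  subst this
  refine ⟨s₂, h₂, ?_⟩
  simp [update_upd_left huv, update_upd_right, upd_left huv, upd_right]

/-- A bound for the running time of a loop. -/
def loopCost (n c : ℕ) : ℕ := (n + 1) * (c + 14 * n + 30)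

theorem to_loop (huv : u ≠ v) (σ : ℕ → K → List (Letter tm))
    (hB : ∀ i < n, To B c (upd (σ i) u v (oneHot n i) []) (upd (σ (i + 1)) u v (oneHot n i) [])) :
    To (loop u v B) (loopCost n c) (upd (σ 0) u v (zeros n) []) (upd (σ n) u v (zeros n) []) := by
  -- In each round fewer than `n` zeros travel from `v` to `u` and back, at 7 steps per letter and
  -- direction; this is the term `14 * n`.
  have h₁ := to_star (P := pop u (bit false) ;; push u (bit true) ;; moveAll [bit false] v u ;; B ;;
    transfer [bit false] u v ;; pop u (bit true) ;; push v (bit false)) (c := c + 14 * n + 20) n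
    (fun i => upd (σ i) u v (zeros (n - i)) (zeros i)) ?_
  · have h₂ : To (emp u) 1 (upd (σ n) u v (zeros (n - n)) (zeros n))
        (upd (σ n) u v (zeros (n - n)) (zeros n)) := to_emp (by simp [upd_left huv])
    have h₃ := h₂.seq (to_moveAll (A := [bit false]) huv.symm
      (by simp [upd_right]))
    have h₄ := h₁.seq h₃
    simp only [Nat.sub_zero, zeros, List.replicate_zero, Nat.sub_self, upd_right, upd_left huv,
      update_upd_left huv, update_upd_right, List.reverse_replicate, List.append_nil,
      List.length_replicate, List.length_singleton] at h₄
    refine h₄.mono ?_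
    simp only [loopCost]
    nlinarith
  · intro i hi
    obtain ⟨m, rfl⟩ : ∃ m, n = i + m + 1 := ⟨n - i - 1, by omega⟩
    have e₁ : i + m + 1 - i = m + 1 := by omega
    have e₂ : i + m + 1 - (i + 1) = m := by omega
    have e₃ : i + m + 1 - 1 - i = m := by omega
    have hB' := hB i (by omega)
    simp only [oneHot, e₃] at hB'
    simp only [e₁, e₂]
    have h₁ : To (pop u (bit false)) 3 (upd (σ i) u v (zeros (m + 1)) (zeros i))
        (upd (σ i) u v (zeros m) (zeros i)) := by
      have := to_pop (k := u) (s := upd (σ i) u v (zeros (m + 1)) (zeros i))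
        (a := (bit false : Letter tm)) (l := zeros m) (by simp [upd_left huv, List.replicate_succ])
      rwa [update_upd_left huv] at this
    have h₂ : To (push u (bit true)) 1 (upd (σ i) u v (zeros m) (zeros i))
        (upd (σ i) u v (bit true :: zeros m) (zeros i)) := by
      have := to_push (k := u) (s := upd (σ i) u v (zeros m) (zeros i))
        (a := (bit true : Letter tm))
      rwa [update_upd_left huv, upd_left huv] at this
    have h₃ : To (moveAll [bit false] v u) (7 * i + 3)
        (upd (σ i) u v (bit true :: zeros m) (zeros i))
        (upd (σ i) u v (zeros i ++ bit true :: zeros m) []) := by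
      have := to_moveAll (A := [bit false]) (s := upd (σ i) u v (bit true :: zeros m) (zeros i))
        huv.symm (by simp [upd_right])
      simpa [update_upd_left huv, update_upd_right, upd_left huv, upd_right] using this
    have h₄ : To (transfer [bit false] u v) (7 * i + 1)
        (upd (σ (i + 1)) u v (zeros i ++ bit true :: zeros m) [])
        (upd (σ (i + 1)) u v (bit true :: zeros m) (zeros i)) := by
      have := to_transfer (A := [bit false])
        (s := upd (σ (i + 1)) u v (zeros i ++ bit true :: zeros m) [])
        huv (upd_left huv) (by simp)
      simpa [update_upd_left huv, update_upd_right, upd_left huv, upd_right] using this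
    have h₅ : To (pop u (bit true)) 3 (upd (σ (i + 1)) u v (bit true :: zeros m) (zeros i))
        (upd (σ (i + 1)) u v (zeros m) (zeros i)) := by
      have := to_pop (k := u) (s := upd (σ (i + 1)) u v (bit true :: zeros m) (zeros i))
        (a := (bit true : Letter tm)) (l := zeros m) (by simp [upd_left huv])
      rwa [update_upd_left huv] at this
    have h₆ : To (push v (bit false)) 1 (upd (σ (i + 1)) u v (zeros m) (zeros i))
        (upd (σ (i + 1)) u v (zeros m) (zeros (i + 1))) := by
      have := to_push (k := v) (s := upd (σ (i + 1)) u v (zeros m) (zeros i))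
        (a := (bit false : Letter tm))
      rwa [update_upd_right, upd_right] at this
    exact (h₁.seq (h₂.seq (h₃.seq (hB'.seq (h₄.seq (h₅.seq h₆)))))).mono (by omega)

end Prog
end SymBreak

namespace SymBreak
namespace Prog

open Letter

/-! ### Walks along lists -/

section Walk

variable {K Γ α : Type} [DecidableEq K] {B : Prog K Γ} {c : ℕ}

/-- `F p l` are the stacks when the elements of `p` have been processed, the latest one first, and
those of `l` are still to come. -/
theorem walk_sound (F : List α → List α → K → List Γ)
    (hB : ∀ p l s', Rel B (F p l) s' → ∃ a l', l = a :: l' ∧ s' = F (a :: p) l')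
    {p l : List α} {s' : K → List Γ} (h : Rel (star B) (F p l) s') :
    ∃ l₁ l₂, l = l₁ ++ l₂ ∧ s' = F (l₁.reverse ++ p) l₂ := by
  refine star_induction (Inv := fun s' => ∃ l₁ l₂, l = l₁ ++ l₂ ∧ s' = F (l₁.reverse ++ p) l₂) h
    ⟨[], l, by simp⟩ ?_
  rintro _ s₂ ⟨l₁, l₂, rfl, rfl⟩ h'
  obtain ⟨a, l', rfl, rfl⟩ := hB _ _ _ h'
  exact ⟨l₁ ++ [a], l', by simp⟩

theorem to_walk (F : List α → List α → K → List Γ) {p l₁ l₂ : List α}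
    (hB : ∀ p a l, a ∈ l₁ → To B c (F p (a :: l)) (F (a :: p) l)) :
    To (star B) (l₁.length * (c + 1) + 1) (F p (l₁ ++ l₂)) (F (l₁.reverse ++ p) l₂) := by
  induction l₁ generalizing p with
  | nil => simpa using to_star_nil
  | cons a l₁ ih =>
    have h₁ := hB p a (l₁ ++ l₂) (by simp)
    have h₂ := ih (p := a :: p) fun p b l hb => hB p b l (List.mem_cons_of_mem _ hb)
    simpa using (h₁.star_cons h₂).mono
      (by simp only [Nat.succ_mul]; omega)

end Walk

/-! ### The contents of the stacks -/

variable {tm : Turing.FinTM2}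

/-- The contents of the stacks, as a record. -/
@[ext] structure Regs (tm : Turing.FinTM2) where
  x : List (Letter tm)
  i : List (Letter tm)
  i' : List (Letter tm)
  j : List (Letter tm)
  j' : List (Letter tm)
  t : List (Letter tm)
  c : List (Letter tm)
  c' : List (Letter tm)
  w : Bool → List (Letter tm)
  ctl : List (Letter tm)
  m : tm.K → List (Letter tm)

namespace Regs

/-- The stacks with given contents. -/
def st (R : Regs tm) : Reg tm.K → List (Letter tm)
  | .x => R.x
  | .i => R.i
  | .i' => R.i'
  | .j => R.j
  | .j' => R.j'
  | .t => R.t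
  | .c => R.c
  | .c' => R.c'
  | .w b => R.w b
  | .ctl => R.ctl
  | .m k => R.m k

variable (R : Regs tm) (l l' : List (Letter tm))

@[simp] theorem st_x : R.st .x = R.x := rfl
@[simp] theorem st_i : R.st .i = R.i := rfl
@[simp] theorem st_i' : R.st .i' = R.i' := rfl
@[simp] theorem st_j : R.st .j = R.j := rfl
@[simp] theorem st_j' : R.st .j' = R.j' := rfl
@[simp] theorem st_t : R.st .t = R.t := rfl
@[simp] theorem st_c : R.st .c = R.c := rfl
@[simp] theorem st_c' : R.st .c' = R.c' := rfl
@[simp] theorem st_w (b : Bool) : R.st (.w b) = R.w b := rfl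
@[simp] theorem st_ctl : R.st .ctl = R.ctl := rfl
@[simp] theorem st_m (k : tm.K) : R.st (.m k) = R.m k := rfl

@[simp] theorem update_x : Function.update R.st .x l = { R with x := l }.st := by
  funext k; cases k <;> simp [st]
@[simp] theorem update_i : Function.update R.st .i l = { R with i := l }.st := by
  funext k; cases k <;> simp [st]
@[simp] theorem update_i' : Function.update R.st .i' l = { R with i' := l }.st := by
  funext k; cases k <;> simp [st]
@[simp] theorem update_j : Function.update R.st .j l = { R with j := l }.st := by
  funext k; cases k <;> simp [st]
@[simp] theorem update_j' : Function.update R.st .j' l = { R with j' := l }.st := by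
  funext k; cases k <;> simp [st]
@[simp] theorem update_t : Function.update R.st .t l = { R with t := l }.st := by
  funext k; cases k <;> simp [st]
@[simp] theorem update_c : Function.update R.st .c l = { R with c := l }.st := by
  funext k; cases k <;> simp [st]
@[simp] theorem update_c' : Function.update R.st .c' l = { R with c' := l }.st := by
  funext k; cases k <;> simp [st]
@[simp] theorem update_w (b : Bool) :
    Function.update R.st (.w b) l = { R with w := Function.update R.w b l }.st := by
  funext k; cases k <;> simp [st, Function.update_apply]
@[simp] theorem update_ctl : Function.update R.st .ctl l = { R with ctl := l }.st := by
  funext k; cases k <;> simp [st]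
@[simp] theorem update_m (k : tm.K) :
    Function.update R.st (.m k) l = { R with m := Function.update R.m k l }.st := by
  funext k; cases k <;> simp [st, Function.update_apply]

@[simp] theorem upd_i : upd R.st .i .i' l l' = { R with i := l, i' := l' }.st := by
  simp [upd]
@[simp] theorem upd_j : upd R.st .j .j' l l' = { R with j := l, j' := l' }.st := by
  simp [upd]

theorem upd_i_self (h : R.i = l) (h' : R.i' = l') : upd R.st .i .i' l l' = R.st :=
  upd_eq_self h h'
theorem upd_j_self (h : R.j = l) (h' : R.j' = l') : upd R.st .j .j' l l' = R.st :=
  upd_eq_self h h'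

end Regs

/-- The programs that use a machine. -/
abbrev Program (tm : Turing.FinTM2) : Type := Prog (Reg tm.K) (Letter tm)

/-! ### Loops on the counters -/

theorem loop_i_sound {B : Program tm} {n : ℕ} (Inv : ℕ → Regs tm → Prop)
    (hInv : ∀ p R, Inv p R → R.i = zeros n ∧ R.i' = []) {R : Regs tm}
    {s' : Reg tm.K → List (Letter tm)}
    (hB : ∀ p < n, ∀ R s', Inv p R → Rel B { R with i := oneHot n p }.st s' →
      ∃ R', Inv (p + 1) R' ∧ s' = { R' with i := oneHot n p }.st)
    (h₀ : Inv 0 R) (h : Rel (loop .i .i' B) R.st s') : ∃ R', Inv n R' ∧ s' = R'.st := by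
  obtain ⟨_, ⟨R', h₁, rfl⟩, rfl⟩ := loop_sound (by simp) (fun p s => ∃ R, Inv p R ∧ s = R.st)
    (n := n) (u := Reg.i) (v := Reg.i') (B := B) (s' := s') (s := R.st)
    (by
      rintro p hp _ s' ⟨R, hR, rfl⟩ h
      obtain ⟨R', h₁, h₂⟩ := hB p hp R s' hR (by rw [Regs.upd_i] at h; rwa [← (hInv p R hR).2] at h)
      exact ⟨_, ⟨R', h₁, rfl⟩, by rw [Regs.upd_i, h₂, ← (hInv _ R' h₁).2]⟩)
    ⟨R, h₀, rfl⟩ (by rwa [R.upd_i_self _ _ (hInv 0 R h₀).1 (hInv 0 R h₀).2])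
  exact ⟨R', h₁, R'.upd_i_self _ _ (hInv n R' h₁).1 (hInv n R' h₁).2⟩

theorem loop_i_eq {B : Program tm} {n : ℕ} {R : Regs tm} (σ : ℕ → Regs tm)
    (hi : ∀ p, (σ p).i = zeros n) (hi' : ∀ p, (σ p).i' = []) (hR : R = σ 0)
    {s' : Reg tm.K → List (Letter tm)}
    (hB : ∀ p < n, ∀ s', Rel B { σ p with i := oneHot n p }.st s' →
      s' = { σ (p + 1) with i := oneHot n p }.st)
    (h : Rel (loop .i .i' B) R.st s') : s' = (σ n).st := by
  obtain ⟨R', rfl, h⟩ := loop_i_sound (fun p R => R = σ p) (by rintro p _ rfl; exact ⟨hi p, hi' p⟩)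
    (by rintro p hp _ s' rfl h; exact ⟨_, rfl, hB p hp s' h⟩) hR h
  exact h

theorem to_loop_i {B : Program tm} {n c : ℕ} {R R' : Regs tm} (σ : ℕ → Regs tm)
    (hi : ∀ p, (σ p).i = zeros n) (hi' : ∀ p, (σ p).i' = []) (hR : R = σ 0) (hR' : σ n = R')
    (hB : ∀ p < n, To B c { σ p with i := oneHot n p }.st { σ (p + 1) with i := oneHot n p }.st) :
    To (loop .i .i' B) (loopCost n c) R.st R'.st := by
  have h₁ := to_loop (u := Reg.i) (v := Reg.i') (by simp) (fun p => (σ p).st) (n := n) (c := c)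
    (B := B) (by
      intro p hp
      simpa only [Regs.upd_i, hi'] using hB p hp)
  rwa [Regs.upd_i_self _ _ _ (hi 0) (hi' 0), Regs.upd_i_self _ _ _ (hi n) (hi' n), ← hR,
    hR'] at h₁

theorem loop_j_sound {B : Program tm} {n : ℕ} (Inv : ℕ → Regs tm → Prop)
    (hInv : ∀ p R, Inv p R → R.j = zeros n ∧ R.j' = []) {R : Regs tm}
    {s' : Reg tm.K → List (Letter tm)}
    (hB : ∀ p < n, ∀ R s', Inv p R → Rel B { R with j := oneHot n p }.st s' →
      ∃ R', Inv (p + 1) R' ∧ s' = { R' with j := oneHot n p }.st)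
    (h₀ : Inv 0 R) (h : Rel (loop .j .j' B) R.st s') : ∃ R', Inv n R' ∧ s' = R'.st := by
  obtain ⟨_, ⟨R', h₁, rfl⟩, rfl⟩ := loop_sound (by simp) (fun p s => ∃ R, Inv p R ∧ s = R.st)
    (n := n) (u := Reg.j) (v := Reg.j') (B := B) (s' := s') (s := R.st)
    (by
      rintro p hp _ s' ⟨R, hR, rfl⟩ h
      obtain ⟨R', h₁, h₂⟩ := hB p hp R s' hR (by rw [Regs.upd_j] at h; rwa [← (hInv p R hR).2] at h)
      exact ⟨_, ⟨R', h₁, rfl⟩, by rw [Regs.upd_j, h₂, ← (hInv _ R' h₁).2]⟩)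
    ⟨R, h₀, rfl⟩ (by rwa [R.upd_j_self _ _ (hInv 0 R h₀).1 (hInv 0 R h₀).2])
  exact ⟨R', h₁, R'.upd_j_self _ _ (hInv n R' h₁).1 (hInv n R' h₁).2⟩

theorem loop_j_eq {B : Program tm} {n : ℕ} {R : Regs tm} (σ : ℕ → Regs tm)
    (hj : ∀ p, (σ p).j = zeros n) (hj' : ∀ p, (σ p).j' = []) (hR : R = σ 0)
    {s' : Reg tm.K → List (Letter tm)}
    (hB : ∀ p < n, ∀ s', Rel B { σ p with j := oneHot n p }.st s' →
      s' = { σ (p + 1) with j := oneHot n p }.st)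
    (h : Rel (loop .j .j' B) R.st s') : s' = (σ n).st := by
  obtain ⟨R', rfl, h⟩ := loop_j_sound (fun p R => R = σ p) (by rintro p _ rfl; exact ⟨hj p, hj' p⟩)
    (by rintro p hp _ s' rfl h; exact ⟨_, rfl, hB p hp s' h⟩) hR h
  exact h

theorem to_loop_j {B : Program tm} {n c : ℕ} {R R' : Regs tm} (σ : ℕ → Regs tm)
    (hj : ∀ p, (σ p).j = zeros n) (hj' : ∀ p, (σ p).j' = []) (hR : R = σ 0) (hR' : σ n = R')
    (hB : ∀ p < n, To B c { σ p with j := oneHot n p }.st { σ (p + 1) with j := oneHot n p }.st) :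
    To (loop .j .j' B) (loopCost n c) R.st R'.st := by
  have h₁ := to_loop (u := Reg.j) (v := Reg.j') (by simp) (fun p => (σ p).st) (n := n) (c := c)
    (B := B) (by
      intro p hp
      simpa only [Regs.upd_j, hj'] using hB p hp)
  rwa [Regs.upd_j_self _ _ _ (hj 0) (hj' 0), Regs.upd_j_self _ _ _ (hj n) (hj' n), ← hR,
    hR'] at h₁

/-! ### Table entries -/

/-- The letters of a word. -/
abbrev bitLetters : List (Letter tm) := [bit false, bit true]

theorem bits_subset (l : List Bool) : ∀ a ∈ (bits l : List (Letter tm)), a ∈ bitLetters (tm := tm) := by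
  simp only [List.mem_map]
  rintro _ ⟨b, -, rfl⟩
  cases b <;> simp

/-- All pairs of bits. -/
abbrev bitPairs : List (Bool × Bool) := [(false, false), (false, true), (true, false), (true, true)]

/-- Push a combination of the words on the stacks `i` and `j` to the stack `w`. -/
noncomputable def comb (f : Bool → Bool → Bool) (w : Bool) : Program tm :=
  star (altL .x (bitPairs.map fun q => pop .i (bit q.1) ;; pop .j (bit q.2) ;; push .i' (bit q.1) ;;
    push .j' (bit q.2) ;; push (.w w) (bit (f q.1 q.2)))) ;;
  emp .i ;; emp .j ;; moveAll bitLetters .i' .i ;; moveAll bitLetters .j' .j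

/-- The stacks in the course of a combination. -/
def combRegs (R : Regs tm) (f : Bool → Bool → Bool) (w : Bool) (p l : List (Bool × Bool)) :
    Regs tm :=
  { R with
    i := bits (l.map Prod.fst)
    i' := bits (p.map Prod.fst)
    j := bits (l.map Prod.snd)
    j' := bits (p.map Prod.snd)
    w := Function.update R.w w (bits (p.map fun q => f q.1 q.2) ++ R.w w) }

theorem combRegs_nil {R : Regs tm} {f : Bool → Bool → Bool} {w : Bool} {l : List (Bool × Bool)}
    (hi : R.i = bits (l.map Prod.fst)) (hj : R.j = bits (l.map Prod.snd))
    (hi' : R.i' = []) (hj' : R.j' = []) : combRegs R f w [] l = R := by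
  cases R; simp_all [combRegs]

/-- The results are pushed while the two words are read from the front, so they appear reversed.
This is the source of the reversals in `pairVec` and `labels`. The two emptiness tests force the
walk to reach the end. -/
theorem comb_eq {R : Regs tm} {f : Bool → Bool → Bool} {w : Bool} {l : List (Bool × Bool)}
    (hi : R.i = bits (l.map Prod.fst)) (hj : R.j = bits (l.map Prod.snd))
    (hi' : R.i' = []) (hj' : R.j' = []) {s' : Reg tm.K → List (Letter tm)}
    (h : Rel (comb f w) R.st s') :
    s' = { R with
      w := Function.update R.w w (bits (l.map fun q : Bool × Bool => f q.1 q.2).reverse ++ R.w w) }.st := by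
  obtain ⟨s₁, h₁, h⟩ := rel_seq.1 h
  rw [← combRegs_nil (f := f) (w := w) hi hj hi' hj'] at h₁
  obtain ⟨l₁, l₂, rfl, rfl⟩ := walk_sound (fun p l => (combRegs R f w p l).st) (by
    intro p l s' h
    simp only [rel_altL, List.mem_map] at h
    obtain ⟨_, ⟨⟨α, β⟩, -, rfl⟩, h⟩ := h
    simp only [rel_seq, rel_pop, rel_push] at h
    obtain ⟨_, ⟨r₁, h₁, rfl⟩, _, ⟨r₂, h₂, rfl⟩, _, rfl, _, rfl, rfl⟩ := h
    simp only [combRegs, Regs.st_i, Regs.update_i, Regs.st_j] at h₁ h₂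
    cases l with
    | nil => simp at h₁
    | cons q l =>
      simp only [bits, List.map_cons, List.cons.injEq, bit.injEq] at h₁ h₂
      obtain ⟨h₁, rfl⟩ := h₁
      obtain ⟨h₂, rfl⟩ := h₂
      exact ⟨q, l, rfl, by simp [combRegs, ← h₁, ← h₂]⟩) h₁
  simp only [rel_seq, rel_emp] at h
  obtain ⟨_, ⟨h₂, rfl⟩, _, ⟨h₃, rfl⟩, _, h₄, h₅⟩ := h
  obtain ⟨-, rfl⟩ := rel_moveAll (by simp) h₄
  obtain ⟨-, rfl⟩ := rel_moveAll (by simp) h₅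
  have : l₂ = [] := by simpa [combRegs] using h₂
  subst this
  simp [combRegs, hi, hj, hi', hj', ← List.map_reverse]

theorem to_comb {R : Regs tm} {f : Bool → Bool → Bool} {w : Bool} {l : List (Bool × Bool)}
    (hi : R.i = bits (l.map Prod.fst)) (hj : R.j = bits (l.map Prod.snd))
    (hi' : R.i' = []) (hj' : R.j' = []) :
    To (comb f w) (35 * l.length + 20) R.st { R with
      w := Function.update R.w w (bits (l.map fun q : Bool × Bool => f q.1 q.2).reverse ++ R.w w) }.st := by
  have h₁ := to_walk (B := altL .x (bitPairs.map fun q => pop .i (bit q.1) ;; pop .j (bit q.2) ;;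
    push .i' (bit q.1) ;; push .j' (bit q.2) ;; push (.w w) (bit (f q.1 q.2)))) (c := 17)
    (fun p l => (combRegs R f w p l).st) (p := []) (l₁ := l) (l₂ := []) (by
      intro p q l' _
      refine (to_altL (c := 13) (List.mem_map_of_mem (a := q)
        (by rcases q with ⟨_ | _, _ | _⟩ <;> simp)) ?_).mono (by simp)
      have := (to_pop (s := (combRegs R f w p (q :: l')).st) (k := .i)
        (a := bit q.1) (l := bits (l'.map Prod.fst)) rfl).seq
        ((to_pop (k := .j) (a := bit q.2) (l := bits (l'.map Prod.snd)) (by simp [combRegs])).seq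
        ((to_push (k := .i') (a := bit q.1)).seq ((to_push (k := .j') (a := bit q.2)).seq
        (to_push (k := .w w) (a := bit (f q.1 q.2))))))
      simpa [combRegs] using this)
  rw [List.append_nil, List.append_nil, combRegs_nil hi hj hi' hj'] at h₁
  have h₂ := h₁.seq ((to_emp (k := .i) (by simp [combRegs])).seq
    ((to_emp (k := .j) (by simp [combRegs])).seq ((to_moveAll (A := bitLetters) (u := Reg.i') (v := Reg.i)
      (by simp) (fun a ha => bits_subset _ a ha)).seq
      (to_moveAll (A := bitLetters) (u := Reg.j') (v := Reg.j) (by simp)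
      (fun a ha => bits_subset (l.reverse.map Prod.snd) a (by simpa [combRegs] using ha))))))
  refine h₂.cast (by simp [combRegs]; omega) ?_
  simp [combRegs, hi, hj, hi', hj', ← List.map_reverse]

end Prog
end SymBreak

namespace SymBreak
namespace Prog

open Letter

variable {tm : Turing.FinTM2}

/-! ### Reading an adjacency matrix -/

/-- A table entry, which is a signed word, as a list of letters. -/
def entry (e : Bool × List Bool) : List (Letter tm) := sgn e.1 :: (bits e.2 ++ [sep])

/-- A table as a list of letters. -/
def table (E : List (Bool × List Bool)) : List (Letter tm) := E.flatMap entry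

@[simp] theorem table_nil : (table [] : List (Letter tm)) = [] := rfl

@[simp] theorem table_cons (e : Bool × List Bool) (E : List (Bool × List Bool)) :
    (table (e :: E) : List (Letter tm)) = sgn e.1 :: (bits e.2 ++ sep :: table E) := by
  simp [table, entry]

@[simp] theorem table_append (E E' : List (Bool × List Bool)) :
    (table (E ++ E') : List (Letter tm)) = table E ++ table E' := by
  simp [table]

/-- The word with ones exactly at the positions `i` and `j`, backwards. -/
def pairVec (n i j : ℕ) : List Bool := ((List.range n).map fun p => p == i || p == j).reverse

/-- The positions in the words given by two one-hot counters. -/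
def hotPairs (n i j : ℕ) : List (Bool × Bool) := (List.range n).map fun p => (p == i, p == j)

theorem oneHot_eq {n i : ℕ} (hi : i < n) :
    (oneHot n i : List (Letter tm)) = (List.range n).map fun p => bit (p == i) := by
  apply List.ext_getElem
  · simp; omega
  · intro p h₁ h₂
    simp only [oneHot, zeros, List.getElem_append, List.length_replicate, List.getElem_replicate,
      List.getElem_map, List.getElem_range]
    split_ifs with h
    · simp; omega
    · rcases Nat.eq_or_lt_of_le (not_lt.1 h) with rfl | h'
      · simp
      · obtain ⟨d, rfl⟩ := Nat.exists_eq_add_of_lt h'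
        simp only [show i + d + 1 - i = d + 1 by omega, List.getElem_cons_succ,
          List.getElem_replicate]
        simp; omega

theorem oneHot_eq_fst {n i : ℕ} (j : ℕ) (hi : i < n) :
    (oneHot n i : List (Letter tm)) = bits ((hotPairs n i j).map Prod.fst) := by
  rw [oneHot_eq hi]; simp [hotPairs]

theorem oneHot_eq_snd {n j : ℕ} (i : ℕ) (hj : j < n) :
    (oneHot n j : List (Letter tm)) = bits ((hotPairs n i j).map Prod.snd) := by
  rw [oneHot_eq hj]; simp [hotPairs]

/-- Push a table entry that is given by the positions on the stacks `i` and `j` and by the word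
`tail`. -/
noncomputable def pushEntry (f : Bool → Bool → Bool) (b : Bool) (tail : List Bool) (w : Bool) :
    Program tm :=
  push (.w w) sep ;; pushL (.w w) (bits tail) ;; comb f w ;; push (.w w) (sgn b)

/-- An entry is built from its last letter to its first: separator, tail, combined word, sign. -/
theorem pushEntry_eq {R : Regs tm} {f : Bool → Bool → Bool} {b w : Bool} {tail : List Bool}
    {n i j : ℕ} (hi : i < n) (hj : j < n) (hRi : R.i = oneHot n i) (hRj : R.j = oneHot n j)
    (hi' : R.i' = []) (hj' : R.j' = []) {s' : Reg tm.K → List (Letter tm)}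
    (h : Rel (pushEntry f b tail w) R.st s') :
    s' = { R with w := Function.update R.w w (table [(b,
      ((hotPairs n i j).map fun q : Bool × Bool => f q.1 q.2).reverse ++ tail)] ++ R.w w) }.st := by
  simp only [pushEntry, rel_seq, rel_push, rel_pushL] at h
  obtain ⟨_, rfl, _, rfl, s₁, h₁, rfl⟩ := h
  simp only [Regs.st_w, Regs.update_w, Function.update_self, Function.update_idem] at h₁
  obtain rfl := comb_eq (l := hotPairs n i j) (by exact hRi.trans (oneHot_eq_fst j hi))
    (by exact hRj.trans (oneHot_eq_snd i hj)) (by exact hi') (by exact hj') h₁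
  simp

theorem to_pushEntry {R : Regs tm} {f : Bool → Bool → Bool} {b w : Bool} {tail : List Bool}
    {n i j : ℕ} (hi : i < n) (hj : j < n) (hRi : R.i = oneHot n i) (hRj : R.j = oneHot n j)
    (hi' : R.i' = []) (hj' : R.j' = []) :
    To (pushEntry f b tail w) (35 * n + 2 * tail.length + 30) R.st
      { R with w := Function.update R.w w (table [(b,
        ((hotPairs n i j).map fun q : Bool × Bool => f q.1 q.2).reverse ++ tail)] ++ R.w w) }.st := by
  have h₁ := to_comb (R := { R with w := Function.update R.w w (bits tail ++ sep :: R.w w) })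
    (f := f) (w := w) (l := hotPairs n i j) (hRi.trans (oneHot_eq_fst j hi))
    (hRj.trans (oneHot_eq_snd i hj)) hi' hj'
  have h₂ := to_pushL (k := Reg.w w) (l := bits tail)
    (s := { R with w := Function.update R.w w (sep :: R.w w) }.st)
  have h₃ := to_push (k := Reg.w w) (a := sep) (s := R.st)
  simp only [Regs.st_w, Regs.update_w, Function.update_self, Function.update_idem] at h₁ h₂ h₃
  exact (h₃.seq (h₂.seq (h₁.seq to_push))).cast (by simp [hotPairs]; omega) (by simp)

/-- The two table entries for one entry of an adjacency matrix. -/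
def bitEntries (tail : List Bool) (A : ℕ → ℕ → Bool) (n i j : ℕ) : List (Bool × List Bool) :=
  [(false, pairVec n i i ++ tail), (A i j, pairVec n i j ++ tail)]

/-- The table entries for the first entries of a row of an adjacency matrix. -/
def rowEntries (tail : List Bool) (A : ℕ → ℕ → Bool) (n i : ℕ) : ℕ → List (Bool × List Bool)
  | 0 => []
  | j + 1 => bitEntries tail A n i j ++ rowEntries tail A n i j

/-- The table entries for the first rows of an adjacency matrix. -/
def matEntries (tail : List Bool) (A : ℕ → ℕ → Bool) (n : ℕ) : ℕ → List (Bool × List Bool)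
  | 0 => []
  | i + 1 => rowEntries tail A n i n ++ matEntries tail A n i

theorem mem_rowEntries {tail : List Bool} {A : ℕ → ℕ → Bool} {n i m : ℕ} {e : Bool × List Bool} :
    e ∈ rowEntries tail A n i m ↔ ∃ j < m, e ∈ bitEntries tail A n i j := by
  induction m with
  | zero => simp [rowEntries]
  | succ m ih =>
    simp only [rowEntries, List.mem_append, ih]
    constructor
    · rintro (h | ⟨j, hj, h⟩)
      · exact ⟨m, by omega, h⟩
      · exact ⟨j, by omega, h⟩
    · rintro ⟨j, hj, h⟩
      rcases Nat.lt_succ_iff_lt_or_eq.1 hj with hj | rfl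
      · exact .inr ⟨j, hj, h⟩
      · exact .inl h

theorem mem_matEntries {tail : List Bool} {A : ℕ → ℕ → Bool} {n m : ℕ} {e : Bool × List Bool} :
    e ∈ matEntries tail A n m ↔ ∃ i < m, ∃ j < n, e ∈ bitEntries tail A n i j := by
  induction m with
  | zero => simp [matEntries]
  | succ m ih =>
    simp only [matEntries, List.mem_append, ih, mem_rowEntries]
    constructor
    · rintro (h | ⟨j, hj, h⟩)
      · exact ⟨m, by omega, h⟩
      · exact ⟨j, by omega, h⟩
    · rintro ⟨j, hj, h⟩
      rcases Nat.lt_succ_iff_lt_or_eq.1 hj with hj | rfl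
      · exact .inr ⟨j, hj, h⟩
      · exact .inl h

/-- The end of a row of an adjacency matrix. -/
def rowBits (A : ℕ → ℕ → Bool) (n i j : ℕ) : List Bool := (List.range' j (n - j)).map (A i)

/-- The last rows of an adjacency matrix. -/
def matBits (A : ℕ → ℕ → Bool) (n i : ℕ) : List Bool :=
  (List.range' i (n - i)).flatMap fun i => rowBits A n i 0

theorem rowBits_eq {A : ℕ → ℕ → Bool} {n i j : ℕ} (hj : j < n) :
    rowBits A n i j = A i j :: rowBits A n i (j + 1) := by
  rw [rowBits, show n - j = n - (j + 1) + 1 by omega, List.range'_succ]; rfl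

theorem matBits_eq {A : ℕ → ℕ → Bool} {n i : ℕ} (hi : i < n) :
    matBits A n i = rowBits A n i 0 ++ matBits A n (i + 1) := by
  rw [matBits, show n - i = n - (i + 1) + 1 by omega, List.range'_succ]; rfl

@[simp] theorem rowBits_self {A : ℕ → ℕ → Bool} {n i : ℕ} : rowBits A n i n = [] := by
  simp [rowBits]

@[simp] theorem matBits_self {A : ℕ → ℕ → Bool} {n : ℕ} : matBits A n n = [] := by
  simp [matBits]

/-- Read an entry of an adjacency matrix and push the corresponding table entries. -/
noncomputable def readBit (tail : List Bool) (w : Bool) : Program tm :=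
  altL .x ([false, true].map fun b => pop .x (bit b) ;; pushEntry or b tail w ;;
    pushEntry (fun a _ => a) false tail w)

/-- Read an adjacency matrix and push the corresponding table entries. -/
noncomputable def readMatrix (tail : List Bool) (w : Bool) : Program tm :=
  loop .i .i' (loop .j .j' (readBit tail w))

/-- The counters have the value `n`. -/
structure Ready (n : ℕ) (R : Regs tm) : Prop where
  i : R.i = zeros n
  i' : R.i' = []
  j : R.j = zeros n
  j' : R.j' = []

theorem hotPairs_or (n i j : ℕ) :
    ((hotPairs n i j).map fun q : Bool × Bool => or q.1 q.2).reverse = pairVec n i j := by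
  simp [hotPairs, pairVec, Function.comp_def]

/-- The combination that ignores `j` yields the second, negative entry of `bitEntries`, for the
single vertex `i`. It represents no `t`-set of interest; its purpose is to contradict the entry that
a nonzero diagonal element produces. -/
theorem hotPairs_fst (n i j : ℕ) :
    ((hotPairs n i j).map fun q : Bool × Bool => (fun a _ => a : Bool → Bool → Bool) q.1 q.2).reverse =
      pairVec n i i := by
  simp [hotPairs, pairVec, Function.comp_def]

/-- The stacks in the course of reading an adjacency matrix. -/
def readRegs (R : Regs tm) (tail : List Bool) (w : Bool) (A : ℕ → ℕ → Bool) (n i j : ℕ)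
    (r : List (Letter tm)) : Regs tm :=
  { R with
    x := bits (rowBits A n i j) ++ (bits (matBits A n (i + 1)) ++ r)
    w := Function.update R.w w
      (table (rowEntries tail A n i j ++ matEntries tail A n i) ++ R.w w) }

theorem readBit_eq {R : Regs tm} {tail : List Bool} {w : Bool} {A : ℕ → ℕ → Bool} {n i j : ℕ}
    {r : List (Letter tm)} (hi : i < n) (hj : j < n) (hRi : R.i = oneHot n i)
    (hRj : R.j = oneHot n j) (hi' : R.i' = []) (hj' : R.j' = []) {s'}
    (h : Rel (readBit tail w) (readRegs R tail w A n i j r).st s') :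
    s' = (readRegs R tail w A n i (j + 1) r).st := by
  simp only [readBit, rel_altL, List.mem_map] at h
  obtain ⟨_, ⟨b, -, rfl⟩, h⟩ := h
  simp only [rel_seq, rel_pop] at h
  obtain ⟨_, ⟨l, h₁, rfl⟩, s₁, h₂, h₃⟩ := h
  simp only [readRegs, rowBits_eq hj, Regs.st_x, bits, List.map_cons, List.cons_append,
    List.cons.injEq, bit.injEq] at h₁
  obtain ⟨rfl, rfl⟩ := h₁
  rw [Regs.update_x] at h₂
  obtain rfl := pushEntry_eq (n := n) (i := i) (j := j) hi hj
    (by exact hRi) (by exact hRj) (by exact hi') (by exact hj') h₂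
  obtain rfl := pushEntry_eq (n := n) (i := i) (j := j) hi hj
    (by exact hRi) (by exact hRj) (by exact hi') (by exact hj') h₃
  rw [hotPairs_or, hotPairs_fst]
  simp [readRegs, rowEntries, bitEntries]

theorem to_readBit {R : Regs tm} {tail : List Bool} {w : Bool} {A : ℕ → ℕ → Bool} {n i j : ℕ}
    {r : List (Letter tm)} (hi : i < n) (hj : j < n) (hRi : R.i = oneHot n i)
    (hRj : R.j = oneHot n j) (hi' : R.i' = []) (hj' : R.j' = []) :
    To (readBit tail w) (70 * n + 4 * tail.length + 70) (readRegs R tail w A n i j r).st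
      (readRegs R tail w A n i (j + 1) r).st := by
  have h₁ := to_pop (s := (readRegs R tail w A n i j r).st) (k := Reg.x) (a := bit (A i j))
    (l := bits (rowBits A n i (j + 1)) ++ (bits (matBits A n (i + 1)) ++ r))
    (by simp [readRegs, rowBits_eq hj])
  rw [Regs.update_x] at h₁
  have h₂ := h₁.seq ((to_pushEntry (f := or) (b := A i j) (w := w) (tail := tail) (n := n) (i := i)
    (j := j) hi hj (by exact hRi) (by exact hRj) (by exact hi') (by exact hj')).seq
    (to_pushEntry (f := fun a _ => a) (b := false) (w := w) (tail := tail) (n := n) (i := i)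
    (j := j) hi hj (by exact hRi) (by exact hRj) (by exact hi') (by exact hj')))
  refine (to_altL (List.mem_map_of_mem (a := A i j) (l := [false, true]) (by simp)) h₂).cast
    (by simp; omega) ?_
  rw [hotPairs_or, hotPairs_fst]
  simp [readRegs, rowEntries, bitEntries]

theorem readRow_eq {R : Regs tm} {tail : List Bool} {w : Bool} {A : ℕ → ℕ → Bool} {n i : ℕ}
    {r : List (Letter tm)} (hi : i < n) (hRi : R.i = oneHot n i) (hi' : R.i' = [])
    (hj : R.j = zeros n) (hj' : R.j' = []) {s'}
    (h : Rel (loop .j .j' (readBit tail w)) (readRegs R tail w A n i 0 r).st s') :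
    s' = (readRegs R tail w A n i n r).st :=
  loop_j_eq (fun j => readRegs R tail w A n i j r) (fun _ => hj) (fun _ => hj') rfl
    (fun j hlt _ h => readBit_eq (R := { R with j := oneHot n j }) hi hlt hRi rfl hi' hj' h) h

theorem to_readRow {R : Regs tm} {tail : List Bool} {w : Bool} {A : ℕ → ℕ → Bool} {n i : ℕ}
    {r : List (Letter tm)} (hi : i < n) (hRi : R.i = oneHot n i) (hi' : R.i' = [])
    (hj : R.j = zeros n) (hj' : R.j' = []) :
    To (loop .j .j' (readBit tail w)) (loopCost n (70 * n + 4 * tail.length + 70))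
      (readRegs R tail w A n i 0 r).st (readRegs R tail w A n i n r).st :=
  to_loop_j (fun j => readRegs R tail w A n i j r) (fun _ => hj) (fun _ => hj') rfl rfl
    (fun j hlt => to_readBit (R := { R with j := oneHot n j }) hi hlt hRi rfl hi' hj')

/-- The stacks in the course of reading an adjacency matrix, between two rows. -/
def matRegs (R : Regs tm) (tail : List Bool) (w : Bool) (A : ℕ → ℕ → Bool) (n i : ℕ)
    (r : List (Letter tm)) : Regs tm :=
  { R with
    x := bits (matBits A n i) ++ r
    w := Function.update R.w w (table (matEntries tail A n i) ++ R.w w) }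

theorem matRegs_zero {R : Regs tm} {tail : List Bool} {w : Bool} {A : ℕ → ℕ → Bool} {n : ℕ}
    {r : List (Letter tm)} (hx : R.x = bits (matBits A n 0) ++ r) :
    R = matRegs R tail w A n 0 r := by
  ext1 <;> simp [matRegs, hx, matEntries]

/-- Together with `matRegs_eq_readRegs` this identifies the states at the two ends of a row, so that
the inner loop fits into the outer one. -/
theorem matRegs_eq_readRegs_zero {R : Regs tm} {tail : List Bool} {w : Bool} {A : ℕ → ℕ → Bool}
    {n i : ℕ} {r : List (Letter tm)} (hi : i < n) :
    matRegs R tail w A n i r = readRegs R tail w A n i 0 r := by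
  simp [matRegs, readRegs, rowEntries, matBits_eq hi]

theorem matRegs_eq_readRegs {R : Regs tm} {tail : List Bool} {w : Bool} {A : ℕ → ℕ → Bool}
    {n i : ℕ} {r : List (Letter tm)} :
    matRegs R tail w A n (i + 1) r = readRegs R tail w A n i n r := by
  simp [matRegs, readRegs, matEntries]

theorem readMatrix_eq {R : Regs tm} {tail : List Bool} {w : Bool} {A : ℕ → ℕ → Bool} {n : ℕ}
    {r : List (Letter tm)} (hR : Ready n R) (hx : R.x = bits (matBits A n 0) ++ r) {s'}
    (h : Rel (readMatrix tail w) R.st s') : s' = (matRegs R tail w A n n r).st := by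
  refine loop_i_eq (fun i => matRegs R tail w A n i r) (fun _ => hR.i) (fun _ => hR.i')
    (matRegs_zero hx) (fun i hi s' h => ?_) h
  rw [matRegs_eq_readRegs_zero hi] at h
  rw [matRegs_eq_readRegs]
  exact readRow_eq (R := { R with i := oneHot n i }) hi rfl hR.i' hR.j hR.j' h

theorem to_readMatrix {R : Regs tm} {tail : List Bool} {w : Bool} {A : ℕ → ℕ → Bool} {n : ℕ}
    {r : List (Letter tm)} (hR : Ready n R) (hx : R.x = bits (matBits A n 0) ++ r) :
    To (readMatrix tail w) (loopCost n (loopCost n (70 * n + 4 * tail.length + 70))) R.st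
      (matRegs R tail w A n n r).st := by
  refine to_loop_i (fun i => matRegs R tail w A n i r) (fun _ => hR.i) (fun _ => hR.i')
    (matRegs_zero hx) rfl (fun i hi => ?_)
  rw [matRegs_eq_readRegs_zero hi, matRegs_eq_readRegs]
  exact to_readRow (R := { R with i := oneHot n i }) hi rfl hR.i' hR.j hR.j'

end Prog
end SymBreak

namespace SymBreak
namespace Prog

open Letter

variable {tm : Turing.FinTM2}

/-! ### Guessing negative table entries -/

/-- Guess a word, of a length given by the counter `i`. -/
noncomputable def guess (w : Bool) : Program tm :=
  loop .i .i' (alt (push (.w w) (bit false)) (push (.w w) (bit true)))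

theorem guess_sound {R : Regs tm} {n : ℕ} {w : Bool} (hR : Ready n R) {s'}
    (h : Rel (guess w) R.st s') : ∃ v : List Bool, v.length = n ∧
      s' = { R with w := Function.update R.w w (bits v ++ R.w w) }.st := by
  obtain ⟨_, ⟨v, hv, rfl⟩, rfl⟩ := loop_i_sound (n := n) (fun p R' => ∃ v : List Bool,
      v.length = p ∧ R' = { R with w := Function.update R.w w (bits v ++ R.w w) })
    (by rintro p _ ⟨v, -, rfl⟩; exact ⟨hR.i, hR.i'⟩)
    (by
      rintro p hp _ s' ⟨v, hv, rfl⟩ h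
      rw [rel_alt, rel_push, rel_push] at h
      rcases h with rfl | rfl
      · exact ⟨_, ⟨false :: v, by simp [hv], rfl⟩, by simp⟩
      · exact ⟨_, ⟨true :: v, by simp [hv], rfl⟩, by simp⟩)
    ⟨[], rfl, by simp⟩ h
  exact ⟨v, hv, rfl⟩

theorem to_guess {R : Regs tm} {n : ℕ} {w : Bool} (hR : Ready n R) {v : List Bool}
    (hv : v.length = n) : To (guess w) (loopCost n 2) R.st
      { R with w := Function.update R.w w (bits v ++ R.w w) }.st := by
  subst hv
  -- The word is pushed from its last letter on: after `p` rounds its suffix of length `p` is on the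
  -- stack.
  refine to_loop_i (fun p => { R with
    w := Function.update R.w w (bits (v.drop (v.length - p)) ++ R.w w) }) (fun _ => hR.i)
    (fun _ => hR.i') (by simp) (by simp) (fun p hp => ?_)
  have h : v.drop (v.length - p - 1) = v[v.length - p - 1] :: v.drop (v.length - p) := by
    rw [List.drop_eq_getElem_cons (by omega)]
    congr 2; omega
  simp only [← Nat.sub_sub, h]
  cases v[v.length - p - 1]
  · exact (to_push.altl).cast (by omega) (by simp)
  · exact (to_push.altr).cast (by omega) (by simp)

/-- Guess negative table entries, with words that end in a word from a list. -/
noncomputable def guessEntries (L : List (List Bool)) (w : Bool) : Program tm :=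
  star (altL .x (L.map fun p => push (.w w) sep ;; pushL (.w w) (bits p) ;; guess w ;;
    push (.w w) (sgn false)))

theorem guessEntries_sound {L : List (List Bool)} {R : Regs tm} {n : ℕ} {w : Bool}
    (hR : Ready n R) {s'} (h : Rel (guessEntries L w) R.st s') : ∃ E : List (Bool × List Bool),
      (∀ e ∈ E, ∃ v : List Bool, ∃ p ∈ L, v.length = n ∧ e = (false, v ++ p)) ∧
      s' = { R with w := Function.update R.w w (table E ++ R.w w) }.st := by
  refine star_induction (Inv := fun s' => ∃ E : List (Bool × List Bool),
      (∀ e ∈ E, ∃ v : List Bool, ∃ p ∈ L, v.length = n ∧ e = (false, v ++ p)) ∧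
      s' = { R with w := Function.update R.w w (table E ++ R.w w) }.st) h ⟨[], by simp⟩ ?_
  rintro _ s' ⟨E, hE, rfl⟩ h
  simp only [rel_altL, List.mem_map] at h
  obtain ⟨_, ⟨p, hp, rfl⟩, h⟩ := h
  simp only [rel_seq, rel_push, rel_pushL] at h
  obtain ⟨_, rfl, _, rfl, s₁, h, rfl⟩ := h
  simp only [Regs.st_w, Regs.update_w, Function.update_self, Function.update_idem] at h
  obtain ⟨v, hv, rfl⟩ := guess_sound (n := n) (by exact ⟨hR.i, hR.i', hR.j, hR.j'⟩) h
  refine ⟨(false, v ++ p) :: E, ?_, by simp⟩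
  simp only [List.mem_cons, forall_eq_or_imp]
  exact ⟨⟨v, p, hp, hv, rfl⟩, hE⟩

/-- A bound for the running time of guessing a negative table entry. -/
def guessCost (n T N : ℕ) : ℕ := loopCost n 2 + 2 * T + N + 8

theorem to_guessEntries {L : List (List Bool)} {R : Regs tm} {n T : ℕ} {w : Bool}
    (hR : Ready n R) (hL : ∀ p ∈ L, p.length ≤ T) {E : List (Bool × List Bool)}
    (hE : ∀ e ∈ E, ∃ v : List Bool, ∃ p ∈ L, v.length = n ∧ e = (false, v ++ p)) :
    To (guessEntries L w) (E.length * (guessCost n T L.length + 1) + 1) R.st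
      { R with w := Function.update R.w w (table E ++ R.w w) }.st := by
  have h := to_walk (B := altL .x (L.map fun p => push (.w w) sep ;; pushL (.w w) (bits p) ;;
      guess w ;; push (.w w) (sgn false))) (c := guessCost n T L.length)
    (fun p (_ : List (Bool × List Bool)) =>
      { R with w := Function.update R.w w (table p ++ R.w w) }.st)
    -- Entries are pushed on top of each other, so the last one of `E` has to be guessed first.
    (p := []) (l₁ := E.reverse) (l₂ := []) (by
      intro E' e _ he
      obtain ⟨v, p, hp, hv, rfl⟩ := hE e (List.mem_reverse.1 he)
      have h₁ := to_push (k := Reg.w w) (a := sep)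
        (s := { R with w := Function.update R.w w (table E' ++ R.w w) }.st)
      have h₂ := to_pushL (k := Reg.w w) (l := bits p)
        (s := { R with w := Function.update R.w w (sep :: (table E' ++ R.w w)) }.st)
      have h₃ := to_guess (n := n) (w := w)
        (R := { R with w := Function.update R.w w (bits p ++ sep :: (table E' ++ R.w w)) })
        ⟨hR.i, hR.i', hR.j, hR.j'⟩ hv
      simp only [Regs.st_w, Regs.update_w, Function.update_self, Function.update_idem] at h₁ h₂ h₃
      refine (to_altL (List.mem_map_of_mem hp) (h₁.seq (h₂.seq (h₃.seq to_push)))).cast ?_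
        (by simp)
      have := hL p hp
      simp [guessCost]; omega)
  have hR' : { R with w := Function.update R.w w (table [] ++ R.w w) } = R := by ext1 <;> simp
  rw [hR'] at h
  exact h.cast (by simp) (by simp)

/-! ### Rearranging the words of a table -/

/-- Move the first letter, or the second one, of a word to its end. -/
def rotate {α : Type} : Bool → List α → List α
  | false, a :: l => l ++ [a]
  | true, a :: b :: l => a :: (l ++ [b])
  | _, l => l

theorem rotate_map {α β : Type} (f : α → β) (o : Bool) (l : List α) :
    rotate o (l.map f) = (rotate o l).map f := by
  rcases o with _ | _ <;> rcases l with _ | ⟨a, _ | ⟨b, l⟩⟩ <;> simp [rotate]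

theorem rotate_perm {α : Type} (o : Bool) (l : List α) : (rotate o l).Perm l := by
  rcases o with _ | _ <;> rcases l with _ | ⟨a, _ | ⟨b, l⟩⟩ <;> simp only [rotate, List.Perm.refl]
  · exact .refl _
  · exact List.perm_append_comm
  · exact .cons _ List.perm_append_comm

@[simp] theorem length_rotate {α : Type} (o : Bool) (l : List α) :
    (rotate o l).length = l.length :=
  (rotate_perm o l).length_eq

/-- A sequence of rotations. -/
def rotates {α : Type} (ops : List Bool) (l : List α) : List α :=
  ops.foldl (fun l o => rotate o l) l

theorem rotates_append {α : Type} (ops ops' : List Bool) (l : List α) :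
    rotates (ops ++ ops') l = rotates ops' (rotates ops l) := by
  simp [rotates]

theorem rotates_map {α β : Type} (f : α → β) (ops : List Bool) (l : List α) :
    rotates ops (l.map f) = (rotates ops l).map f := by
  induction ops generalizing l with
  | nil => rfl
  | cons o ops ih =>
    change rotates ops (rotate o (l.map f)) = _
    rw [rotate_map, ih]; rfl

theorem rotates_perm {α : Type} (ops : List Bool) (l : List α) : (rotates ops l).Perm l := by
  induction ops generalizing l with
  | nil => exact .refl _
  | cons o ops ih => exact (ih (rotate o l)).trans (rotate_perm o l)

@[simp] theorem length_rotates {α : Type} (ops : List Bool) (l : List α) :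
    (rotates ops l).length = l.length :=
  (rotates_perm ops l).length_eq

theorem rotates_replicate_false {α : Type} (p q : List α) :
    rotates (List.replicate p.length false) (p ++ q) = q ++ p := by
  induction p generalizing q with
  | nil => simp [rotates]
  | cons a p ih =>
    change rotates (List.replicate p.length false) (rotate false (a :: (p ++ q))) = _
    rw [rotate, List.append_assoc, ih]; simp

theorem rotates_replicate_true {α : Type} (a : α) (p q : List α) :
    rotates (List.replicate p.length true) (a :: (p ++ q)) = a :: (q ++ p) := by
  induction p generalizing q with
  | nil => simp [rotates]
  | cons b p ih =>
    change rotates (List.replicate p.length true) (rotate true (a :: b :: (p ++ q))) = _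
    rw [rotate, List.append_assoc, ih]; simp

/-- The target is assembled at the front from its last element to its first. With `suf ++ r₁ ++ a ::
r₂` at hand, rotating everything past `suf ++ r₁` brings `a` to the front. Then holding `a` fixed
and rotating past `r₂` gives `a :: (suf ++ r₁ ++ r₂)`. Each new element costs fewer rotations than
the list has elements. -/
theorem exists_rotates_aux {α : Type} (l suf : List α) : ∀ pre, l.Perm (pre ++ suf) →
    ∃ ops rest, ops.length ≤ suf.length * l.length ∧ rotates ops l = suf ++ rest ∧
      rest.Perm pre := by
  induction suf with
  | nil => exact fun pre h => ⟨[], l, by simp, rfl, by simpa using h⟩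
  | cons a suf ih =>
    intro pre h
    obtain ⟨ops, rest, h₁, h₂, h₃⟩ := ih (pre ++ [a]) (by simpa using h)
    obtain ⟨r₁, r₂, rfl⟩ := List.append_of_mem (h₃.mem_iff.2 (by simp : a ∈ pre ++ [a]))
    refine ⟨ops ++ (List.replicate (suf ++ r₁).length false ++ List.replicate r₂.length true),
      r₁ ++ r₂, ?_, ?_, ?_⟩
    · have h₄ := congrArg List.length h₂
      simp only [length_rotates, List.length_append, List.length_cons] at h₄
      simp only [List.length_append, List.length_replicate, List.length_cons, Nat.succ_mul]
      omega
    · rw [rotates_append, h₂, rotates_append, ← List.append_assoc, rotates_replicate_false,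
        List.cons_append, rotates_replicate_true]
      simp
    · have h₅ : (a :: (r₁ ++ r₂)).Perm (a :: pre) :=
        (List.perm_middle.symm.trans h₃).trans List.perm_append_comm
      exact h₅.cons_inv

theorem exists_rotates {α : Type} {l l' : List α} (h : l.Perm l') :
    ∃ ops : List Bool, ops.length ≤ l.length * l.length ∧ rotates ops l = l' := by
  obtain ⟨ops, rest, h₁, h₂, h₃⟩ := exists_rotates_aux l l' [] (by simpa using h)
  rw [h₃.eq_nil, List.append_nil] at h₂
  exact ⟨ops, by rwa [h.length_eq] at h₁ ⊢, h₂⟩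

/-- The separator is not a bit, so a transfer of bits that is followed by a separator has moved the
whole word. -/
theorem bits_split {c : List Bool} {l r r' : List (Letter tm)}
    (h : bits c ++ sep :: r = l ++ sep :: r') (hl : ∀ a ∈ l, a ∈ bitLetters (tm := tm)) :
    l = bits c ∧ r' = r := by
  induction c generalizing l with
  | nil =>
    cases l with
    | nil => simpa using h.symm
    | cons a l =>
      simp only [bits, List.map_nil, List.nil_append, List.cons_append, List.cons.injEq] at h
      have := hl a (by simp)
      simp [← h.1] at this
  | cons b c ih =>
    cases l with
    | nil => simp at h
    | cons a l =>
      simp only [bits, List.map_cons, List.cons_append, List.cons.injEq] at h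
      obtain ⟨h₁, h₂⟩ := ih h.2 fun a ha => hl a (List.mem_cons_of_mem _ ha)
      rw [h₁, h₂, ← h.1]
      exact ⟨rfl, rfl⟩

/-- Move the rest of an entry from the stack `w` to the stack `t`, the first letter coming last. -/
noncomputable def rotTail (w : Bool) : Program tm :=
  altL .x ([false, true].map fun β => pop (.w w) (bit β) ;; transfer bitLetters (.w w) .t ;;
    pop (.w w) sep ;; push .t (bit β) ;; push .t sep)

theorem rotTail_sound {R : Regs tm} {w : Bool} {c : List Bool} {r : List (Letter tm)}
    (hw : R.w w = bits c ++ sep :: r) {s'} (h : Rel (rotTail w) R.st s') :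
    ∃ β c', c = β :: c' ∧ s' = { R with
      w := Function.update R.w w r
      t := sep :: bit β :: (bits c'.reverse ++ R.t) }.st := by
  simp only [rotTail, rel_altL, List.mem_map] at h
  obtain ⟨_, ⟨β, -, rfl⟩, h⟩ := h
  simp only [rel_seq, rel_pop, rel_push] at h
  obtain ⟨_, ⟨l, h₁, rfl⟩, _, h₂, _, ⟨r', h₃, rfl⟩, _, rfl, rfl⟩ := h
  rw [Regs.st_w, hw] at h₁
  cases c with
  | nil => simp at h₁
  | cons β' c =>
    simp only [bits, List.map_cons, List.cons_append, List.cons.injEq, bit.injEq] at h₁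
    obtain ⟨rfl, rfl⟩ := h₁
    obtain ⟨l, r₂, h₄, h₅, rfl⟩ := rel_transfer (by simp) h₂
    simp only [Regs.update_w, Regs.st_w, Function.update_self, Regs.st_t, Regs.update_t] at h₃ h₄
    subst h₃
    obtain ⟨rfl, rfl⟩ := bits_split h₄ h₅
    exact ⟨β', c, rfl, by simp⟩

theorem to_rotTail {R : Regs tm} {w : Bool} {β : Bool} {c : List Bool} {r : List (Letter tm)}
    (hw : R.w w = bits (β :: c) ++ sep :: r) :
    To (rotTail w) (8 * c.length + 20) R.st { R with
      w := Function.update R.w w r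
      t := sep :: bit β :: (bits c.reverse ++ R.t) }.st := by
  have h₁ := to_pop (s := R.st) (k := Reg.w w) (a := bit β) (l := bits c ++ sep :: r)
    (by rw [Regs.st_w, hw]; rfl)
  have h₂ := to_transfer (A := bitLetters) (u := Reg.w w) (v := Reg.t) (by simp)
    (s := { R with w := Function.update R.w w (bits c ++ sep :: r) }.st) (l := bits c)
    (r := sep :: r) (by simp) (bits_subset c)
  have h₃ := to_pop (s := { R with w := Function.update R.w w (sep :: r)
                                   t := bits c.reverse ++ R.t }.st)
    (k := Reg.w w) (a := sep) (l := r) (by simp)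
  simp only [Regs.update_w, Function.update_idem, Regs.update_t, Regs.st_t] at h₁ h₂ h₃
  rw [← List.map_reverse] at h₂
  exact (to_altL (List.mem_map_of_mem (a := β) (l := [false, true]) (by simp))
    (h₁.seq (h₂.seq (h₃.seq (to_push.seq to_push))))).cast (by simp; omega) (by simp)

/-- Move an entry from the stack `w` to the stack `t`, and rotate its word. -/
noncomputable def rotEntry (o w : Bool) : Program tm :=
  altL .x ([false, true].map fun b => pop (.w w) (sgn b) ;; push .t (sgn b)) ;;
    (if o then move bitLetters (.w w) .t ;; rotTail w else rotTail w)

theorem rotEntry_sound {R : Regs tm} {o w : Bool} {E : List (Bool × List Bool)}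
    (hw : R.w w = table E) {s'} (h : Rel (rotEntry o w) R.st s') :
    ∃ e E', E = e :: E' ∧ s' = { R with
      w := Function.update R.w w (table E')
      t := (entry (e.1, rotate o e.2)).reverse ++ R.t }.st := by
  simp only [rotEntry, rel_seq, rel_altL, List.mem_map] at h
  obtain ⟨s₁, ⟨_, ⟨b, -, rfl⟩, h₁⟩, h⟩ := h
  simp only [rel_seq, rel_pop, rel_push] at h₁
  obtain ⟨_, ⟨l, h₁, rfl⟩, rfl⟩ := h₁
  rw [Regs.st_w, hw] at h₁
  cases E with
  | nil => simp at h₁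
  | cons e E =>
    obtain ⟨b', c⟩ := e
    simp only [table_cons, List.cons.injEq, sgn.injEq] at h₁
    obtain ⟨rfl, rfl⟩ := h₁
    refine ⟨(b', c), E, rfl, ?_⟩
    simp only [Regs.update_w, Regs.update_t, Regs.st_t] at h
    cases o with
    | false =>
      simp only [Bool.false_eq_true, if_false] at h
      obtain ⟨β, c, rfl, rfl⟩ := rotTail_sound (c := c) (r := table E) (by simp) h
      simp [rotate, entry]
    | true =>
      simp only [if_true] at h
      obtain ⟨s₂, h₂, h₃⟩ := rel_seq.1 h
      obtain ⟨a, ha, l, h₄, rfl⟩ := rel_move.1 h₂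
      simp only [Regs.st_w, Function.update_self] at h₄
      cases c with
      | nil =>
        simp only [bits, List.map_nil, List.nil_append, List.cons.injEq] at h₄
        simp [← h₄.1] at ha
      | cons α c =>
        simp only [bits, List.map_cons, List.cons_append, List.cons.injEq] at h₄
        obtain ⟨rfl, rfl⟩ := h₄
        simp only [Regs.update_w, Function.update_idem, Regs.update_t, Regs.st_t] at h₃
        obtain ⟨β, c, rfl, rfl⟩ := rotTail_sound (c := c) (r := table E) (by simp) h₃
        simp [rotate, entry]

/-- On words that are too short `rotate` does nothing whereas the program blocks; hence the
assumption on the length. -/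
theorem to_rotEntry {R : Regs tm} {o w : Bool} {e : Bool × List Bool}
    {E : List (Bool × List Bool)} (he : 2 ≤ e.2.length) (hw : R.w w = table (e :: E)) :
    To (rotEntry o w) (8 * e.2.length + 40) R.st { R with
      w := Function.update R.w w (table E)
      t := (entry (e.1, rotate o e.2)).reverse ++ R.t }.st := by
  obtain ⟨b, c⟩ := e
  rcases c with _ | ⟨α, _ | ⟨β, c⟩⟩
  · simp at he
  · simp at he
  have h₁ := to_pop (s := R.st) (k := Reg.w w) (a := sgn b)
    (l := bits (α :: β :: c) ++ sep :: table E) (by rw [Regs.st_w, hw, table_cons])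
  simp only [Regs.update_w] at h₁
  have h₂ := h₁.seq (to_push (k := Reg.t) (a := sgn b))
  simp only [Regs.update_t, Regs.st_t] at h₂
  have h₃ := to_altL (k := Reg.x) (List.mem_map_of_mem
    (f := fun b => (pop (.w w) (sgn b) ;; push .t (sgn b) : Program tm))
    (a := b) (l := [false, true]) (by simp)) h₂
  cases o with
  | false =>
    have h₄ := to_rotTail (w := w) (β := α) (c := β :: c) (r := table E)
      (R := { R with w := Function.update R.w w (bits (α :: β :: c) ++ sep :: table E)
                     t := sgn b :: R.t }) (by simp)
    exact (h₃.seq h₄).cast (by simp; omega) (by simp [rotate, entry])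
  | true =>
    have h₄ := to_move (A := bitLetters) (u := Reg.w w) (v := Reg.t) (by simp) (a := bit α)
      (s := { R with w := Function.update R.w w (bits (α :: β :: c) ++ sep :: table E)
                     t := sgn b :: R.t }.st) (l := bits (β :: c) ++ sep :: table E) (by simp)
      (by cases α <;> simp)
    simp only [Regs.update_w, Regs.update_t, Regs.st_t, Function.update_idem] at h₄
    have h₅ := to_rotTail (w := w) (β := β) (c := c) (r := table E)
      (R := { R with w := Function.update R.w w (bits (β :: c) ++ sep :: table E)
                     t := bit α :: sgn b :: R.t }) (by simp)
    exact (h₃.seq (h₄.seq h₅)).cast (by simp; omega) (by simp [rotate, entry])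

/-- The letters of a table. -/
abbrev tableLetters : List (Letter tm) := [bit false, bit true, sgn false, sgn true, sep]

theorem table_subset (E : List (Bool × List Bool)) :
    ∀ a ∈ (table E : List (Letter tm)), a ∈ tableLetters (tm := tm) := by
  simp only [table, List.mem_flatMap, entry, List.mem_cons, List.mem_append, List.mem_map]
  rintro a ⟨⟨b, c⟩, -, rfl | ⟨β, -, rfl⟩ | h⟩
  · cases b <;> simp
  · cases β <;> simp
  · simp_all

/-- Rotate all words of a table. -/
noncomputable def rotTable (o w : Bool) : Program tm :=
  star (rotEntry o w) ;; emp (.w w) ;; moveAll tableLetters .t (.w w)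

/-- The stacks in the course of rotating the words of a table. -/
def rotRegs (R : Regs tm) (o w : Bool) (p E : List (Bool × List Bool)) : Regs tm :=
  { R with
    w := Function.update R.w w (table E)
    t := (table (p.reverse.map fun e : Bool × List Bool => (e.1, rotate o e.2))).reverse }

theorem rotRegs_nil {R : Regs tm} {o w : Bool} {E : List (Bool × List Bool)}
    (hw : R.w w = table E) (ht : R.t = []) : R = rotRegs R o w [] E := by
  ext1 <;> simp [rotRegs, ht, ← hw]

/-- The test that the stack `w` is empty excludes runs that rotate only some entries. All words are
thus rearranged in the same way, as a permutation of the points demands. -/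
theorem rotTable_eq {R : Regs tm} {o w : Bool} {E : List (Bool × List Bool)}
    (hw : R.w w = table E) (ht : R.t = []) {s'} (h : Rel (rotTable o w) R.st s') :
    s' = { R with
      w := Function.update R.w w (table (E.map fun e : Bool × List Bool => (e.1, rotate o e.2))) }.st := by
  simp only [rotTable, rel_seq, rel_emp] at h
  obtain ⟨s₁, h₁, _, ⟨h₂, rfl⟩, h₃⟩ := h
  rw [rotRegs_nil hw ht] at h₁
  obtain ⟨l₁, l₂, rfl, rfl⟩ := walk_sound (fun p l => (rotRegs R o w p l).st) (by
    intro p l s' h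
    obtain ⟨e, E', rfl, rfl⟩ := rotEntry_sound (R := rotRegs R o w p l) (E := l)
      (by simp [rotRegs]) h
    refine ⟨e, E', rfl, ?_⟩
    simp [rotRegs, table]) h₁
  have : l₂ = [] := by
    cases l₂ with
    | nil => rfl
    | cons e l => simp [rotRegs] at h₂
  subst this
  obtain ⟨-, rfl⟩ := rel_moveAll (by simp) h₃
  simp [rotRegs, ht]

theorem to_rotTable {R : Regs tm} {o w : Bool} {k : ℕ} {E : List (Bool × List Bool)}
    (hE : ∀ e ∈ E, e.2.length = k) (hk : 2 ≤ k)
    (hw : R.w w = table E) (ht : R.t = []) :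
    To (rotTable o w) (E.length * (20 * k + 80) + 10) R.st { R with
      w := Function.update R.w w (table (E.map fun e : Bool × List Bool => (e.1, rotate o e.2))) }.st := by
  have h₁ := to_walk (B := rotEntry o w) (c := 8 * k + 40) (fun p l => (rotRegs R o w p l).st)
    (p := []) (l₁ := E) (l₂ := []) (by
      intro p e l he
      have := to_rotEntry (o := o) (w := w) (R := rotRegs R o w p (e :: l)) (e := e) (E := l)
        (by rw [hE e he]; exact hk) (by simp [rotRegs])
      rw [hE e he] at this
      exact this.cast le_rfl (by simp [rotRegs, table]))
  rw [List.append_nil, List.append_nil, ← rotRegs_nil hw ht] at h₁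
  have hlen : ∀ E : List (Bool × List Bool), (∀ e ∈ E, e.2.length = k) →
      (table E : List (Letter tm)).length = E.length * (k + 2) := by
    intro E hE
    induction E with
    | nil => simp
    | cons e E ih =>
      have h₁ := ih fun e he => hE e (List.mem_cons_of_mem _ he)
      have h₂ := hE e (by simp)
      simp only [table_cons, List.length_cons, List.length_append, bits, List.length_map, h₁, h₂]
      ring
  have h₂ := h₁.seq ((to_emp (k := Reg.w w) (by simp [rotRegs])).seq
    (to_moveAll (A := tableLetters) (u := Reg.t) (v := Reg.w w) (by simp) (fun a ha =>
      table_subset (E.map fun e : Bool × List Bool => (e.1, rotate o e.2)) a (by simpa [rotRegs] using ha))))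
  refine h₂.cast ?_ (by simp [rotRegs, ht])
  have := hlen (E.map fun e : Bool × List Bool => (e.1, rotate o e.2)) (by simpa using hE)
  simp only [List.length_map] at this
  simp only [rotRegs, List.reverse_reverse, Regs.st_t, List.length_reverse, this, List.length_cons,
    List.length_nil, List.reverse_reverse]
  nlinarith

/-- Rearrange the words of a table, all in the same way. -/
noncomputable def rearrange (w : Bool) : Program tm :=
  star (alt (rotTable false w) (rotTable true w))

theorem rearrange_sound {R : Regs tm} {w : Bool} {E : List (Bool × List Bool)}
    (hw : R.w w = table E) (ht : R.t = []) {s'} (h : Rel (rearrange w) R.st s') :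
    ∃ ops : List Bool, s' = { R with
      w := Function.update R.w w (table (E.map fun e : Bool × List Bool => (e.1, rotates ops e.2))) }.st := by
  refine star_induction (Inv := fun s' => ∃ ops : List Bool, s' = { R with
      w := Function.update R.w w (table (E.map fun e : Bool × List Bool => (e.1, rotates ops e.2))) }.st) h
    ⟨[], by simp [rotates, ← hw]⟩ ?_
  rintro _ s' ⟨ops, rfl⟩ h
  have key : ∃ o, Rel (rotTable o w) { R with
      w := Function.update R.w w (table (E.map fun e : Bool × List Bool => (e.1, rotates ops e.2))) }.st s' := by
    rcases rel_alt.1 h with h | h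
    exacts [⟨_, h⟩, ⟨_, h⟩]
  obtain ⟨o, h⟩ := key
  refine ⟨ops ++ [o], ?_⟩
  obtain rfl := rotTable_eq (by simp; rfl) (by exact ht) h
  simp [rotates, Function.comp_def]

theorem to_rearrange {R : Regs tm} {w : Bool} {k : ℕ} {E : List (Bool × List Bool)}
    (hE : ∀ e ∈ E, e.2.length = k) (hk : 2 ≤ k)
    (hw : R.w w = table E) (ht : R.t = []) (ops : List Bool) :
    To (rearrange w) (ops.length * (E.length * (20 * k + 80) + 12) + 1) R.st { R with
      w := Function.update R.w w (table (E.map fun e : Bool × List Bool => (e.1, rotates ops e.2))) }.st := by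
  have h₁ := to_walk (B := alt (rotTable false w) (rotTable true w))
    (c := E.length * (20 * k + 80) + 11)
    (fun p (_ : List Bool) => { R with
      w := Function.update R.w w (table (E.map fun e : Bool × List Bool => (e.1, rotates p.reverse e.2))) }.st)
    (p := []) (l₁ := ops) (l₂ := []) (by
      intro p o _ _
      have h := to_rotTable (o := o) (w := w) (k := k)
        (E := E.map fun e : Bool × List Bool => (e.1, rotates p.reverse e.2)) (R := { R with
          w := Function.update R.w w (table (E.map fun e : Bool × List Bool => (e.1, rotates p.reverse e.2))) })
        (by simpa using hE) hk (by simp) ht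
      cases o
      · exact h.altl.cast (by simp) (by simp [rotates, Function.comp_def])
      · exact h.altr.cast (by simp) (by simp [rotates, Function.comp_def]))
  have hR' : { R with
      w := Function.update R.w w (table (E.map fun e : Bool × List Bool => (e.1, rotates [].reverse e.2))) } = R := by
    ext1 <;> simp [rotates, ← hw]
  rw [hR'] at h₁
  exact h₁.cast le_rfl (by simp)

end Prog
end SymBreak

namespace SymBreak
namespace Prog

open Letter

variable {tm : Turing.FinTM2}

/-! ### Simulation of a machine -/

/-- The letter of a stack of the machine, if any, that is represented by a letter. -/
def decode (k : tm.K) : Option (Letter tm) → Option (tm.Γ k)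
  | some (m k' a) => if h : k' = k then some (h ▸ a) else none
  | _ => none

theorem decode_head (k : tm.K) (l : List (tm.Γ k)) :
    decode k (l.map (Letter.m k)).head? = l.head? := by
  cases l <;> simp [decode]

noncomputable section

open Classical in
/-- The program for a statement of the machine in a given state. -/
def body : Turing.TM2.Stmt tm.Γ tm.Λ tm.σ → tm.σ → Program tm
  | .push k f q, v => push (.m k) (m k (f v)) ;; body q v
  | .peek k f q, v => altL .x (tm.σFin.elems.toList.map fun v' =>
      test (.m k) (fun o => decide (f v (decode k o) = v')) ;; body q v')
  | .pop k f q, v => altL .x (tm.σFin.elems.toList.map fun v' =>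
      test (.m k) (fun o => decide (f v (decode k o) = v')) ;; drop (.m k) ;; body q v')
  | .load a q, v => body q (a v)
  | .branch f q q', v => if f v then body q v else body q' v
  | .goto f, v => push .ctl (st (some (f v)) v)
  | .halt, v => push .ctl (st none v)

/-- A bound for the running time of the program for a statement. -/
def bodyCost (tm : Turing.FinTM2) : Turing.TM2.Stmt tm.Γ tm.Λ tm.σ → ℕ
  | .push _ _ q => bodyCost tm q + 2
  | .peek _ _ q => bodyCost tm q + tm.σFin.elems.card + 2
  | .pop _ _ q => bodyCost tm q + tm.σFin.elems.card + 4
  | .load _ q => bodyCost tm q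
  | .branch _ q q' => bodyCost tm q + bodyCost tm q'
  | .goto _ => 1
  | .halt => 1

/-- The stacks that represent a configuration of the machine. -/
def repr (R : Regs tm) (a : Turing.TM2.Cfg tm.Γ tm.Λ tm.σ) : Regs tm :=
  { R with
    ctl := st a.l a.var :: R.ctl
    m := fun k => (a.stk k).map (Letter.m k) }

/-- The stacks that represent the stacks of the machine. -/
def reprStk (R : Regs tm) (S : ∀ k, List (tm.Γ k)) : Regs tm :=
  { R with m := fun k => (S k).map (Letter.m k) }

theorem reprStk_update (R : Regs tm) (S : ∀ k, List (tm.Γ k)) (k : tm.K) (l : List (tm.Γ k)) :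
    Function.update (reprStk R S).st (.m k) (l.map (Letter.m k)) =
      (reprStk R (Function.update S k l)).st := by
  rw [Regs.update_m]
  congr 1
  ext1 <;> try rfl
  funext k'
  by_cases h : k' = k
  · subst h; simp [reprStk]
  · simp [reprStk, h]

/-- The internal state is not stored while a statement is executed; it is an index of the program.
After reading from a stack the new state is guessed, and the test on the top letter lets only the
correct guess pass, so the outcome is unique. -/
theorem body_eq {R : Regs tm} {q : Turing.TM2.Stmt tm.Γ tm.Λ tm.σ} {v : tm.σ}
    {S : ∀ k, List (tm.Γ k)} {s'} (h : Rel (body q v) (reprStk R S).st s') :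
    s' = (repr R (Turing.TM2.stepAux q v S)).st := by
  induction q generalizing v S with
  | push k f q ih =>
    simp only [body, rel_seq, rel_push] at h
    obtain ⟨_, rfl, h⟩ := h
    have := reprStk_update R S k (f v :: S k)
    simp only [List.map_cons] at this
    exact ih (by rw [← this]; exact h)
  | peek k f q ih =>
    simp only [body, rel_altL, List.mem_map] at h
    obtain ⟨_, ⟨v', -, rfl⟩, h⟩ := h
    simp only [rel_seq, rel_test, decide_eq_true_eq] at h
    obtain ⟨_, ⟨h₁, rfl⟩, h⟩ := h
    have h₂ := decode_head k (S k)
    simp only [reprStk, Regs.st_m, h₂] at h₁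
    subst h₁
    exact ih h
  | pop k f q ih =>
    simp only [body, rel_altL, List.mem_map] at h
    obtain ⟨_, ⟨v', -, rfl⟩, h⟩ := h
    simp only [rel_seq, rel_test, rel_drop, decide_eq_true_eq] at h
    obtain ⟨_, ⟨h₁, rfl⟩, _, rfl, h⟩ := h
    have h₂ := decode_head k (S k)
    simp only [reprStk, Regs.st_m, h₂] at h₁
    subst h₁
    have := reprStk_update R S k (S k).tail
    rw [List.map_tail] at this
    exact ih (by rw [← this]; exact h)
  | load a q ih => exact ih h
  | branch f q q' ih ih' =>
    simp only [body] at h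
    simp only [Turing.TM2.stepAux]
    cases hf : f v
    · rw [hf] at h
      simp only [Bool.false_eq_true, if_false] at h
      exact ih' h
    · rw [hf] at h
      simp only [if_true] at h
      exact ih h
  | goto f =>
    simp only [body, rel_push] at h
    simpa [repr, reprStk, Turing.TM2.stepAux] using h
  | halt =>
    simp only [body, rel_push] at h
    simpa [repr, reprStk, Turing.TM2.stepAux] using h

theorem to_body {R : Regs tm} {q : Turing.TM2.Stmt tm.Γ tm.Λ tm.σ} {v : tm.σ}
    {S : ∀ k, List (tm.Γ k)} : To (body q v) (bodyCost tm q) (reprStk R S).st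
      (repr R (Turing.TM2.stepAux q v S)).st := by
  have hσ : ∀ v : tm.σ, v ∈ tm.σFin.elems.toList := fun v => by simpa using tm.σFin.complete v
  induction q generalizing v S with
  | push k f q ih =>
    have h₁ := to_push (k := Reg.m k) (a := m k (f v)) (s := (reprStk R S).st)
    have := reprStk_update R S k (f v :: S k)
    simp only [List.map_cons] at this
    have h₂ := h₁.seq ((ih (v := v) (S := Function.update S k (f v :: S k))).cast le_rfl rfl |>
      fun h => by rw [← this] at h; exact h)
    exact h₂.mono (by simp only [bodyCost]; omega)
  | peek k f q ih =>
    refine (to_altL (List.mem_map_of_mem (hσ (f v (S k).head?))) ((to_test ?_).seq ih)).mono ?_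
    · simp only [reprStk, Regs.st_m, decode_head k (S k), decide_true]
    · simp [bodyCost]; omega
  | pop k f q ih =>
    have := reprStk_update R S k (S k).tail
    rw [List.map_tail] at this
    refine (to_altL (List.mem_map_of_mem (hσ (f v (S k).head?))) ((to_test ?_).seq
      (to_drop.seq ((ih (v := f v (S k).head?) (S := Function.update S k (S k).tail)).cast le_rfl rfl
        |> fun h => by rw [← this] at h; exact h)))).mono ?_
    · simp only [reprStk, Regs.st_m, decode_head k (S k), decide_true]
    · simp [bodyCost]; omega
  | load a q ih => exact ih
  | branch f q q' ih ih' =>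
    simp only [body, Turing.TM2.stepAux]
    cases hf : f v
    · simp only [Bool.false_eq_true, if_false, cond_false]
      exact ih'.mono (by simp [bodyCost])
    · simp only [if_true, cond_true]
      exact ih.mono (by simp [bodyCost])
  | goto f => exact to_push.cast le_rfl (by simp [repr, reprStk, Turing.TM2.stepAux])
  | halt => exact to_push.cast le_rfl (by simp [repr, reprStk, Turing.TM2.stepAux])

/-- The program for a step of the machine. -/
def stepM (tm : Turing.FinTM2) : Program tm :=
  altL .x ((tm.ΛFin.elems ×ˢ tm.σFin.elems).toList.map fun q =>
    pop .ctl (st (some q.1) q.2) ;; body (tm.m q.1) q.2)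

/-- A bound for the running time of the program for a step of the machine. -/
def stepCost (tm : Turing.FinTM2) : ℕ :=
  (∑ l ∈ tm.ΛFin.elems, bodyCost tm (tm.m l)) + tm.ΛFin.elems.card * tm.σFin.elems.card + 4

theorem stepM_eq {R : Regs tm} {a : tm.Cfg} {s'} (h : Rel (stepM tm) (repr R a).st s') :
    ∃ b, tm.step a = some b ∧ s' = (repr R b).st := by
  simp only [stepM, rel_altL, List.mem_map] at h
  obtain ⟨_, ⟨⟨l, v⟩, -, rfl⟩, h⟩ := h
  simp only [rel_seq, rel_pop] at h
  obtain ⟨_, ⟨r, h₁, rfl⟩, h⟩ := h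
  simp only [repr, Regs.st_ctl, List.cons.injEq, st.injEq] at h₁
  obtain ⟨⟨h₁, h₂⟩, h₃⟩ := h₁
  obtain ⟨l', v', S⟩ := a
  simp only at h₁ h₂
  subst h₁ h₂ h₃
  refine ⟨Turing.TM2.stepAux (tm.m l) v' S, rfl, body_eq (R := R) ?_⟩
  simpa [repr, reprStk] using h

theorem to_stepM {R : Regs tm} {a b : tm.Cfg} (h : tm.step a = some b) :
    To (stepM tm) (stepCost tm) (repr R a).st (repr R b).st := by
  obtain ⟨_ | l, v, S⟩ := a
  · exact absurd h (by simp [Turing.TM2.step])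
  obtain rfl : Turing.TM2.stepAux (tm.m l) v S = b := Option.some.inj h
  have h₁ := to_pop (s := (repr R (⟨some l, v, S⟩ : tm.Cfg)).st) (k := Reg.ctl)
    (a := st (some l) v) (l := R.ctl) rfl
  have h₂ : Function.update (repr R (⟨some l, v, S⟩ : tm.Cfg)).st .ctl R.ctl = (reprStk R S).st := by
    simp [repr, reprStk]
  rw [h₂] at h₁
  have hmem : (l, v) ∈ (tm.ΛFin.elems ×ˢ tm.σFin.elems).toList := by
    simpa using ⟨tm.ΛFin.complete l, tm.σFin.complete v⟩
  refine (to_altL (List.mem_map_of_mem hmem) (h₁.seq to_body)).mono ?_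
  have := Finset.single_le_sum (f := fun l => bodyCost tm (tm.m l)) (fun _ _ => Nat.zero_le _)
    (tm.ΛFin.complete l)
  simp only [stepCost, List.length_map, Finset.length_toList, Finset.card_product]
  omega

theorem bind_iterate_none {α : Type} (f : α → Option α) (n : ℕ) :
    (flip bind f)^[n] none = none := by
  induction n with
  | zero => rfl
  | succ n ih => rw [Function.iterate_succ_apply]; exact ih

/-- A step from a halting configuration gives `none` for ever, so a deterministic computation visits
at most one halting configuration. -/
theorem iterate_halt_unique {α : Type} {f : α → Option α} {o : Option α} {a b : α} {n n' : ℕ}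
    (ha : (flip bind f)^[n] o = some a) (hb : (flip bind f)^[n'] o = some b)
    (ha' : f a = none) (hb' : f b = none) : a = b := by
  wlog h : n ≤ n' generalizing n n' a b
  · exact (this hb ha hb' ha' (by omega)).symm
  obtain ⟨d, rfl⟩ := Nat.exists_eq_add_of_le h
  rw [Nat.add_comm, Function.iterate_add_apply, ha] at hb
  cases d with
  | zero => simpa using hb
  | succ d =>
    rw [Function.iterate_succ_apply] at hb
    rw [show flip bind f (some a) = none from ha', bind_iterate_none] at hb
    simp at hb

/-- Run the machine on its stacks. -/
def simulate (tm : Turing.FinTM2) : Program tm :=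
  push .ctl (st (some tm.main) tm.initialState) ;; star (stepM tm) ;;
    altL .x (tm.σFin.elems.toList.map fun v => pop .ctl (st none v))

/-- The stacks of the machine when one of them has a given contents and the others are empty. -/
def single (k : tm.K) (l : List (tm.Γ k)) : tm.K → List (Letter tm) :=
  Function.update (fun _ => []) k (l.map (Letter.m k))

theorem push_init {R : Regs tm} {l : List (tm.Γ tm.k₀)} (hm : R.m = single tm.k₀ l) :
    Function.update R.st .ctl (st (some tm.main) tm.initialState :: R.st .ctl) =
      (repr R (Turing.initList tm l)).st := by
  rw [Regs.update_ctl]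
  congr 1
  ext1 <;> try rfl
  funext k
  by_cases h : k = tm.k₀
  · subst h; simp [repr, hm, single, Turing.initList]
  · simp [repr, hm, single, Turing.initList, h]

theorem pop_halt {R : Regs tm} {l : List (tm.Γ tm.k₁)} :
    Function.update (repr R (Turing.haltList tm l)).st .ctl R.ctl =
      { R with m := single tm.k₁ l }.st := by
  rw [Regs.update_ctl]
  congr 1
  ext1 <;> try rfl
  funext k
  by_cases h : k = tm.k₁
  · subst h; simp [repr, single, Turing.haltList]
  · simp [repr, single, Turing.haltList, h]

/-- The iteration may be left at any time, but the final pop demands a halting configuration, and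
that one is unique. -/
theorem simulate_eq {R : Regs tm} {l : List (tm.Γ tm.k₀)} {l' : List (tm.Γ tm.k₁)} {c : ℕ}
    (hm : R.m = single tm.k₀ l) (hM : Turing.TM2OutputsInTime tm l (some l') c) {s'}
    (h : Rel (simulate tm) R.st s') : s' = { R with m := single tm.k₁ l' }.st := by
  simp only [simulate, rel_seq, rel_push, rel_altL, List.mem_map] at h
  obtain ⟨_, rfl, _, h₁, _, ⟨v, -, rfl⟩, h₂⟩ := h
  rw [push_init hm] at h₁
  obtain ⟨n, a, hn, rfl⟩ := star_induction (Inv := fun s' => ∃ n a,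
    (flip bind tm.step)^[n] (some (Turing.initList tm l)) = some a ∧ s' = (repr R a).st) h₁
    ⟨0, _, rfl, rfl⟩ (by
      rintro _ s' ⟨n, a, hn, rfl⟩ h
      obtain ⟨b, hb, rfl⟩ := stepM_eq h
      refine ⟨n + 1, b, ?_, rfl⟩
      rw [Function.iterate_succ_apply', hn]
      exact hb)
  obtain ⟨r, h₃, rfl⟩ := rel_pop.1 h₂
  simp only [repr, Regs.st_ctl, List.cons.injEq, st.injEq] at h₃
  obtain ⟨⟨h₃, -⟩, rfl⟩ := h₃
  have key := iterate_halt_unique hn hM.evals_in_steps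
    (by obtain ⟨_, v, S⟩ := a; simp only at h₃; subst h₃; rfl) rfl
  subst key
  exact pop_halt

theorem to_simulate {R : Regs tm} {l : List (tm.Γ tm.k₀)} {l' : List (tm.Γ tm.k₁)} {c : ℕ}
    (hm : R.m = single tm.k₀ l) (hM : Turing.TM2OutputsInTime tm l (some l') c) :
    To (simulate tm) (c * (stepCost tm + 1) + tm.σFin.elems.card + 7) R.st
      { R with m := single tm.k₁ l' }.st := by
  have key : ∀ n a b, (flip bind tm.step)^[n] (some a) = some b →
      To (star (stepM tm)) (n * (stepCost tm + 1) + 1) (repr R a).st (repr R b).st := by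
    intro n
    induction n with
    | zero =>
      intro a b h
      obtain rfl := Option.some.inj h
      exact to_star_nil.mono (by simp)
    | succ n ih =>
      intro a b h
      rw [Function.iterate_succ_apply] at h
      cases ha : tm.step a with
      | none =>
        rw [show flip bind tm.step (some a) = none from ha, bind_iterate_none] at h
        simp at h
      | some a' =>
        rw [show flip bind tm.step (some a) = some a' from ha] at h
        exact ((to_stepM ha).star_cons (ih a' b h)).mono (by rw [Nat.succ_mul]; omega)
  have h₁ := to_push (k := Reg.ctl) (a := st (some tm.main) tm.initialState) (s := R.st)
  rw [push_init hm] at h₁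
  have h₂ := to_altL (k := Reg.x) (List.mem_map_of_mem
    (f := fun v => (pop .ctl (st none v) : Program tm)) (a := tm.initialState)
    (l := tm.σFin.elems.toList) (by simpa using tm.σFin.complete _))
    (to_pop (s := (repr R (Turing.haltList tm l')).st) (l := R.ctl) rfl)
  rw [pop_halt] at h₂
  refine (h₁.seq ((key _ _ _ hM.evals_in_steps).seq h₂)).mono ?_
  have := Nat.mul_le_mul_right (stepCost tm + 1) hM.steps_le_m
  simp only [List.length_map, Finset.length_toList]
  omega

/-- Run the machine on the number in unary that exceeds the value of the counter `i` by `d`. -/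
def runM (a : tm.Γ tm.k₀) (d : ℕ) : Program tm :=
  loop .i .i' (push (.m tm.k₀) (m tm.k₀ a)) ;;
    pushL (.m tm.k₀) (List.replicate d (m tm.k₀ a)) ;; simulate tm

theorem push_single {R : Regs tm} {k : tm.K} {l l' : List (tm.Γ k)} (hm : R.m = single k l) :
    Function.update R.st (.m k) (l'.map (Letter.m k) ++ R.st (.m k)) =
      { R with m := single k (l' ++ l) }.st := by
  rw [Regs.update_m]
  congr 1
  ext1 <;> try rfl
  simp [hm, single]

theorem runM_eq {R : Regs tm} {a : tm.Γ tm.k₀} {n d : ℕ} {l' : List (tm.Γ tm.k₁)} {c : ℕ}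
    (hR : Ready n R) (hm : R.m = fun _ => [])
    (hM : Turing.TM2OutputsInTime tm (List.replicate (n + d) a) (some l') c) {s'}
    (h : Rel (runM a d) R.st s') : s' = { R with m := single tm.k₁ l' }.st := by
  simp only [runM, rel_seq, rel_pushL] at h
  obtain ⟨_, h₁, _, rfl, h₂⟩ := h
  obtain rfl := loop_i_eq (n := n) (fun p => { R with m := single tm.k₀ (List.replicate p a) })
    (fun _ => hR.i) (fun _ => hR.i') (by ext1 <;> simp [hm, single]) (by
      intro p hp s' h
      obtain rfl := rel_push.1 h
      simp [single, List.replicate_succ]) h₁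
  have := push_single (k := tm.k₀) (l := List.replicate n a) (l' := List.replicate d a)
    (R := { R with m := single tm.k₀ (List.replicate n a) }) rfl
  rw [List.map_replicate] at this
  rw [this] at h₂
  exact simulate_eq (R := { R with m := _ }) (l := List.replicate d a ++ List.replicate n a) rfl
    (by rw [← List.replicate_add, Nat.add_comm d]; exact hM) h₂

/-- A bound for the running time of `runM`. -/
def runCost (tm : Turing.FinTM2) (n d c : ℕ) : ℕ :=
  loopCost n 1 + 2 * d + c * (stepCost tm + 1) + tm.σFin.elems.card + 10

theorem to_runM {R : Regs tm} {a : tm.Γ tm.k₀} {n d : ℕ} {l' : List (tm.Γ tm.k₁)} {c : ℕ}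
    (hR : Ready n R) (hm : R.m = fun _ => [])
    (hM : Turing.TM2OutputsInTime tm (List.replicate (n + d) a) (some l') c) :
    To (runM a d) (runCost tm n d c) R.st { R with m := single tm.k₁ l' }.st := by
  have h₁ := to_loop_i (n := n) (c := 1) (B := push (.m tm.k₀) (m tm.k₀ a))
    (R := R) (fun p => { R with m := single tm.k₀ (List.replicate p a) })
    (fun _ => hR.i) (fun _ => hR.i') (by ext1 <;> simp [hm, single]) rfl
    (fun p hp => to_push.cast le_rfl (by simp [single, List.replicate_succ]))
  have h₂ := to_pushL (k := Reg.m tm.k₀) (l := List.replicate d (m tm.k₀ a))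
    (s := { R with m := single tm.k₀ (List.replicate n a) }.st)
  have := push_single (k := tm.k₀) (l := List.replicate n a) (l' := List.replicate d a)
    (R := { R with m := single tm.k₀ (List.replicate n a) }) rfl
  rw [List.map_replicate] at this
  rw [this] at h₂
  have h₃ := to_simulate (l := List.replicate d a ++ List.replicate n a)
    (R := { R with m := single tm.k₀ (List.replicate d a ++ List.replicate n a) }) rfl
    (by rw [← List.replicate_add, Nat.add_comm d]; exact hM)
  exact (h₁.seq (h₂.seq h₃)).mono (by simp [runCost]; omega)

/-- No more letters can be on a stack than there were steps to write them. This is the only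
information available about the size of the formula. -/
theorem length_output_le {R : Regs tm} {a : tm.Γ tm.k₀} {n d : ℕ} {l' : List (tm.Γ tm.k₁)} {c : ℕ}
    (hR : Ready n R) (hm : R.m = fun _ => [])
    (hM : Turing.TM2OutputsInTime tm (List.replicate (n + d) a) (some l') c) :
    l'.length ≤ runCost tm n d c := by
  obtain ⟨N, hN, h⟩ := to_runM hR hm hM
  simpa [hm, single] using (h.length_le (Reg.m tm.k₁)).trans (Nat.add_le_add_left hN _)

end

end Prog
end SymBreak

/-! ### Checking a generated formula against a table, and comparing tables -/

namespace SymBreak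
namespace Prog

open Letter

theorem walk_sound_forall {K Γ α : Type} [DecidableEq K] {B : Prog K Γ} (Q : α → Prop)
    (F : List α → List α → K → List Γ)
    (hB : ∀ p l s', Rel B (F p l) s' → ∃ a l', l = a :: l' ∧ Q a ∧ s' = F (a :: p) l')
    {p l : List α} {s' : K → List Γ} (h : Rel (star B) (F p l) s') :
    ∃ l₁ l₂, l = l₁ ++ l₂ ∧ (∀ a ∈ l₁, Q a) ∧ s' = F (l₁.reverse ++ p) l₂ := by
  refine star_induction (Inv := fun s' => ∃ l₁ l₂, l = l₁ ++ l₂ ∧ (∀ a ∈ l₁, Q a) ∧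
    s' = F (l₁.reverse ++ p) l₂) h ⟨[], l, by simp⟩ ?_
  rintro _ s₂ ⟨l₁, l₂, rfl, h₁, rfl⟩ h'
  obtain ⟨a, l', rfl, ha, rfl⟩ := hB _ _ _ h'
  refine ⟨l₁ ++ [a], l', by simp, ?_, by simp⟩
  intro b hb
  rcases List.mem_append.1 hb with hb | hb
  · exact h₁ b hb
  · rwa [List.mem_singleton.1 hb]

variable {tm : Turing.FinTM2}

theorem append_split {α : Type} {p q l r : List α} {a : α} (h : p ++ q = l ++ a :: r)
    (ha : a ∉ p) : ∃ l', l = p ++ l' ∧ q = l' ++ a :: r := by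
  rcases List.append_eq_append_iff.1 h with ⟨l', rfl, rfl⟩ | ⟨p', rfl, h'⟩
  · exact ⟨l', rfl, rfl⟩
  · cases p' with
    | nil => exact ⟨[], by simp, by simpa using h'.symm⟩
    | cons b p' =>
      obtain ⟨rfl, -⟩ := List.cons.inj h'
      simp at ha

/-- Signs occur only at the beginnings of entries, so reading a sign after an arbitrary skip means
standing at an entry. -/
theorem table_split {E : List (Bool × List Bool)} {l r : List (Letter tm)} {b : Bool}
    (h : table E = l ++ sgn b :: r) : ∃ E₁ c E₂, E = E₁ ++ (b, c) :: E₂ ∧ l = table E₁ ∧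
      r = bits c ++ sep :: table E₂ := by
  induction E generalizing l with
  | nil => simp at h
  | cons e E ih =>
    rw [table_cons] at h
    cases l with
    | nil =>
      simp only [List.nil_append, List.cons.injEq, sgn.injEq] at h
      obtain ⟨h₁, h₂⟩ := h
      exact ⟨[], e.2, E, by rw [← h₁]; rfl, rfl, h₂.symm⟩
    | cons a l =>
      simp only [List.cons_append, List.cons.injEq] at h
      obtain ⟨rfl, h⟩ := h
      obtain ⟨l', rfl, h₁⟩ := append_split (p := bits e.2 ++ [sep]) (q := table E)
        (by simpa using h) (by simp)
      obtain ⟨E₁, c, E₂, rfl, rfl, rfl⟩ := ih h₁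
      exact ⟨e :: E₁, c, E₂, rfl, by simp, rfl⟩

theorem length_table {E : List (Bool × List Bool)} {k : ℕ} (hE : ∀ e ∈ E, e.2.length = k) :
    (table E : List (Letter tm)).length = E.length * (k + 2) := by
  induction E with
  | nil => simp
  | cons e E ih =>
    have h₁ := ih fun e he => hE e (List.mem_cons_of_mem _ he)
    have h₂ := hE e (by simp)
    simp only [table_cons, List.length_cons, List.length_append, bits, List.length_map, h₁, h₂]
    ring

noncomputable section

/-! ### Evaluation of a formula -/

/-- A literal as a word. -/
def litWord (q : Bool × List Bool) : List (Option Bool) := some q.1 :: q.2.map some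

/-- A clause as a word. -/
def clauseWord (C : List (Bool × List Bool)) : List (Option Bool) := C.flatMap litWord ++ [none]

section

variable (κ : tm.K) (o : Option Bool → tm.Γ κ)

/-- The representation of a word on a stack of the machine. -/
abbrev outLetters (l : List (Option Bool)) : List (Letter tm) := l.map fun a => m κ (o a)

/-- Change the contents of a stack of the machine. -/
abbrev withOut (R : Regs tm) (l : List (Option Bool)) : Regs tm :=
  { R with m := Function.update R.m κ (outLetters κ o l) }

/-- Pairs of bits, which have to be equal if `strict` holds. -/
abbrev strictPairs (strict : Bool) : List (Bool × Bool) :=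
  bitPairs.filter fun q => !strict || q.1 == q.2

/-- Scan a bit of a literal of the formula and a bit of a table entry. -/
def scanBit (strict w : Bool) : Program tm :=
  altL .x ((strictPairs strict).map fun q =>
    pop (.w w) (bit q.1) ;; pop (.m κ) (m κ (o (some q.2))) ;; push .t (bit q.1))

/-- Scan a literal of the formula and a table entry, which have to agree if `strict` holds. -/
def scanLit (strict w : Bool) : Program tm :=
  transfer tableLetters (.w w) .t ;;
  altL .x ((strictPairs strict).map fun q =>
    pop (.w w) (sgn q.1) ;; pop (.m κ) (m κ (o (some q.2))) ;; push .t (sgn q.1)) ;;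
  star (scanBit κ o strict w) ;; pop (.w w) sep ;; push .t sep ;; moveAll tableLetters .t (.w w)

/-- The stacks in the course of scanning a literal. -/
def scanRegs (R : Regs tm) (w : Bool) (r u : List (Letter tm)) (v : List (Option Bool))
    (p l : List (Bool × Bool)) : Regs tm :=
  { R with
    w := Function.update R.w w (bits (l.map Prod.fst) ++ r)
    t := bits (p.map Prod.fst) ++ u
    m := Function.update R.m κ (outLetters κ o (l.map (fun q => some q.2) ++ v)) }

variable {κ o}

theorem mem_strictPairs {strict : Bool} {q : Bool × Bool} :
    q ∈ strictPairs strict ↔ (strict = true → q.1 = q.2) := by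
  obtain ⟨_ | _, _ | _⟩ := q <;> cases strict <;> simp

/-- The literal is read in parallel with a freely chosen table entry. As all words have length `k`,
the separator of the entry stops the reading exactly at the end of the literal. The condition on `r`
says that no further literal follows `C`, so the literal read belongs to `C`. Strict scanning lets
only equal pairs of letters pass. -/
theorem scanLit_sound (ho : Function.Injective o) {strict w : Bool} {R : Regs tm} {k : ℕ}
    {E : List (Bool × List Bool)} (hE : ∀ e ∈ E, e.2.length = k)
    (hw : R.w w = table E) (ht : R.t = []) {C : List (Bool × List Bool)}
    (hC : ∀ q ∈ C, q.2.length = k) {r : List (Option Bool)}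
    (hr : ∀ b r', r ≠ some b :: r') {s'}
    (h : Rel (scanLit κ o strict w) (withOut κ o R (C.flatMap litWord ++ r)).st s') :
    ∃ q C', C = q :: C' ∧ (strict = true → q ∈ E) ∧
      s' = (withOut κ o R (C'.flatMap litWord ++ r)).st := by
  simp only [scanLit, rel_seq] at h
  obtain ⟨s₁, h₁, s₂, h₂, s₃, h₃, s₄, h₄, s₅, h₅, h₆⟩ := h
  obtain ⟨l, r₁, h₇, -, rfl⟩ := rel_transfer (by simp) h₁
  simp only [rel_altL, List.mem_map] at h₂
  obtain ⟨_, ⟨⟨b, b'⟩, hb, rfl⟩, h₂⟩ := h₂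
  rw [mem_strictPairs] at hb
  simp only [rel_seq, rel_pop, rel_push] at h₂
  obtain ⟨_, ⟨r₂, h₈, rfl⟩, _, ⟨r₃, h₉, rfl⟩, rfl⟩ := h₂
  simp only [Regs.st_w, Regs.update_w, Regs.st_t, Regs.update_t, Function.update_self,
    Function.update_idem, Regs.st_m, hw, ht, List.append_nil] at h₇ h₈ h₉ h₃
  subst h₈
  obtain ⟨E₁, c, E₂, rfl, rfl, rfl⟩ := table_split h₇
  cases C with
  | nil =>
    cases r with
    | nil => simp at h₉
    | cons a r =>
      simp only [List.flatMap_nil, List.nil_append, outLetters, List.map_cons, List.cons.injEq,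
        m.injEq, heq_eq_eq, true_and, ho.eq_iff] at h₉
      exact absurd (by rw [h₉.1]) (hr b' r)
  | cons q C =>
    simp only [List.flatMap_cons, litWord, outLetters, List.cons_append, List.map_cons,
      List.cons.injEq, m.injEq, heq_eq_eq, true_and, ho.eq_iff, Option.some.injEq] at h₉
    obtain ⟨rfl, rfl⟩ := h₉
    have hlen : c.length = q.2.length := by
      rw [hE (b, c) (by simp), hC q (by simp)]
    have e₁ : (c.zip q.2).map Prod.fst = c := List.map_fst_zip hlen.le
    have e₂ : (c.zip q.2).map Prod.snd = q.2 := List.map_snd_zip hlen.ge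
    have e₃ : (c.zip q.2).map (fun q => some q.2) = q.2.map some := by
      conv_rhs => rw [← e₂, List.map_map]
      rfl
    obtain ⟨v, hv⟩ : ∃ v, C.flatMap litWord ++ r = v := ⟨_, rfl⟩
    have hF : Rel (star (scanBit κ o strict w)) (scanRegs κ o R w (sep :: table E₂) (sgn b :: (table E₁).reverse) v []
        (c.zip q.2)).st s₃ := by
      convert h₃ using 2
      simp [scanRegs, e₁, e₃, hv]
    obtain ⟨l₁, l₂, h₁₀, h₁₁, rfl⟩ := walk_sound_forall (fun q => strict = true → q.1 = q.2)
      (fun p l => (scanRegs κ o R w (sep :: table E₂) (sgn b :: (table E₁).reverse) v p l).st) (by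
        intro p l s' h
        simp only [scanBit, rel_altL, List.mem_map] at h
        obtain ⟨_, ⟨⟨β, γ⟩, hβ, rfl⟩, h⟩ := h
        rw [mem_strictPairs] at hβ
        simp only [rel_seq, rel_pop, rel_push] at h
        obtain ⟨_, ⟨r₂, h₈, rfl⟩, _, ⟨r₃, h₉, rfl⟩, rfl⟩ := h
        cases l with
        | nil => simp [scanRegs] at h₈
        | cons a l =>
          simp only [scanRegs, Regs.st_w, Function.update_self, bits, List.map_cons,
            List.cons_append, List.cons.injEq, bit.injEq] at h₈
          obtain ⟨rfl, rfl⟩ := h₈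
          simp only [scanRegs, Regs.update_w, Regs.st_m, Function.update_self, outLetters,
            List.map_cons, List.cons_append, List.cons.injEq, m.injEq, heq_eq_eq, true_and,
            ho.eq_iff, Option.some.injEq] at h₉
          obtain ⟨rfl, rfl⟩ := h₉
          exact ⟨a, l, rfl, hβ, by simp [scanRegs]⟩) hF
    obtain ⟨r₄, h₁₂, rfl⟩ := rel_pop.1 h₄
    obtain rfl := rel_push.1 h₅
    cases l₂ with
    | cons a l₂ => simp [scanRegs] at h₁₂
    | nil =>
      simp only [scanRegs, Regs.st_w, Function.update_self, List.map_nil, List.nil_append, bits,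
        List.cons.injEq, true_and] at h₁₂
      subst h₁₂
      obtain ⟨-, rfl⟩ := rel_moveAll (by simp) h₆
      rw [List.append_nil] at h₁₀
      subst h₁₀
      refine ⟨q, C, rfl, fun hs => ?_, ?_⟩
      · have : c = q.2 := by
          conv_lhs => rw [← e₁]
          conv_rhs => rw [← e₂]
          exact List.map_congr_left fun q hq => h₁₁ q hq hs
        have hb' : b = q.1 := hb hs
        have : q = (b, c) := by rw [hb', this]
        simp [this]
      · rw [hv]
        have hw' := hw
        simp only [table_append, table_cons] at hw'
        simp only [scanRegs, Regs.update_w, Regs.update_t, Regs.st_t, Regs.st_w,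
          Function.update_self, Function.update_idem]
        congr 1
        ext1 <;> simp [ht, hw', List.map_reverse, e₁]
/-- A bound for the running time of scanning a literal. -/
def scanCost (k T : ℕ) : ℕ := 22 * T + 40 * k + 80

/-- If scanning is not strict, any entry `e` will do: it serves merely as a ruler that measures the
length of the literal. -/
theorem to_scanLit {strict w : Bool} {R : Regs tm} {k : ℕ}
    {E : List (Bool × List Bool)} (hE : ∀ e ∈ E, e.2.length = k)
    (hw : R.w w = table E) (ht : R.t = []) {e q : Bool × List Bool} (he : e ∈ E)
    (hq : q.2.length = k) (hs : strict = true → e = q) {r : List (Option Bool)} :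
    To (scanLit κ o strict w) (scanCost k (E.length * (k + 2)))
      (withOut κ o R (litWord q ++ r)).st (withOut κ o R r).st := by
  obtain ⟨E₁, E₂, rfl⟩ := List.append_of_mem he
  obtain ⟨b, c⟩ := e
  obtain ⟨b', c'⟩ := q
  have hc := hE _ he
  simp only at hc hq
  have e₁ : (c.zip c').map Prod.fst = c := List.map_fst_zip (by omega)
  have e₂ : (c.zip c').map Prod.snd = c' := List.map_snd_zip (by omega)
  have e₃ : (c.zip c').map (fun q => some q.2) = c'.map some := by
    conv_rhs => rw [← e₂, List.map_map]
    rfl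
  have hlen := length_table (tm := tm) hE
  have h₁ := to_transfer (A := tableLetters) (u := Reg.w w) (v := Reg.t) (by simp)
    (s := (withOut κ o R (litWord (b', c') ++ r)).st) (l := table E₁)
    (r := sgn b :: (bits c ++ sep :: table E₂)) (by simp [hw]) (table_subset E₁)
  have h₂ := to_altL (k := Reg.x) (List.mem_map_of_mem (f := fun q : Bool × Bool =>
      (pop (.w w) (sgn q.1) ;; pop (.m κ) (m κ (o (some q.2))) ;; push .t (sgn q.1) : Program tm))
      (a := (b, b')) (l := strictPairs strict) (by
        rw [mem_strictPairs]; intro h; exact congrArg Prod.fst (hs h)))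
    ((to_pop (s := { withOut κ o R (litWord (b', c') ++ r) with
        w := Function.update R.w w (sgn b :: (bits c ++ sep :: table E₂))
        t := (table E₁).reverse }.st) (k := Reg.w w) (a := sgn b)
        (l := bits c ++ sep :: table E₂) (by simp)).seq
      ((to_pop (k := Reg.m κ) (a := m κ (o (some b'))) (l := outLetters κ o (c'.map some ++ r))
        (by simp [litWord])).seq to_push))
  have h₃ := to_walk (B := scanBit κ o strict w) (c := 14)
    (fun p l => (scanRegs κ o R w (sep :: table E₂) (sgn b :: (table E₁).reverse) r p l).st)
    (p := []) (l₁ := c.zip c') (l₂ := []) (by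
      intro p q l hq
      have hq' : q ∈ strictPairs strict := by
        rw [mem_strictPairs]
        intro h
        have h' : c = c' := congrArg Prod.snd (hs h)
        subst h'
        obtain ⟨i, hi, rfl⟩ := List.getElem_of_mem hq
        simp
      refine (to_altL (List.mem_map_of_mem hq')
        ((to_pop (a := bit q.1) (l := bits (l.map Prod.fst) ++ sep :: table E₂)
          (by simp [scanRegs])).seq ((to_pop (k := Reg.m κ) (a := m κ (o (some q.2)))
          (l := outLetters κ o (l.map (fun q => some q.2) ++ r)) (by simp [scanRegs])).seq
          to_push))).cast ?_ (by simp [scanRegs])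
      have := List.length_filter_le (fun q => !strict || q.1 == q.2) bitPairs
      simp at this ⊢
      omega)
  have h₄ := to_pop (s := (scanRegs κ o R w (sep :: table E₂) (sgn b :: (table E₁).reverse) r
    ((c.zip c').reverse ++ []) []).st) (k := Reg.w w) (a := sep) (l := table E₂)
    (by simp [scanRegs])
  have h₅ := to_moveAll (A := tableLetters) (u := Reg.t) (v := Reg.w w) (by simp)
    (s := { withOut κ o R r with
      w := Function.update R.w w (table E₂)
      t := (table (E₁ ++ [(b, c)])).reverse }.st)
    (fun a ha => table_subset (E₁ ++ [(b, c)]) a (by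
      rw [Regs.st_t, List.mem_reverse] at ha; exact ha))
  have h₆ := h₄.seq ((to_push.cast le_rfl (by simp [scanRegs, e₁, List.map_reverse]) :
    To (push .t sep) _ _ { withOut κ o R r with
      w := Function.update R.w w (table E₂)
      t := (table (E₁ ++ [(b, c)])).reverse }.st).seq h₅)
  have h₇ := (h₂.cast le_rfl (by simp [scanRegs, e₁, e₃]) : To _ _ _ (scanRegs κ o R w
    (sep :: table E₂) (sgn b :: (table E₁).reverse) r [] (c.zip c' ++ [])).st).seq (h₃.seq h₆)
  have h₈ := (h₁.cast le_rfl (by simp [ht]) : To _ _ _ { withOut κ o R (litWord (b', c') ++ r) with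
        w := Function.update R.w w (sgn b :: (bits c ++ sep :: table E₂))
        t := (table E₁).reverse }.st).seq h₇
  have h₉ : (strictPairs strict).length ≤ 4 := List.length_filter_le _ _
  refine h₈.cast ?_ ?_
  · rw [scanCost, ← hlen]
    simp only [Regs.st_t, List.length_reverse, List.length_zip, hc, hq,
      List.length_map, min_self, List.length_cons, List.length_nil, table_append, table_cons,
      List.length_append, table_nil]
    omega
  · simp only [table_append, table_cons] at hw
    simp only [Regs.update_w, Regs.update_t, Regs.st_t, Regs.st_w,
      Function.update_self, Function.update_idem, List.reverse_reverse]
    congr 1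
    ext1 <;> simp [ht, hw]

variable (κ o) in
/-- Scan a clause of the formula that contains an entry of the table. -/
def scanClause (w : Bool) : Program tm :=
  star (scanLit κ o false w) ;; scanLit κ o true w ;; star (scanLit κ o false w) ;;
    pop (.m κ) (m κ (o none))

theorem scanLits_sound (ho : Function.Injective o) {w : Bool} {R : Regs tm} {k : ℕ}
    {E : List (Bool × List Bool)} (hE : ∀ e ∈ E, e.2.length = k)
    (hw : R.w w = table E) (ht : R.t = []) {C : List (Bool × List Bool)}
    (hC : ∀ q ∈ C, q.2.length = k) {r : List (Option Bool)}
    (hr : ∀ b r', r ≠ some b :: r') {s'}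
    (h : Rel (star (scanLit κ o false w)) (withOut κ o R (C.flatMap litWord ++ r)).st s') :
    ∃ C' ⊆ C, s' = (withOut κ o R (C'.flatMap litWord ++ r)).st := by
  refine star_induction (Inv := fun s' => ∃ C' ⊆ C, s' =
    (withOut κ o R (C'.flatMap litWord ++ r)).st) h ⟨C, fun _ h => h, rfl⟩ ?_
  rintro _ s' ⟨C', hC', rfl⟩ h
  obtain ⟨q, C'', rfl, -, rfl⟩ := scanLit_sound ho hE hw ht (fun q hq => hC q (hC' hq)) hr h
  exact ⟨C'', fun q hq => hC' (List.mem_cons_of_mem _ hq), rfl⟩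

/-- The one literal that is scanned strictly witnesses that the clause is true. The end marker of
the clause has to be popped, so the scan covers this clause and no other. -/
theorem scanClause_sound (ho : Function.Injective o) {w : Bool} {R : Regs tm} {k : ℕ}
    {E : List (Bool × List Bool)} (hE : ∀ e ∈ E, e.2.length = k)
    (hw : R.w w = table E) (ht : R.t = []) {C : List (Bool × List Bool)}
    (hC : ∀ q ∈ C, q.2.length = k) {r : List (Option Bool)} {s'}
    (h : Rel (scanClause κ o w) (withOut κ o R (clauseWord C ++ r)).st s') :
    (∃ q ∈ C, q ∈ E) ∧ s' = (withOut κ o R r).st := by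
  simp only [scanClause, rel_seq, clauseWord, List.append_assoc, List.singleton_append] at h
  obtain ⟨s₁, h₁, s₂, h₂, s₃, h₃, h₄⟩ := h
  obtain ⟨C₁, hC₁, rfl⟩ := scanLits_sound ho hE hw ht hC (by simp) h₁
  obtain ⟨q, C₂, rfl, hq, rfl⟩ := scanLit_sound ho hE hw ht (fun q hq => hC q (hC₁ hq)) (by simp) h₂
  obtain ⟨C₃, hC₃, rfl⟩ := scanLits_sound ho hE hw ht
    (fun q hq => hC q (hC₁ (List.mem_cons_of_mem _ hq))) (by simp) h₃
  refine ⟨⟨q, hC₁ (by simp), hq rfl⟩, ?_⟩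
  obtain ⟨l, h₅, rfl⟩ := rel_pop.1 h₄
  cases C₃ with
  | cons q C => simp [litWord, ho.eq_iff] at h₅
  | nil =>
    simp only [List.flatMap_nil, List.nil_append, outLetters, Regs.st_m, Function.update_self,
      List.map_cons, List.cons.injEq, true_and] at h₅
    simp [← h₅]

theorem to_scanLits {w : Bool} {R : Regs tm} {k : ℕ}
    {E : List (Bool × List Bool)} (hE : ∀ e ∈ E, e.2.length = k)
    (hw : R.w w = table E) (ht : R.t = []) {e : Bool × List Bool} (he : e ∈ E)
    {C : List (Bool × List Bool)} (hC : ∀ q ∈ C, q.2.length = k) {r : List (Option Bool)} :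
    To (star (scanLit κ o false w)) (C.length * (scanCost k (E.length * (k + 2)) + 1) + 1)
      (withOut κ o R (C.flatMap litWord ++ r)).st (withOut κ o R r).st := by
  have h := to_walk (B := scanLit κ o false w) (c := scanCost k (E.length * (k + 2)))
    (fun _ C => (withOut κ o R (C.flatMap litWord ++ r)).st) (p := []) (l₁ := C) (l₂ := []) (by
      intro p q l hq
      simp only [List.flatMap_cons, List.append_assoc]
      exact to_scanLit hE hw ht he (hC q hq) (by simp))
  simpa only [List.append_nil, List.flatMap_nil, List.nil_append] using h

theorem to_scanClause {w : Bool} {R : Regs tm} {k : ℕ}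
    {E : List (Bool × List Bool)} (hE : ∀ e ∈ E, e.2.length = k)
    (hw : R.w w = table E) (ht : R.t = []) {C : List (Bool × List Bool)}
    (hC : ∀ q ∈ C, q.2.length = k) (hCE : ∃ q ∈ C, q ∈ E) {r : List (Option Bool)} :
    To (scanClause κ o w) (C.length * (scanCost k (E.length * (k + 2)) + 1) + 8)
      (withOut κ o R (clauseWord C ++ r)).st (withOut κ o R r).st := by
  obtain ⟨q, hq, hqE⟩ := hCE
  obtain ⟨C₁, C₂, rfl⟩ := List.append_of_mem hq
  have h₁ := to_scanLits (κ := κ) (o := o) hE hw ht hqE (C := C₁)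
    (fun q hq => hC q (by simp [hq])) (r := litWord q ++ (C₂.flatMap litWord ++ none :: r))
  have h₂ := to_scanLit (κ := κ) (o := o) (strict := true) hE hw ht hqE (q := q)
    (hC q (by simp)) (by simp) (r := C₂.flatMap litWord ++ none :: r)
  have h₃ := to_scanLits (κ := κ) (o := o) hE hw ht hqE (C := C₂)
    (fun q hq => hC q (by simp [hq])) (r := none :: r)
  have h₄ := to_pop (s := (withOut κ o R (none :: r)).st) (k := Reg.m κ) (a := m κ (o none))
    (l := outLetters κ o r) (by simp)
  have h₅ := h₁.seq (h₂.seq (h₃.seq h₄))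
  simp only [Regs.update_m, Function.update_idem] at h₅
  rw [clauseWord, List.flatMap_append, List.flatMap_cons]
  simp only [List.append_assoc, List.singleton_append]
  refine h₅.mono ?_
  simp only [List.length_append, List.length_cons]
  ring_nf
  omega

variable (κ o) in
/-- Evaluate the formula, if it is satisfied by the assignment in the table. -/
def scanFormula (w : Bool) : Program tm :=
  star (scanClause κ o w) ;; emp (.m κ)

theorem scanFormula_sound (ho : Function.Injective o) {w : Bool} {R : Regs tm} {k : ℕ}
    {E : List (Bool × List Bool)} (hE : ∀ e ∈ E, e.2.length = k)
    (hw : R.w w = table E) (ht : R.t = []) {F : List (List (Bool × List Bool))}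
    (hF : ∀ C ∈ F, ∀ q ∈ C, q.2.length = k) {s'}
    (h : Rel (scanFormula κ o w) (withOut κ o R (F.flatMap clauseWord)).st s') :
    (∀ C ∈ F, ∃ q ∈ C, q ∈ E) ∧ s' = (withOut κ o R []).st := by
  simp only [scanFormula, rel_seq, rel_emp] at h
  obtain ⟨s₁, h₁, h₂, rfl⟩ := h
  -- Here `F'` are the clauses still to be scanned. It suffices to know that a clause not occurring
  -- among them has been found true.
  obtain ⟨F', hF', h₃, rfl⟩ := star_induction (Inv := fun s' => ∃ F' ⊆ F,
    (∀ C ∈ F, C ∉ F' → ∃ q ∈ C, q ∈ E) ∧ s' = (withOut κ o R (F'.flatMap clauseWord)).st) h₁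
    ⟨F, fun _ h => h, fun _ h h' => absurd h h', rfl⟩ (by
      rintro s s' ⟨F', hF', h₃, rfl⟩ h
      cases F' with
      | nil =>
        -- With no clause left there is no literal for the strict scan, so this round is impossible.
        simp only [scanClause, rel_seq] at h
        obtain ⟨s₁, h₄, s₂, h₅, -⟩ := h
        obtain ⟨C, hC, rfl⟩ := scanLits_sound ho hE hw ht (C := []) (by simp) (r := []) (by simp) h₄
        obtain ⟨q, C', rfl, -⟩ := scanLit_sound ho hE hw ht
          (fun q hq => absurd (hC hq) (by simp)) (by simp) h₅
        exact absurd (hC (List.mem_cons_self)) (by simp)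
      | cons C F' =>
        rw [List.flatMap_cons] at h
        obtain ⟨h₄, rfl⟩ := scanClause_sound ho hE hw ht (hF C (hF' (by simp))) h
        refine ⟨F', fun C hC => hF' (by simp [hC]), fun C' hC' hC'' => ?_, rfl⟩
        by_cases hCC : C' = C
        · rw [hCC]; exact h₄
        · exact h₃ C' hC' (by simp [hCC, hC'']))
  cases F' with
  | nil => exact ⟨fun C hC => h₃ C hC (by simp), by simp⟩
  | cons C F' => simp [clauseWord] at h₂

/-- A bound for the running time of the evaluation of a formula. -/
def formulaCost (k T N : ℕ) : ℕ := N * (N * (scanCost k T + 1) + 9) + 3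

theorem to_scanFormula {w : Bool} {R : Regs tm} {k N : ℕ}
    {E : List (Bool × List Bool)} (hE : ∀ e ∈ E, e.2.length = k)
    (hw : R.w w = table E) (ht : R.t = []) {F : List (List (Bool × List Bool))}
    (hF : ∀ C ∈ F, ∀ q ∈ C, q.2.length = k) (hFE : ∀ C ∈ F, ∃ q ∈ C, q ∈ E)
    (hN : (F.flatMap clauseWord).length ≤ N) :
    To (scanFormula κ o w) (formulaCost k (E.length * (k + 2)) N)
      (withOut κ o R (F.flatMap clauseWord)).st (withOut κ o R []).st := by
  have hlit : ∀ C : List (Bool × List Bool), C.length ≤ (C.flatMap litWord).length := by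
    intro C
    induction C with
    | nil => simp
    | cons q C ih =>
      simp only [List.flatMap_cons, litWord, List.length_append, List.length_cons] at ih ⊢
      omega
  -- Both the number of clauses and the length of each are bounded by the length of the written
  -- formula, since every clause and every literal occupies at least one letter.
  have hclause : ∀ F : List (List (Bool × List Bool)), F.length ≤ (F.flatMap clauseWord).length ∧
      ∀ C ∈ F, C.length ≤ (F.flatMap clauseWord).length := by
    intro F
    induction F with
    | nil => simp
    | cons C F ih =>
      have := hlit C
      simp only [List.flatMap_cons, clauseWord, List.length_append, List.length_cons,
        List.mem_cons, forall_eq_or_imp, List.length_nil] at ih ⊢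
      refine ⟨by omega, by omega, fun C' hC' => (ih.2 C' hC').trans (by omega)⟩
  obtain ⟨hN₁, hN₂⟩ := hclause F
  have h := to_walk (B := scanClause κ o w) (c := N * (scanCost k (E.length * (k + 2)) + 1) + 8)
    (fun _ F => (withOut κ o R (F.flatMap clauseWord)).st) (p := []) (l₁ := F) (l₂ := []) (by
      intro p C l hC
      rw [List.flatMap_cons]
      refine (to_scanClause hE hw ht (hF C hC) (hFE C hC)).mono ?_
      have := Nat.mul_le_mul_right (scanCost k (E.length * (k + 2)) + 1) ((hN₂ C hC).trans hN)
      omega)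
  rw [List.append_nil] at h
  refine (h.seq (to_emp (k := Reg.m κ) (by simp))).mono ?_
  have := Nat.mul_le_mul_right (N * (scanCost k (E.length * (k + 2)) + 1) + 9) (hN₁.trans hN)
  simp only [formulaCost, Nat.add_assoc] at this ⊢
  norm_num
  omega

end

/-! ### Contradictions between tables -/

/-- Compare two bits. -/
def compareBit (w : Bool) : Program tm :=
  altL .x ([false, true].map fun β => pop .c' (bit β) ;; pop (.w w) (bit β))

/-- Find an entry of the table on `u` such that the opposite entry is in the table on `v`. -/
def diff (u v : Bool) : Program tm :=
  altL .x ([false, true].map fun b =>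
    star (drop (.w u)) ;; pop (.w u) (sgn b) ;; transfer bitLetters (.w u) .c ;; pop (.w u) sep ;;
    moveAll bitLetters .c .c' ;;
    star (drop (.w v)) ;; pop (.w v) (sgn !b) ;;
    star (compareBit v) ;; emp .c' ;; pop (.w v) sep)

theorem drops_sound {R : Regs tm} {w : Bool} {s'} (h : Rel (star (drop (.w w))) R.st s') :
    ∃ l r, R.w w = l ++ r ∧ s' = { R with w := Function.update R.w w r }.st := by
  refine star_induction (Inv := fun s' => ∃ l r, R.w w = l ++ r ∧
    s' = { R with w := Function.update R.w w r }.st) h ⟨[], R.w w, by simp⟩ ?_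
  rintro _ s' ⟨l, r, hlr, rfl⟩ h
  obtain rfl := rel_drop.1 h
  cases r with
  | nil => exact ⟨l, [], hlr, by simp⟩
  | cons a r => exact ⟨l ++ [a], r, by simp [hlr], by simp⟩

theorem to_drops {R : Regs tm} {w : Bool} {l r : List (Letter tm)} (h : R.w w = l ++ r) :
    To (star (drop (.w w))) (l.length * 2 + 1) R.st
      { R with w := Function.update R.w w r }.st := by
  have h₁ := to_walk (B := drop (.w w)) (c := 1)
    (fun _ l => { R with w := Function.update R.w w (l ++ r) }.st)
    (p := []) (l₁ := l) (l₂ := []) (by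
      intro p a l ha
      exact to_drop.cast le_rfl (by simp))
  have hR : { R with w := Function.update R.w w (l ++ [] ++ r) } = R := by
    ext1 <;> simp [← h]
  rw [hR] at h₁
  exact h₁

/-- The stacks in the course of comparing two words. -/
def compareRegs (R : Regs tm) (w : Bool) (r : List (Letter tm)) (l l' : List Bool) : Regs tm :=
  { R with
    w := Function.update R.w w (bits l ++ r)
    c' := bits l' }

theorem diff_sound {R : Regs tm} {u v : Bool} {T : Bool → List (Bool × List Bool)}
    (hw : ∀ b, R.w b = table (T b)) (hc : R.c = []) (hc' : R.c' = []) {s'}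
    (h : Rel (diff u v) R.st s') : ∃ b c, (b, c) ∈ T u ∧ (!b, c) ∈ T v := by
  simp only [diff, rel_altL, List.mem_map] at h
  obtain ⟨_, ⟨b, -, rfl⟩, h⟩ := h
  simp only [rel_seq] at h
  obtain ⟨s₁, h₁, s₂, h₂, s₃, h₃, s₄, h₄, s₅, h₅, s₆, h₆, s₇, h₇, s₈, h₈, s₉, h₉, h₁₀⟩ := h
  obtain ⟨l, r, h, rfl⟩ := drops_sound h₁
  rw [hw u] at h
  obtain ⟨r₁, h₁₁, rfl⟩ := rel_pop.1 h₂
  simp only [Regs.st_w, Function.update_self] at h₁₁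
  subst h₁₁
  obtain ⟨U₁, c, U₂, hU, rfl, rfl⟩ := table_split h
  obtain ⟨l, r₂, h₁₂, h₁₃, rfl⟩ := rel_transfer (by simp) h₃
  obtain ⟨r₃, h₁₄, rfl⟩ := rel_pop.1 h₄
  simp only [Regs.update_w, Regs.st_w, Function.update_self, Function.update_idem, Regs.st_c, hc,
    List.append_nil, Regs.update_c] at h₁₂ h₁₄ h₅
  subst h₁₄
  obtain ⟨rfl, rfl⟩ := bits_split h₁₂ h₁₃
  obtain ⟨-, rfl⟩ := rel_moveAll (by simp) h₅
  simp only [Regs.update_c, Regs.st_c, Regs.st_c', Regs.update_c', hc', List.append_nil,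
    List.reverse_reverse] at h₆
  obtain ⟨l₂, r₄, h₁₅, rfl⟩ := drops_sound h₆
  obtain ⟨r₅, h₁₆, rfl⟩ := rel_pop.1 h₇
  simp only [Regs.st_w, Function.update_self] at h₁₆
  subst h₁₆
  -- The search in `u` has destroyed the table there up to the entry found. If `v = u`, the second
  -- search sees only the later entries, which still belong to the table.
  obtain ⟨V, hV, h₁₇⟩ : ∃ V ⊆ T v, Function.update R.w u (table U₂) v = table V := by
    by_cases huv : v = u
    · subst huv
      refine ⟨U₂, ?_, by simp⟩
      rw [hU]
      exact fun a ha => by simp [ha]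
    · exact ⟨T v, fun _ h => h, by rw [Function.update_of_ne huv, hw]⟩
  simp only at h₁₅
  rw [h₁₇] at h₁₅
  obtain ⟨V₁, c', V₂, rfl, rfl, rfl⟩ := table_split h₁₅
  simp only [Regs.update_w, Function.update_idem] at h₈
  obtain ⟨R₀, hR₀⟩ : ∃ R₀ : Regs tm, R₀ = { R with
    w := Function.update R.w u (table U₂)
    c := [] } := ⟨_, rfl⟩
  have hF : Rel (star (compareBit v)) (compareRegs R₀ v (sep :: table V₂) c' c).st s₈ := by
    convert h₈ using 2
    rw [compareRegs, hR₀]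
  -- `p` is the common prefix compared so far; the tests that follow force both remainders to be
  -- empty.
  obtain ⟨p, l, l', rfl, rfl, rfl⟩ := star_induction (Inv := fun s => ∃ p l l', c' = p ++ l ∧
    c = p ++ l' ∧ s = (compareRegs R₀ v (sep :: table V₂) l l').st) hF ⟨[], c', c, rfl, rfl, rfl⟩ (by
      rintro _ s' ⟨p, l, l', rfl, rfl, rfl⟩ h
      simp only [compareBit, rel_altL, List.mem_map] at h
      obtain ⟨_, ⟨β, -, rfl⟩, h⟩ := h
      simp only [rel_seq, rel_pop] at h
      obtain ⟨_, ⟨r, h₁, rfl⟩, r', h₂, rfl⟩ := h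
      cases l' with
      | nil => simp [compareRegs] at h₁
      | cons a l' =>
        simp only [compareRegs, Regs.st_c', bits, List.map_cons, List.cons.injEq, bit.injEq] at h₁
        obtain ⟨rfl, rfl⟩ := h₁
        simp only [compareRegs, Regs.update_c', Regs.st_w, Function.update_self] at h₂
        cases l with
        | nil => simp at h₂
        | cons a' l =>
          simp only [bits, List.map_cons, List.cons_append, List.cons.injEq, bit.injEq] at h₂
          obtain ⟨rfl, rfl⟩ := h₂
          exact ⟨p ++ [a'], l, l', by simp, by simp, by simp [compareRegs]⟩)
  obtain ⟨h₁₈, rfl⟩ := rel_emp.1 h₉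
  obtain ⟨r, h₁₉, -⟩ := rel_pop.1 h₁₀
  obtain rfl : l' = [] := by simpa [compareRegs] using h₁₈
  cases l with
  | cons a l => simp [compareRegs] at h₁₉
  | nil => exact ⟨b, p, by rw [hU]; simp, hV (by simp)⟩

/-- The second search takes place in the table that the first one leaves behind, which matters if `u
= v`. -/
theorem to_diff_aux {R : Regs tm} {u v : Bool} {U₁ U₂ V₁ V₂ : List (Bool × List Bool)} {b : Bool}
    {c : List Bool} (hU : R.w u = table (U₁ ++ (b, c) :: U₂))
    (hV : Function.update R.w u (table U₂) v = table (V₁ ++ (!b, c) :: V₂)) (hc : R.c = [])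
    (hc' : R.c' = []) {N : ℕ} (hUN : (R.w u).length ≤ N)
    (hVN : (table (V₁ ++ (!b, c) :: V₂) : List (Letter tm)).length ≤ N) :
    ∃ s', To (diff u v) (40 * N + 60) R.st s' := by
  have h₁ := to_drops (R := R) (w := u) (l := table U₁) (r := sgn b :: (bits c ++ sep :: table U₂))
    (by simp [hU])
  have h₂ := to_pop (s := { R with
    w := Function.update R.w u (sgn b :: (bits c ++ sep :: table U₂)) }.st) (k := Reg.w u)
    (a := sgn b) (l := bits c ++ sep :: table U₂) (by simp)
  have h₃ := to_transfer (A := bitLetters) (u := Reg.w u) (v := Reg.c) (by simp)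
    (s := { R with w := Function.update R.w u (bits c ++ sep :: table U₂) }.st) (l := bits c)
    (r := sep :: table U₂) (by simp) (bits_subset c)
  have h₄ := to_pop (s := { R with
    w := Function.update R.w u (sep :: table U₂)
    c := bits c.reverse }.st) (k := Reg.w u) (a := sep) (l := table U₂) (by simp)
  have h₅ := to_moveAll (A := bitLetters) (u := Reg.c) (v := Reg.c') (by simp)
    (s := { R with w := Function.update R.w u (table U₂), c := bits c.reverse }.st)
    (bits_subset _)
  have h₆ := to_drops (w := v) (l := table V₁) (r := sgn (!b) :: (bits c ++ sep :: table V₂))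
    (R := { R with w := Function.update R.w u (table U₂), c := [], c' := bits c })
    (by simpa using hV)
  have h₇ := to_pop (s := { R with
    w := Function.update (Function.update R.w u (table U₂)) v
      (sgn (!b) :: (bits c ++ sep :: table V₂))
    c := []
    c' := bits c }.st) (k := Reg.w v) (a := sgn (!b)) (l := bits c ++ sep :: table V₂) (by simp)
  have h₈ := to_walk (B := compareBit v) (c := 9) (fun _ l => (compareRegs { R with
    w := Function.update R.w u (table U₂), c := [] } v (sep :: table V₂) l l).st) (p := [])
    (l₁ := c) (l₂ := []) (by
      intro p β l hβ
      refine (to_altL (List.mem_map_of_mem (a := β) (l := [false, true]) (by simp))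
        ((to_pop (a := bit β) (l := bits l) (by simp [compareRegs])).seq
        (to_pop (a := bit β) (l := bits l ++ sep :: table V₂) (by simp [compareRegs])))).cast
        (by simp) (by simp [compareRegs]))
  have h₉ := (to_emp (k := Reg.c') (s := (compareRegs { R with
    w := Function.update R.w u (table U₂), c := [] } v (sep :: table V₂) [] []).st)
    (by simp [compareRegs])).seq (to_pop (k := Reg.w v) (a := sep) (l := table V₂)
      (by simp [compareRegs]))
  have h₁₀ := (h₇.cast le_rfl (by simp [compareRegs]) : To _ _ _ (compareRegs { R with
    w := Function.update R.w u (table U₂), c := [] } v (sep :: table V₂) (c ++ []) (c ++ [])).st).seq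
    (h₈.seq h₉)
  have h₁₁ := (h₅.cast le_rfl (by simp [hc']) : To _ _ _ { R with
    w := Function.update R.w u (table U₂), c := [], c' := bits c }.st).seq (h₆.seq h₁₀)
  have h₁₂ := (h₃.cast le_rfl (by simp [hc, List.map_reverse]) : To _ _ _ { R with
    w := Function.update R.w u (sep :: table U₂)
    c := bits c.reverse }.st).seq ((h₄.cast le_rfl (by simp) : To _ _ _ { R with
    w := Function.update R.w u (table U₂)
    c := bits c.reverse }.st).seq h₁₁)
  have h₁₃ := h₁.seq ((h₂.cast le_rfl (by simp) : To _ _ _ { R with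
    w := Function.update R.w u (bits c ++ sep :: table U₂) }.st).seq h₁₂)
  refine ⟨_, (to_altL (List.mem_map_of_mem (a := b) (l := [false, true]) (by simp)) h₁₃).mono ?_⟩
  rw [hU] at hUN
  simp only [table_append, table_cons, List.length_append, List.length_cons, List.length_map,
    Regs.st_c, List.length_reverse, List.length_nil] at hUN hVN ⊢
  omega

theorem to_diff {R : Regs tm} {u v : Bool} {T : Bool → List (Bool × List Bool)}
    (hw : ∀ b, R.w b = table (T b)) (hc : R.c = []) (hc' : R.c' = []) {N : ℕ}
    (hN : ∀ b, (R.w b).length ≤ N) {b : Bool} {c : List Bool} (hu : (b, c) ∈ T u)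
    (hv : (!b, c) ∈ T v) : ∃ s', To (diff u v) (40 * N + 60) R.st s' := by
  obtain ⟨U₁, U₂, hU⟩ := List.append_of_mem hu
  by_cases huv : v = u
  · subst huv
    rw [hU] at hv
    simp only [List.mem_append, List.mem_cons, Prod.mk.injEq, Bool.not_eq_eq_eq_not,
      Bool.eq_not_self, false_and, false_or] at hv
    have hN' := hN v
    rw [hw v, hU] at hN'
    -- Within one table the entry that comes first has to be the one found first; if this is the
    -- opposite entry, the two signs exchange their roles.
    rcases hv with hv | hv
    · obtain ⟨V₁, V₂, rfl⟩ := List.append_of_mem hv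
      refine to_diff_aux (U₁ := V₁) (b := !b) (c := c) (U₂ := V₂ ++ (b, c) :: U₂) (V₁ := V₂)
        (V₂ := U₂) (by rw [hw, hU]; simp) (by simp) hc hc' (hN v) ?_
      simp only [table_append, table_cons, List.length_append, List.length_cons,
        List.length_map] at hN' ⊢
      omega
    · obtain ⟨V₁, V₂, rfl⟩ := List.append_of_mem hv
      refine to_diff_aux (U₁ := U₁) (b := b) (c := c) (V₁ := V₁) (V₂ := V₂)
        (by rw [hw, hU]) (by simp) hc hc' (hN v) ?_
      simp only [table_append, table_cons, List.length_append, List.length_cons,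
        List.length_map] at hN' ⊢
      omega
  · obtain ⟨V₁, V₂, hV⟩ := List.append_of_mem hv
    have hN' := hN v
    rw [hw, hV] at hN'
    exact to_diff_aux (by rw [hw, hU]) (by rw [Function.update_of_ne huv, hw, hV]) hc hc' (hN u) hN'

end

end Prog
end SymBreak

namespace SymBreak
namespace Prog

open Letter

variable {tm : Turing.FinTM2}

/-! ### Stages of the main program -/

/-- The stacks between two parts of the main program: the rest of the input, the counters, and
two tables. -/
def stage (n : ℕ) (x : List Bool) (T : Bool → List (Bool × List Bool)) : Regs tm where
  x := bits x
  i := zeros n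
  i' := []
  j := zeros n
  j' := []
  t := []
  c := []
  c' := []
  w b := table (T b)
  ctl := []
  m _ := []

variable {n : ℕ} {x : List Bool} {T : Bool → List (Bool × List Bool)}

theorem stage_ready : Ready n (stage n x T : Regs tm) := ⟨rfl, rfl, rfl, rfl⟩

theorem stage_update {w : Bool} {E : List (Bool × List Bool)} :
    { (stage n x T : Regs tm) with
      w := Function.update (stage n x T : Regs tm).w w (table E) } =
    stage n x (Function.update T w E) := by
  ext1 <;> try rfl
  funext b
  by_cases h : b = w
  · subst h; simp [stage]
  · simp [stage, h]

/-- The words of length `n`. -/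
def allWords : ℕ → List (List Bool)
  | 0 => [[]]
  | n + 1 => (allWords n).flatMap fun l => [false :: l, true :: l]

theorem mem_allWords {n : ℕ} {l : List Bool} : l ∈ allWords n ↔ l.length = n := by
  induction n generalizing l with
  | zero => simp [allWords]
  | succ n ih =>
    simp only [allWords, List.mem_flatMap, List.mem_cons, List.not_mem_nil, or_false]
    constructor
    · rintro ⟨l, hl, rfl | rfl⟩ <;> simp [ih.1 hl]
    · cases l with
      | nil => simp
      | cons b l =>
        intro h
        exact ⟨l, ih.2 (by simpa using h), by cases b <;> simp⟩

/-- The words of the length of a given word that are different from it. -/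
def otherWords (tail : List Bool) : List (List Bool) := (allWords tail.length).filter (· ≠ tail)

theorem mem_otherWords {tail p : List Bool} :
    p ∈ otherWords tail ↔ p.length = tail.length ∧ p ≠ tail := by
  simp [otherWords, mem_allWords]

/-- Lists of negative entries whose words do not end in `tail`. -/
def IsNegative (tail : List Bool) (n : ℕ) (G : List (Bool × List Bool)) : Prop :=
  ∀ e ∈ G, ∃ v : List Bool, ∃ p ∈ otherWords tail, v.length = n ∧ e = (false, v ++ p)

/-- Rotate the words of a table. -/
def rotWords (ops : List Bool) (E : List (Bool × List Bool)) : List (Bool × List Bool) :=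
  E.map fun e => (e.1, rotates ops e.2)

/-- Each clause contains an entry of the table. -/
def Satisfies (F : List (List (Bool × List Bool))) (E : List (Bool × List Bool)) : Prop :=
  ∀ C ∈ F, ∃ q ∈ C, q ∈ E

/-- There are opposite entries in two tables. -/
def Contra (U V : List (Bool × List Bool)) : Prop := ∃ b c, (b, c) ∈ U ∧ (!b, c) ∈ V

noncomputable section

variable (tail : List Bool) (a : tm.Γ tm.k₀) (o : Option Bool → tm.Γ tm.k₁)

/-- Complete a table, rearrange its words, and check that the result satisfies the formula that
is generated by the machine. -/
def phase (w : Bool) : Program tm :=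
  guessEntries (otherWords tail) w ;; rearrange w ;; runM a tail.length ;; scanFormula tm.k₁ o w

variable {tail a o} {F : List (List (Bool × List Bool))} {c : ℕ}

theorem single_eq {R : Regs tm} (hm : R.m = fun _ => []) {l : List (Option Bool)} :
    { R with m := single tm.k₁ (l.map o) } = withOut tm.k₁ o R l := by
  ext1 <;> try rfl
  simp [single, hm, Function.comp_def]

theorem phase_sound (ho : Function.Injective o)
    (hM : Turing.TM2OutputsInTime tm (List.replicate (n + tail.length) a)
      (some ((F.flatMap clauseWord).map o)) c)
    (hF : ∀ C ∈ F, ∀ q ∈ C, q.2.length = n + tail.length) {w : Bool}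
    (hT : ∀ e ∈ T w, e.2.length = n + tail.length) {s'}
    (h : Rel (phase tail a o w) (stage n x T).st s') : ∃ G ops, IsNegative tail n G ∧
      Satisfies F (rotWords ops (G ++ T w)) ∧
      s' = (stage n x (Function.update T w (rotWords ops (G ++ T w)))).st := by
  simp only [phase, rel_seq] at h
  obtain ⟨s₁, h₁, s₂, h₂, s₃, h₃, h₄⟩ := h
  obtain ⟨G, hG, rfl⟩ := guessEntries_sound stage_ready h₁
  rw [show (stage n x T : Regs tm).w w = table (T w) from rfl, ← table_append, stage_update] at h₂
  obtain ⟨ops, rfl⟩ := rearrange_sound (E := G ++ T w) (by simp [stage]) rfl h₂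
  rw [stage_update, Function.update_idem] at h₃
  obtain rfl := runM_eq stage_ready rfl hM h₃
  rw [single_eq rfl] at h₄
  have hlen : ∀ e ∈ rotWords ops (G ++ T w), e.2.length = n + tail.length := by
    simp only [rotWords, List.mem_map, List.mem_append]
    rintro _ ⟨e, he | he, rfl⟩
    · obtain ⟨v, p, hp, hv, rfl⟩ := hG e he
      simp [hv, (mem_otherWords.1 hp).1]
    · simp [hT e he]
  obtain ⟨h₅, rfl⟩ := scanFormula_sound ho hlen (by simp [stage, rotWords]) rfl hF h₄
  refine ⟨G, ops, hG, h₅, ?_⟩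
  congr 1
  ext1 <;> try rfl
  simp [stage]

/-- A bound for the running time of a phase. -/
def phaseCost (tm : Turing.FinTM2) (tail : List Bool) (n N c : ℕ) : ℕ :=
  N * (guessCost n tail.length (otherWords tail).length + 1) +
    (n + tail.length) * (n + tail.length) * (N * (20 * (n + tail.length) + 80) + 12) +
    runCost tm n tail.length c +
    formulaCost (n + tail.length) (N * (n + tail.length + 2)) (runCost tm n tail.length c) + 10

theorem formulaCost_mono {k T T' N N' : ℕ} (hT : T ≤ T') (hN : N ≤ N') :
    formulaCost k T N ≤ formulaCost k T' N' := by
  unfold formulaCost scanCost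
  gcongr

theorem to_phase (htail : 2 ≤ tail.length)
    (hM : Turing.TM2OutputsInTime tm (List.replicate (n + tail.length) a)
      (some ((F.flatMap clauseWord).map o)) c)
    (hF : ∀ C ∈ F, ∀ q ∈ C, q.2.length = n + tail.length) {w : Bool}
    (hT : ∀ e ∈ T w, e.2.length = n + tail.length) {G : List (Bool × List Bool)} {ops : List Bool}
    (hG : IsNegative tail n G) (hops : ops.length ≤ (n + tail.length) * (n + tail.length))
    (hsat : Satisfies F (rotWords ops (G ++ T w))) {N : ℕ} (hN : (G ++ T w).length ≤ N) :
    To (phase tail a o w) (phaseCost tm tail n N c) (stage n x T).st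
      (stage n x (Function.update T w (rotWords ops (G ++ T w)))).st := by
  have hlen : ∀ e ∈ G ++ T w, e.2.length = n + tail.length := by
    simp only [List.mem_append]
    rintro e (he | he)
    · obtain ⟨v, p, hp, hv, rfl⟩ := hG e he
      simp [hv, (mem_otherWords.1 hp).1]
    · exact hT e he
  have hlen' : ∀ e ∈ rotWords ops (G ++ T w), e.2.length = n + tail.length := by
    simp only [rotWords, List.mem_map]
    rintro _ ⟨e, he, rfl⟩
    simp [hlen e he]
  have h₁ := to_guessEntries (R := (stage n x T : Regs tm)) (w := w) (T := tail.length)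
    stage_ready (L := otherWords tail) (fun p hp => (mem_otherWords.1 hp).1.le) hG
  rw [show (stage n x T : Regs tm).w w = table (T w) from rfl, ← table_append, stage_update] at h₁
  have h₂ := to_rearrange (R := (stage n x (Function.update T w (G ++ T w)) : Regs tm)) (w := w)
    hlen (by omega) (by simp [stage]) rfl ops
  rw [stage_update, Function.update_idem] at h₂
  have h₃ := to_runM (R := stage n x (Function.update T w (rotWords ops (G ++ T w))))
    stage_ready rfl hM
  have h₄ := length_output_le (R := stage n x (Function.update T w (rotWords ops (G ++ T w))))
    stage_ready rfl hM
  rw [single_eq rfl] at h₃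
  have h₅ := to_scanFormula (κ := tm.k₁) (o := o) (w := w)
    (R := stage n x (Function.update T w (rotWords ops (G ++ T w)))) hlen' (by simp [stage]) rfl hF
    (N := runCost tm n tail.length c) hsat (by simpa using h₄)
  refine (h₁.seq (h₂.seq (h₃.seq h₅))).cast ?_ ?_
  · have e₁ : G.length ≤ N := by rw [List.length_append] at hN; omega
    have e₂ : (rotWords ops (G ++ T w)).length ≤ N := by simpa [rotWords] using hN
    have e₃ := Nat.mul_le_mul_right (guessCost n tail.length (otherWords tail).length + 1) e₁
    have e₄ := Nat.mul_le_mul hops (Nat.add_le_add_right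
      (Nat.mul_le_mul_right (20 * (n + tail.length) + 80) hN) 12)
    have e₅ := formulaCost_mono (k := n + tail.length) (N := runCost tm n tail.length c)
      (Nat.mul_le_mul_right (n + tail.length + 2) e₂) le_rfl
    simp only [phaseCost]
    omega
  · congr 1
    ext1 <;> try rfl
    simp [stage]

end

end Prog
end SymBreak

namespace SymBreak
namespace Prog

open Letter

variable {tm : Turing.FinTM2} {n c : ℕ} {x : List Bool} {T : Bool → List (Bool × List Bool)}

/-! ### Malformed inputs -/

theorem drop_eq {R : Regs tm} {s'} (h : Rel (drop .x) R.st s') :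
    s' = { R with x := R.x.drop 1 }.st := by
  obtain rfl := rel_drop.1 h
  simp

theorem to_drop_x {R : Regs tm} : To (drop .x) 1 R.st { R with x := R.x.drop 1 }.st :=
  to_drop.cast le_rfl (by simp)

noncomputable section

/-- Drop as many letters of the input as the square of the value of the counters. -/
def dropSquare (tm : Turing.FinTM2) : Program tm := loop .i .i' (loop .j .j' (drop .x))

theorem dropRow_eq {R : Regs tm} (hj : R.j = zeros n) (hj' : R.j' = []) {s'}
    (h : Rel (loop .j .j' (drop .x)) R.st s') : s' = { R with x := R.x.drop n }.st :=
  loop_j_eq (fun p => { R with x := R.x.drop p }) (fun _ => hj) (fun _ => hj') (by simp)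
    (fun p _ s' h => by
      obtain rfl := drop_eq h
      simp) h

theorem to_dropRow {R : Regs tm} (hj : R.j = zeros n) (hj' : R.j' = []) :
    To (loop .j .j' (drop .x)) (loopCost n 1) R.st { R with x := R.x.drop n }.st :=
  to_loop_j (fun p => { R with x := R.x.drop p }) (fun _ => hj) (fun _ => hj') (by simp) rfl
    (fun p _ => to_drop_x.cast le_rfl (by simp))

theorem dropSquare_eq {s'} (h : Rel (dropSquare tm) (stage n x T).st s') :
    s' = (stage n (x.drop (n * n)) T).st := by
  refine loop_i_eq (fun p => stage n (x.drop (p * n)) T) (fun _ => rfl) (fun _ => rfl) (by simp)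
    (fun p _ s' h => ?_) h
  obtain rfl := dropRow_eq (n := n) (by rfl) (by rfl) h
  simp [stage, Nat.succ_mul, Nat.add_comm]

theorem to_dropSquare : To (dropSquare tm) (loopCost n (loopCost n 1)) (stage n x T).st
    (stage n (x.drop (n * n)) T).st :=
  to_loop_i (fun p => stage n (x.drop (p * n)) T) (fun _ => rfl) (fun _ => rfl) (by simp) rfl
    (fun p _ => (to_dropRow (n := n) rfl rfl).cast le_rfl (by simp [stage, Nat.succ_mul, Nat.add_comm]))

theorem dropLine_eq {s'} (h : Rel (loop .i .i' (drop .x)) (stage n x T : Regs tm).st s') :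
    s' = (stage n (x.drop n) T).st :=
  loop_i_eq (fun p => stage n (x.drop p) T) (fun _ => rfl) (fun _ => rfl) (by simp)
    (fun p _ s' h => by
      obtain rfl := drop_eq h
      simp [stage]) h

theorem to_dropLine : To (loop .i .i' (drop .x)) (loopCost n 1) (stage n x T : Regs tm).st
    (stage n (x.drop n) T).st :=
  to_loop_i (fun p => stage n (x.drop p) T) (fun _ => rfl) (fun _ => rfl) (by simp) rfl
    (fun p _ => to_drop_x.cast le_rfl (by simp [stage]))

/-- Check that the input has the wrong length. -/
def badLength (tm : Turing.FinTM2) : Program tm :=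
  dropSquare tm ;; dropSquare tm ;; loop .i .i' (drop .x) ;;
    alt (emp .x) (nonemp .x ;; drop .x ;; nonemp .x)

/-- After `n` in unary and a zero, a well-formed input has two matrices, `n` ones and a zero left.
Once all but one of these letters are dropped, exactly one letter should remain. Dropping from an
empty stack does nothing, so inputs that are too short end with no letter. -/
theorem badLength_sound {s'} (h : Rel (badLength tm) (stage n x T).st s') :
    x.length ≠ n * n + n * n + n + 1 := by
  simp only [badLength, rel_seq, rel_alt, rel_emp, rel_nonemp, rel_drop] at h
  obtain ⟨s₁, h₁, s₂, h₂, s₃, h₃, h₄⟩ := h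
  obtain rfl := dropSquare_eq h₁
  obtain rfl := dropSquare_eq h₂
  obtain rfl := dropLine_eq h₃
  intro hx
  rcases h₄ with ⟨h₄, -⟩ | ⟨_, ⟨-, rfl⟩, _, rfl, h₄, -⟩
  · have := congrArg List.length h₄
    simp [stage] at this
    omega
  · apply h₄
    rw [← List.length_eq_zero_iff]
    simp [stage]
    omega

/-- A bound for the running time of the checks for malformed inputs. -/
def badCost (n : ℕ) : ℕ := 2 * loopCost n (loopCost n 1) + loopCost n 1 + 20 + 10 * n

theorem to_badLength (hx : x.length ≠ n * n + n * n + n + 1) :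
    ∃ s', To (badLength tm) (badCost n) (stage n x T).st s' := by
  have h₁ := to_dropSquare (tm := tm) (n := n) (x := x) (T := T)
  have h₂ := to_dropSquare (tm := tm) (n := n) (x := x.drop (n * n)) (T := T)
  have h₃ := to_dropLine (tm := tm) (n := n) (x := (x.drop (n * n)).drop (n * n)) (T := T)
  have hlen : (((x.drop (n * n)).drop (n * n)).drop n).length =
      x.length - (n * n + n * n + n) := by
    simp only [List.length_drop]; omega
  generalize ((x.drop (n * n)).drop (n * n)).drop n = y at h₃ hlen
  rcases y with _ | ⟨a, _ | ⟨b, y⟩⟩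
  · exact ⟨_, (h₁.seq (h₂.seq (h₃.seq (to_emp (by simp [stage])).altl))).mono
      (by simp [badCost]; omega)⟩
  · simp at hlen; omega
  · exact ⟨_, (h₁.seq (h₂.seq (h₃.seq ((to_nonemp (by simp [stage])).seq (to_drop.seq
      (to_nonemp (by simp [stage])))).altr))).mono (by simp [badCost]; omega)⟩

/-- Check that the input has something else than the size of the second graph in the middle. -/
def badMiddle (tm : Turing.FinTM2) : Program tm :=
  dropSquare tm ;;
    alt (star (pop .i (bit false) ;; drop .x) ;; pop .i (bit false) ;; pop .x (bit false))
      (loop .i .i' (drop .x) ;; pop .x (bit true))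

theorem badMiddle_sound {s'} (h : Rel (badMiddle tm) (stage n x T).st s') (y : List Bool) :
    x.drop (n * n) ≠ List.replicate n true ++ false :: y := by
  simp only [badMiddle, rel_seq, rel_alt] at h
  obtain ⟨s₁, h₁, h₂⟩ := h
  obtain rfl := dropSquare_eq h₁
  intro hx
  rw [hx] at h₂
  rcases h₂ with ⟨s₂, h₂, h₃⟩ | ⟨s₂, h₂, h₃⟩
  -- The counter loses a zero with each dropped letter, so the letter tested afterwards is one of
  -- the first `n`, where the input has ones.
  · obtain ⟨p, hp, rfl⟩ := star_induction (Inv := fun s => ∃ p ≤ n, s =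
      { (stage n (List.replicate (n - p) true ++ false :: y) T : Regs tm) with
        i := zeros (n - p) }.st) h₂ ⟨0, by omega, by simp [stage]⟩ (by
        rintro _ s' ⟨p, hp, rfl⟩ h
        simp only [rel_seq, rel_pop] at h
        obtain ⟨_, ⟨r, h₁, rfl⟩, h⟩ := h
        obtain rfl := rel_drop.1 h
        simp only [Regs.st_i] at h₁
        rcases hd : n - p with _ | d
        · simp [hd] at h₁
        · rw [hd, zeros, List.replicate_succ, List.cons.injEq] at h₁
          obtain ⟨-, rfl⟩ := h₁
          refine ⟨p + 1, by omega, ?_⟩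
          rw [show n - (p + 1) = d by omega]
          simp [stage, List.replicate_succ])
    obtain ⟨_, h₄, h₅⟩ := h₃
    obtain ⟨r, h₆, rfl⟩ := rel_pop.1 h₄
    obtain ⟨r', h₅, -⟩ := rel_pop.1 h₅
    simp only [Regs.st_i] at h₆
    rcases hd : n - p with _ | d
    · simp [hd] at h₆
    · simp [hd, stage, List.replicate_succ] at h₅
  · obtain rfl := dropLine_eq h₂
    obtain ⟨r, h₄, -⟩ := rel_pop.1 h₃
    simp [stage] at h₄

/-- Either one of the `n` letters after the first matrix is a zero, or all are ones, and then the
next letter must be a one. -/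
theorem to_badMiddle (hlen : n < (x.drop (n * n)).length)
    (hx : ∀ y, x.drop (n * n) ≠ List.replicate n true ++ false :: y) :
    ∃ s', To (badMiddle tm) (badCost n) (stage n x T).st s' := by
  have h₁ := to_dropSquare (tm := tm) (n := n) (x := x) (T := T)
  generalize x.drop (n * n) = z at *
  by_cases hz : ∀ b ∈ z.take n, b = true
  · have hz' : z.take n = List.replicate n true :=
      List.eq_replicate_iff.2 ⟨by simp; omega, hz⟩
    have hz'' := List.take_append_drop n z
    rw [hz', List.drop_eq_getElem_cons hlen] at hz''
    have hb : z[n] = true := by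
      by_contra hb
      exact hx _ (by rw [← Bool.eq_false_of_not_eq_true hb]; exact hz''.symm)
    have h₂ := to_dropLine (tm := tm) (n := n) (x := z) (T := T)
    have h₃ := to_pop (s := (stage n (z.drop n) T : Regs tm).st) (k := .x) (a := bit true)
      (l := bits (z.drop (n + 1))) (by
        rw [List.drop_eq_getElem_cons hlen, hb]; rfl)
    exact ⟨_, (h₁.seq (h₂.seq h₃).altr).mono (by simp [badCost]; omega)⟩
  · push Not at hz
    obtain ⟨b, hb, hb'⟩ := hz
    obtain rfl := Bool.eq_false_of_not_eq_true hb'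
    obtain ⟨l₁, l₂, hl⟩ := List.append_of_mem hb
    have hz' := List.take_append_drop n z
    have hn := congrArg List.length hl
    simp only [List.length_take, List.length_append, List.length_cons] at hn
    obtain ⟨d, hd⟩ : ∃ d, n = l₁.length + d + 1 := ⟨n - l₁.length - 1, by omega⟩
    rw [hl] at hz'
    have h₂ := to_walk (B := (pop .i (bit false) ;; drop .x : Program tm)) (c := 5)
      (fun _ l => { (stage n (l ++ (false :: l₂ ++ z.drop n)) T : Regs tm) with
        i := zeros (l.length + d + 1) }.st) (p := []) (l₁ := l₁) (l₂ := []) (by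
        intro p a l _
        exact ((to_pop (a := bit false) (l := zeros (l.length + d + 1)) (by
          simp [List.replicate_succ, Nat.add_right_comm _ 1])).seq to_drop).cast le_rfl
          (by simp [stage]))
    have h₃ := to_pop (k := Reg.i) (a := bit false) (l := zeros d)
      (s := { (stage n ([] ++ (false :: l₂ ++ z.drop n)) T : Regs tm) with
        i := zeros (([] : List Bool).length + d + 1) }.st) (by simp [List.replicate_succ])
    have h₄ := to_pop (k := Reg.x) (a := bit false) (l := bits (l₂ ++ z.drop n))
      (s := { (stage n ([] ++ (false :: l₂ ++ z.drop n)) T : Regs tm) with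
        i := zeros d }.st) (by simp [stage])
    rw [Regs.update_i] at h₃
    have e : { (stage n ((l₁ ++ []) ++ (false :: l₂ ++ z.drop n)) T : Regs tm) with
        i := zeros ((l₁ ++ []).length + d + 1) } = stage n z T := by
      rw [List.append_nil, ← hd, ← List.append_assoc, hz']
      rfl
    rw [e] at h₂
    exact ⟨_, (h₁.seq (h₂.seq (h₃.seq h₄)).altl).mono (by simp only [badCost]; omega)⟩

end

end Prog
end SymBreak

/-! ### Assembling the verifier -/

namespace SymBreak
namespace Prog

open Letter

variable {tm : Turing.FinTM2} {n c : ℕ} {x : List Bool}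

/-! ### The main program -/

noncomputable section

/-- Count the ones at the beginning of the input. -/
def countOnes (tm : Turing.FinTM2) : Program tm :=
  star (pop .x (bit true) ;; push .i (bit false) ;; push .j (bit false))

/-- Counting may stop early, leaving a one on top of the input; both continuations in `mainProg`
then block. -/
theorem countOnes_sound {T : Bool → List (Bool × List Bool)} {y : List Bool} {s'}
    (h : Rel (countOnes tm) (stage 0 (List.replicate n true ++ false :: y) T).st s') :
    ∃ p ≤ n, s' = (stage p (List.replicate (n - p) true ++ false :: y) T).st := by
  refine star_induction (Inv := fun s' => ∃ p ≤ n, s' =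
    (stage p (List.replicate (n - p) true ++ false :: y) T).st) h ⟨0, by omega, rfl⟩ ?_
  rintro _ s' ⟨p, hp, rfl⟩ h
  simp only [rel_seq, rel_pop, rel_push] at h
  obtain ⟨_, ⟨r, h₁, rfl⟩, _, rfl, rfl⟩ := h
  rcases hd : n - p with _ | d
  · simp [hd, stage] at h₁
  · rw [hd, List.replicate_succ, Regs.st_x] at h₁
    obtain rfl : bits (List.replicate d true ++ false :: y) = r := (List.cons.inj h₁).2
    refine ⟨p + 1, by omega, ?_⟩
    rw [show n - (p + 1) = d by omega]
    simp [stage, List.replicate_succ]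

theorem to_countOnes {T : Bool → List (Bool × List Bool)} {r : List Bool} :
    To (countOnes tm) (n * 8 + 1) (stage 0 (List.replicate n true ++ r) T).st
      (stage n r T).st := by
  have h := to_star (P := (pop .x (bit true) ;; push .i (bit false) ;; push .j (bit false) :
      Program tm)) (c := 7) n (fun p => (stage p (List.replicate (n - p) true ++ r) T).st) (by
    intro p hp
    obtain ⟨d, hd⟩ : ∃ d, n - p = d + 1 := ⟨n - p - 1, by omega⟩
    rw [show n - (p + 1) = d by omega, hd]
    exact ((to_pop (a := bit true) (l := bits (List.replicate d true ++ r))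
      (by simp [stage, List.replicate_succ])).seq (to_push.seq to_push)).cast le_rfl
      (by simp [stage, List.replicate_succ]))
  simpa [countOnes] using h

variable (tail : List Bool) (a : tm.Γ tm.k₀) (o : Option Bool → tm.Γ tm.k₁)

/-- Read two adjacency matrices, and check that they are malformed or that the graphs are not
isomorphic. -/
def compareGraphs : Program tm :=
  readMatrix tail false ;; loop .i .i' (pop .x (bit true)) ;; pop .x (bit false) ;;
    readMatrix tail true ;;
    alt (diff false false) (alt (diff true true)
      (phase tail a o false ;; phase tail a o true ;; diff false true))

/-- Check that the input is not a pair of isomorphic graphs. -/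
def mainProg : Program tm :=
  countOnes tm ;; alt (emp .x) (pop .x (bit false) ;;
    alt (alt (badLength tm) (badMiddle tm)) (compareGraphs tail a o))

variable {tail a o} {F : List (List (Bool × List Bool))}

theorem popOnes_eq {T : Bool → List (Bool × List Bool)} {r : List Bool} {s'}
    (h : Rel (loop .i .i' (pop .x (bit true)))
      (stage n (List.replicate n true ++ r) T : Regs tm).st s') : s' = (stage n r T).st := by
  have := loop_i_eq (fun p => stage n (List.replicate (n - p) true ++ r) T) (fun _ => rfl)
    (fun _ => rfl) (by simp) (fun p hp s' h => by
      obtain ⟨l, h₁, rfl⟩ := rel_pop.1 h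
      obtain ⟨d, hd⟩ : ∃ d, n - p = d + 1 := ⟨n - p - 1, by omega⟩
      rw [show n - (p + 1) = d by omega]
      simp only [hd, stage, Regs.st_x, List.replicate_succ, bits, List.cons_append, List.map_cons,
        List.cons.injEq, true_and] at h₁
      simp [stage, ← h₁]) h
  simpa using this

theorem to_popOnes {T : Bool → List (Bool × List Bool)} {r : List Bool} :
    To (loop .i .i' (pop .x (bit true))) (loopCost n 3)
      (stage n (List.replicate n true ++ r) T : Regs tm).st (stage n r T).st :=
  to_loop_i (fun p => stage n (List.replicate (n - p) true ++ r) T) (fun _ => rfl)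
    (fun _ => rfl) (by simp) (by simp) (fun p hp => by
      obtain ⟨d, hd⟩ : ∃ d, n - p = d + 1 := ⟨n - p - 1, by omega⟩
      rw [show n - (p + 1) = d by omega]
      exact (to_pop (a := bit true) (l := bits (List.replicate d true ++ r))
        (by simp [hd, stage, List.replicate_succ])).cast le_rfl (by simp [stage]))

theorem readMatrix_stage_eq {T : Bool → List (Bool × List Bool)} {A : ℕ → ℕ → Bool}
    {r : List Bool} {w : Bool} {s'}
    (h : Rel (readMatrix tail w) (stage n (matBits A n 0 ++ r) T : Regs tm).st s') :
    s' = (stage n r (Function.update T w (matEntries tail A n n ++ T w))).st := by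
  rw [readMatrix_eq (r := bits r) (A := A) stage_ready (by simp [stage]) h, ← stage_update]
  simp [matRegs, stage]

theorem to_readMatrix_stage {T : Bool → List (Bool × List Bool)} {A : ℕ → ℕ → Bool}
    {r : List Bool} {w : Bool} :
    To (readMatrix tail w) (loopCost n (loopCost n (70 * n + 4 * tail.length + 70)))
      (stage n (matBits A n 0 ++ r) T : Regs tm).st
      (stage n r (Function.update T w (matEntries tail A n n ++ T w))).st := by
  refine (to_readMatrix (r := bits r) (A := A) stage_ready (by simp [stage])).cast le_rfl ?_
  rw [← stage_update]
  simp [matRegs, stage]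

theorem diff_stage {T : Bool → List (Bool × List Bool)} {u v : Bool} {s'}
    (h : Rel (diff u v) (stage n x T : Regs tm).st s') : Contra (T u) (T v) :=
  diff_sound (fun _ => rfl) rfl rfl h

theorem length_matEntries_words {A : ℕ → ℕ → Bool} : ∀ e ∈ matEntries tail A n n,
    e.2.length = n + tail.length := by
  simp only [mem_matEntries, bitEntries, List.mem_cons, List.not_mem_nil, or_false]
  rintro e ⟨i, -, j, -, rfl | rfl⟩ <;> simp [pairVec]

theorem length_matEntries {A : ℕ → ℕ → Bool} :
    (matEntries tail A n n).length = n * (n * 2) := by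
  have h₁ : ∀ i m, (rowEntries tail A n i m).length = m * 2 := by
    intro i m
    induction m with
    | zero => rfl
    | succ m ih => simp [rowEntries, bitEntries, ih]; omega
  have h₂ : ∀ m, (matEntries tail A n m).length = m * (n * 2) := by
    intro m
    induction m with
    | zero => simp [matEntries]
    | succ m ih => simp [matEntries, ih, h₁, Nat.succ_mul]; omega
  exact h₂ n

/-- What the main program checks for two matrices. -/
def Differ (tail : List Bool) (F : List (List (Bool × List Bool))) (n : ℕ)
    (E E' : List (Bool × List Bool)) : Prop :=
  Contra E E ∨ Contra E' E' ∨ ∃ G ops G' ops', IsNegative tail n G ∧ IsNegative tail n G' ∧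
    Satisfies F (rotWords ops (G ++ E)) ∧ Satisfies F (rotWords ops' (G' ++ E')) ∧
    Contra (rotWords ops (G ++ E)) (rotWords ops' (G' ++ E'))

theorem compareGraphs_sound (ho : Function.Injective o)
    (hM : Turing.TM2OutputsInTime tm (List.replicate (n + tail.length) a)
      (some ((F.flatMap clauseWord).map o)) c)
    (hF : ∀ C ∈ F, ∀ q ∈ C, q.2.length = n + tail.length) {A B : ℕ → ℕ → Bool} {s'}
    (h : Rel (compareGraphs tail a o) (stage n (matBits A n 0 ++ (List.replicate n true ++
      false :: matBits B n 0)) fun _ => []).st s') :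
    Differ tail F n (matEntries tail A n n) (matEntries tail B n n) := by
  simp only [compareGraphs, rel_seq, rel_alt] at h
  obtain ⟨s₁, h₁, s₂, h₂, s₃, h₃, s₄, h₄, h₅⟩ := h
  obtain rfl := readMatrix_stage_eq h₁
  obtain rfl := popOnes_eq h₂
  obtain ⟨l, h₆, rfl⟩ := rel_pop.1 h₃
  obtain rfl : bits (matBits B n 0) = l := (List.cons.inj h₆).2
  rw [Regs.update_x] at h₄
  obtain rfl := readMatrix_stage_eq (A := B) (r := [])
    (T := Function.update (fun _ => []) false (matEntries tail A n n ++ [])) (n := n)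
    (by simpa [stage] using h₄)
  rcases h₅ with h₅ | h₅ | ⟨s₅, h₅, s₆, h₇, h₈⟩
  · exact .inl (by simpa using diff_stage h₅)
  · exact .inr (.inl (by simpa using diff_stage h₅))
  · obtain ⟨G, ops, hG, hS, rfl⟩ := phase_sound ho hM hF
      (by simpa using length_matEntries_words) h₅
    obtain ⟨G', ops', hG', hS', rfl⟩ := phase_sound ho hM hF
      (by simpa using length_matEntries_words) h₇
    have := diff_stage h₈
    simp at hS hS' this
    exact .inr (.inr ⟨G, ops, G', ops', hG, hG', hS, hS', this⟩)

/-- The input is well formed, so the branches for malformed inputs cannot succeed, and only the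
comparison of the two tables remains. -/
theorem mainProg_sound (ho : Function.Injective o)
    (hM : Turing.TM2OutputsInTime tm (List.replicate (n + tail.length) a)
      (some ((F.flatMap clauseWord).map o)) c)
    (hF : ∀ C ∈ F, ∀ q ∈ C, q.2.length = n + tail.length) {A B : ℕ → ℕ → Bool} {s'}
    (hA : (matBits A n 0).length = n * n) (hB : (matBits B n 0).length = n * n)
    (h : Rel (mainProg tail a o) (stage 0 (List.replicate n true ++ false ::
      (matBits A n 0 ++ (List.replicate n true ++ false :: matBits B n 0))) fun _ => []).st s') :
    Differ tail F n (matEntries tail A n n) (matEntries tail B n n) := by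
  simp only [mainProg, rel_seq, rel_alt] at h
  obtain ⟨s₁, h₁, h⟩ := h
  obtain ⟨p, hp, rfl⟩ := countOnes_sound h₁
  rcases h with h | ⟨s₂, h₂, h⟩
  · simp [rel_emp, stage] at h
  obtain ⟨l, h₃, rfl⟩ := rel_pop.1 h₂
  obtain rfl : p = n := by
    by_contra hpn
    obtain ⟨d, hd⟩ : ∃ d, n - p = d + 1 := ⟨n - p - 1, by omega⟩
    simp [hd, stage, List.replicate_succ] at h₃
  rw [Nat.sub_self, List.replicate_zero, List.nil_append] at h₃
  obtain rfl := (List.cons.inj h₃).2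
  have e : Function.update (stage p (List.replicate (p - p) true ++ false ::
      (matBits A p 0 ++ (List.replicate p true ++ false :: matBits B p 0))) fun _ => []).st Reg.x
      ((matBits A p 0 ++ (List.replicate p true ++ false :: matBits B p 0)).map bit) =
      (stage p (matBits A p 0 ++ (List.replicate p true ++ false :: matBits B p 0))
        fun _ => [] : Regs tm).st := by
    rw [Regs.update_x]; rfl
  rw [e] at h
  rcases h with (h | h) | h
  · refine absurd ?_ (badLength_sound h)
    simp [hA, hB]; omega
  · exact absurd (List.drop_left' hA) (badMiddle_sound h _)
  · exact compareGraphs_sound ho hM hF h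

/-- A bound for the running time of the main program. -/
def mainCost (tm : Turing.FinTM2) (tail : List Bool) (n N c : ℕ) : ℕ :=
  n * 8 + badCost n + 2 * loopCost n (loopCost n (70 * n + 4 * tail.length + 70)) + loopCost n 3 +
    2 * phaseCost tm tail n N c + 40 * (N * (n + tail.length + 2)) + 100

/-- Any words of length `n * n` may stand for the matrices here. Thus an input that starts correctly
is malformed only through its length or through the second unary number, and the latter needs
testing only if the length is right. -/
theorem to_mainProg_malformed {r : List Bool} (hr : r.head? ≠ some true)
    (h : ∀ A B : List Bool, A.length = n * n → B.length = n * n →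
      r ≠ false :: (A ++ (List.replicate n true ++ false :: B))) {N : ℕ} :
    ∃ s', To (mainProg tail a o) (mainCost tm tail n N c)
      (stage 0 (List.replicate n true ++ r) fun _ => []).st s' := by
  have h₁ := to_countOnes (tm := tm) (n := n) (T := fun _ => []) (r := r)
  rcases r with _ | ⟨_ | _, y⟩
  · exact ⟨_, (h₁.seq (to_emp (by simp [stage])).altl).mono (by simp [mainCost]; omega)⟩
  · have h₂ := to_pop (s := (stage n (false :: y) (fun _ => []) : Regs tm).st) (k := .x)
      (a := bit false) (l := bits y) (by simp [stage])
    have e : Function.update (stage n (false :: y) (fun _ => []) : Regs tm).st .x (bits y) =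
        (stage n y fun _ => []).st := by rw [Regs.update_x]; rfl
    rw [e] at h₂
    by_cases hy : y.length = n * n + n * n + n + 1
    · obtain ⟨s', h₃⟩ := to_badMiddle (tm := tm) (n := n) (x := y) (T := fun _ => [])
        (by simp [hy]; omega) (fun y' hy' => by
          have hlen := congrArg List.length hy'
          simp at hlen
          refine h (y.take (n * n)) y' (by simp; omega) (by omega) ?_
          rw [← hy', List.take_append_drop])
      exact ⟨s', (h₁.seq (h₂.seq h₃.altr.altl).altr).mono (by simp only [mainCost]; omega)⟩
    · obtain ⟨s', h₃⟩ := to_badLength (tm := tm) (n := n) (x := y) (T := fun _ => []) hy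
      exact ⟨s', (h₁.seq (h₂.seq h₃.altl.altl).altr).mono (by simp only [mainCost]; omega)⟩
  · simp at hr

theorem to_mainProg (htail : 2 ≤ tail.length)
    (hM : Turing.TM2OutputsInTime tm (List.replicate (n + tail.length) a)
      (some ((F.flatMap clauseWord).map o)) c)
    (hF : ∀ C ∈ F, ∀ q ∈ C, q.2.length = n + tail.length) {A B : ℕ → ℕ → Bool}
    {N : ℕ} (h : Contra (matEntries tail A n n) (matEntries tail A n n) ∨
      Contra (matEntries tail B n n) (matEntries tail B n n) ∨
      ∃ G ops G' ops', IsNegative tail n G ∧ IsNegative tail n G' ∧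
      ops.length ≤ (n + tail.length) * (n + tail.length) ∧
      ops'.length ≤ (n + tail.length) * (n + tail.length) ∧
      (G ++ matEntries tail A n n).length ≤ N ∧ (G' ++ matEntries tail B n n).length ≤ N ∧
      Satisfies F (rotWords ops (G ++ matEntries tail A n n)) ∧
      Satisfies F (rotWords ops' (G' ++ matEntries tail B n n)) ∧
      Contra (rotWords ops (G ++ matEntries tail A n n))
        (rotWords ops' (G' ++ matEntries tail B n n))) (hN : n * (n * 2) ≤ N) :
    ∃ s', To (mainProg tail a o) (mainCost tm tail n N c) (stage 0 (List.replicate n true ++ false ::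
      (matBits A n 0 ++ (List.replicate n true ++ false :: matBits B n 0))) fun _ => []).st s' := by
  have h₁ := to_countOnes (tm := tm) (n := n) (T := fun _ => []) (r := false ::
      (matBits A n 0 ++ (List.replicate n true ++ false :: matBits B n 0)))
  have h₂ := (to_pop (s := (stage n (false ::
      (matBits A n 0 ++ (List.replicate n true ++ false :: matBits B n 0))) (fun _ => []) :
      Regs tm).st) (k := .x) (a := bit false)
      (l := bits (matBits A n 0 ++ (List.replicate n true ++ false :: matBits B n 0)))
      (by simp [stage])).cast le_rfl (s'' := (stage n (matBits A n 0 ++ (List.replicate n true ++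
        false :: matBits B n 0)) fun _ => []).st) (by rw [Regs.update_x]; rfl)
  have h₃ := to_readMatrix_stage (tm := tm) (tail := tail) (n := n) (A := A) (w := false)
    (r := List.replicate n true ++ false :: matBits B n 0) (T := fun _ => [])
  have h₄ := to_popOnes (tm := tm) (n := n) (r := false :: matBits B n 0)
    (T := Function.update (fun _ => []) false (matEntries tail A n n ++ []))
  have h₅ := (to_pop (s := (stage n (false :: matBits B n 0)
      (Function.update (fun _ => []) false (matEntries tail A n n ++ [])) :
      Regs tm).st) (k := .x) (a := bit false) (l := bits (matBits B n 0))
      (by simp [stage])).cast le_rfl (s'' := (stage n (matBits B n 0 ++ [])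
      (Function.update (fun _ => []) false (matEntries tail A n n ++ []))).st)
      (by simp only [Regs.update_x, List.append_nil]; rfl)
  have h₆ := to_readMatrix_stage (tm := tm) (tail := tail) (n := n) (A := B) (w := true)
    (r := []) (T := Function.update (fun _ => []) false (matEntries tail A n n ++ []))
  obtain ⟨T, hT⟩ : ∃ T, Function.update (Function.update (fun _ : Bool => []) false
    (matEntries tail A n n ++ [])) true (matEntries tail B n n ++ Function.update
      (fun _ => []) false (matEntries tail A n n ++ []) true) = T := ⟨_, rfl⟩
  have hTA : T false = matEntries tail A n n := by rw [← hT]; simp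
  have hTB : T true = matEntries tail B n n := by rw [← hT]; simp
  rw [hT] at h₆
  have hlen : ∀ b, ((stage n [] T : Regs tm).w b).length ≤ N * (n + tail.length + 2) := by
    rintro (_ | _)
    · change (table (T false)).length ≤ _
      rw [hTA, length_table length_matEntries_words, length_matEntries]
      exact Nat.mul_le_mul_right _ hN
    · change (table (T true)).length ≤ _
      rw [hTB, length_table length_matEntries_words, length_matEntries]
      exact Nat.mul_le_mul_right _ hN
  suffices ∃ s', To (alt (diff false false) (alt (diff true true)
      (phase tail a o false ;; phase tail a o true ;; diff false true)))
      (2 * phaseCost tm tail n N c + 40 * (N * (n + tail.length + 2)) + 66)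
      (stage n [] T).st s' by
    obtain ⟨s', h₇⟩ := this
    exact ⟨s', (h₁.seq (h₂.seq (h₃.seq (h₄.seq (h₅.seq (h₆.seq h₇)))).altr).altr).mono
      (by simp only [mainCost]; omega)⟩
  rcases h with ⟨b, v, hb, hv⟩ | ⟨b, v, hb, hv⟩ | ⟨G, ops, G', ops', hG, hG', hops, hops', hGN, hGN',
    hS, hS', b, v, hb, hv⟩
  · obtain ⟨s', h₇⟩ := to_diff (R := stage n [] T) (u := false) (v := false) (fun _ => rfl) rfl rfl
      hlen (by rw [hTA]; exact hb) (by rw [hTA]; exact hv)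
    exact ⟨s', h₇.altl.mono (by omega)⟩
  · obtain ⟨s', h₇⟩ := to_diff (R := stage n [] T) (u := true) (v := true) (fun _ => rfl) rfl rfl
      hlen (by rw [hTB]; exact hb) (by rw [hTB]; exact hv)
    exact ⟨s', h₇.altl.altr.mono (by omega)⟩
  · rw [← hTA] at hGN hS hb
    rw [← hTB] at hGN' hS' hv
    have hlA : ∀ e ∈ T false, e.2.length = n + tail.length := by
      rw [hTA]; exact length_matEntries_words
    have hlB : ∀ e ∈ T true, e.2.length = n + tail.length := by
      rw [hTB]; exact length_matEntries_words
    have h₇ := to_phase (x := []) (w := false) htail hM hF hlA hG hops hS hGN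
    have h₈ := to_phase (x := []) (w := true)
      (T := Function.update T false (rotWords ops (G ++ T false))) htail hM hF
      (by simpa using hlB) hG' hops' (by simpa using hS') (by simpa using hGN')
    obtain ⟨T', hT'⟩ : ∃ T', Function.update (Function.update T false
      (rotWords ops (G ++ T false))) true (rotWords ops' (G' ++ Function.update T false
      (rotWords ops (G ++ T false)) true)) = T' := ⟨_, rfl⟩
    have hTA' : T' false = rotWords ops (G ++ T false) := by rw [← hT']; simp
    have hTB' : T' true = rotWords ops' (G' ++ T true) := by rw [← hT']; simp
    rw [hT'] at h₈
    have hrot : ∀ (G E : List (Bool × List Bool)) (ops : List Bool), IsNegative tail n G →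
        (∀ e ∈ E, e.2.length = n + tail.length) → (G ++ E).length ≤ N →
        (table (rotWords ops (G ++ E)) : List (Letter tm)).length ≤ N * (n + tail.length + 2) := by
      intro G E ops hG hE hN
      rw [length_table (k := n + tail.length)]
      · exact Nat.mul_le_mul_right _ (by simpa [rotWords] using hN)
      · simp only [rotWords, List.mem_map, List.mem_append]
        rintro _ ⟨e, he | he, rfl⟩
        · obtain ⟨v, p, hp, hv, rfl⟩ := hG e he
          simp [hv, (mem_otherWords.1 hp).1]
        · simp [hE e he]
    obtain ⟨s', h₉⟩ := to_diff (R := stage n [] T') (u := false) (v := true) (fun _ => rfl) rfl rfl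
      (N := N * (n + tail.length + 2)) (by
        rintro (_ | _)
        · change (table (T' false)).length ≤ _
          rw [hTA']; exact hrot _ _ _ hG hlA hGN
        · change (table (T' true)).length ≤ _
          rw [hTB']; exact hrot _ _ _ hG' hlB hGN')
      (by rw [hTA']; exact hb) (by rw [hTB']; exact hv)
    exact ⟨s', (h₇.seq (h₈.seq h₉)).altr.altr.mono (by omega)⟩

end

end Prog
end SymBreak

namespace SymBreak

/-! ### Graphs as hypergraphs -/

section Twins

variable {X : Type} [DecidableEq X]

/-- A permutation maps a property of sets, given as predicates, to another one. -/
def MapsSets (f : Equiv.Perm X) (H H' : (X → Prop) → Prop) : Prop :=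
  ∀ S : X → Prop, H S ↔ H' fun x => S (f.symm x)

/-- If `p` lies in all sets of both families, then so does `f p` in all sets of `H'`, being the
image of `p`; likewise if `p` lies in none. Thus `p` and `f p` are indistinguishable for `H'`, and
following `f` by their transposition still matches the families while fixing `p`. -/
theorem mapsSets_swap {H H' : (X → Prop) → Prop} {f : Equiv.Perm X} (h : MapsSets f H H') {p : X}
    (hp : (∀ S, H S → S p) ∧ (∀ S, H' S → S p) ∨ (∀ S, H S → ¬ S p) ∧ ∀ S, H' S → ¬ S p) :
    MapsSets (Equiv.swap (f p) p * f) H H' := by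
  have key : ∀ S, H S → (S (f.symm p) ↔ S p) := by
    intro S hS
    rcases hp with ⟨h₁, h₂⟩ | ⟨h₁, h₂⟩
    · exact iff_of_true (h₂ _ ((h S).1 hS)) (h₁ S hS)
    · exact iff_of_false (h₂ _ ((h S).1 hS)) (h₁ S hS)
  have key' : ∀ S, H S → ∀ x, S (f.symm (Equiv.swap (f p) p x)) ↔ S (f.symm x) := by
    intro S hS x
    rcases eq_or_ne x p with rfl | h₁
    · rw [Equiv.swap_apply_right, Equiv.symm_apply_apply, key S hS]
    · rcases eq_or_ne x (f p) with rfl | h₂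
      · rw [Equiv.swap_apply_left, Equiv.symm_apply_apply, key S hS]
      · rw [Equiv.swap_apply_of_ne_of_ne h₂ h₁]
  have hsymm : ∀ x, (Equiv.swap (f p) p * f).symm x = f.symm (Equiv.swap (f p) p x) := by
    intro x; rfl
  intro S
  simp only [hsymm]
  constructor
  · intro hS
    have : (fun x => S (f.symm (Equiv.swap (f p) p x))) = fun x => S (f.symm x) :=
      funext fun x => propext (key' S hS x)
    rw [this]
    exact (h S).1 hS
  · intro hS
    have h₁ : H fun x => S (f.symm (Equiv.swap (f p) p (f x))) := by
      rw [h]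
      simpa using hS
    have h₂ := key' _ h₁
    simp only [Equiv.apply_symm_apply, Equiv.swap_apply_self] at h₂
    have : (fun x => S (f.symm (Equiv.swap (f p) p (f x)))) = S := by
      funext x
      rw [← h₂ (f x), Equiv.symm_apply_apply]
    rwa [this] at h₁

/-- The points are treated one at a time. A point `q` fixed earlier stays fixed, since it is neither
the new point `p` nor, by injectivity, its image. -/
theorem exists_mapsSets_fixing {H H' : (X → Prop) → Prop} (P : Finset X)
    (hP : ∀ p ∈ P, (∀ S, H S → S p) ∧ (∀ S, H' S → S p) ∨ (∀ S, H S → ¬ S p) ∧ ∀ S, H' S → ¬ S p)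
    {f : Equiv.Perm X} (h : MapsSets f H H') : ∃ f, MapsSets f H H' ∧ ∀ p ∈ P, f p = p := by
  induction P using Finset.induction_on with
  | empty => exact ⟨f, h, by simp⟩
  | insert p P hpP ih =>
    obtain ⟨f, hf, hfix⟩ := ih fun q hq => hP q (Finset.mem_insert_of_mem hq)
    refine ⟨_, mapsSets_swap hf (hP p (Finset.mem_insert_self p P)), ?_⟩
    intro q hq
    rcases Finset.mem_insert.1 hq with rfl | hq
    · simp
    · have hqp : q ≠ p := fun h => hpP (h ▸ hq)
      rw [Equiv.Perm.mul_apply, hfix q hq, Equiv.swap_apply_of_ne_of_ne _ hqp]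
      intro h
      exact hqp (f.injective (by rw [hfix q hq, h]))

end Twins

/-- The sets that consist of the vertices of an edge of a graph on the first `n` points, and of all
points from `n + 3` on. -/
def IsEdgeSet {n k : ℕ} (Γ : SimpleGraph (Fin n)) (S : Fin k → Prop) : Prop :=
  ∃ u v, Γ.Adj u v ∧ ∀ x : Fin k, S x ↔ x.val = u ∨ x.val = v ∨ n + 3 ≤ x.val

theorem IsEdgeSet.iff_of_le {n k : ℕ} {Γ : SimpleGraph (Fin n)} {S : Fin k → Prop}
    (h : IsEdgeSet Γ S) {x : Fin k} (hx : n ≤ x.val) : S x ↔ n + 3 ≤ x.val := by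
  obtain ⟨u, v, -, h⟩ := h
  rw [h]
  omega

variable {n d : ℕ} {Γ Δ : SimpleGraph (Fin n)}

/-- The vertices contained in an edge set are exactly the two ends of the edge. As these are
distinct, `u` and `v` must be the same two ends in some order. -/
theorem isEdgeSet_edge {u v : Fin n} :
    IsEdgeSet Γ (fun x : Fin (n + d) => x.val = u ∨ x.val = v ∨ n + 3 ≤ x.val) ↔ Γ.Adj u v := by
  constructor
  · rintro ⟨u', v', h, h'⟩
    have h₁ := h' (Fin.castAdd d u)
    have h₂ := h' (Fin.castAdd d v)
    have h₃ := h' (Fin.castAdd d u')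
    have h₄ := h' (Fin.castAdd d v')
    simp only [Fin.val_castAdd, ← Fin.ext_iff] at h₁ h₂ h₃ h₄
    have e₁ : ∀ u : Fin n, ¬ n + 3 ≤ u.val := fun u => by omega
    have hne := h.ne
    simp only [e₁, true_or, or_true, true_iff, iff_true, or_false] at h₁ h₂ h₃ h₄
    rcases h₃ with rfl | rfl
    · rcases h₄ with rfl | rfl
      · exact absurd rfl hne
      · exact h
    · rcases h₄ with rfl | rfl
      · exact h.symm
      · exact absurd rfl hne
  · exact fun h => ⟨u, v, h, fun _ => Iff.rfl⟩

/-- The isomorphism is extended by the identity on the added points. -/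
theorem exists_mapsSets_of_iso (e : Γ ≃g Δ) :
    ∃ f : Equiv.Perm (Fin (n + d)), MapsSets f (IsEdgeSet Γ) (IsEdgeSet Δ) := by
  have key : ∀ {Γ Δ : SimpleGraph (Fin n)} (e : Γ ≃g Δ) (f : Equiv.Perm (Fin (n + d)))
      (hf : ∀ u, f (Fin.castAdd d u) = Fin.castAdd d (e u))
      (hf' : ∀ q, f (Fin.natAdd n q) = Fin.natAdd n q) (S : Fin (n + d) → Prop),
      IsEdgeSet Γ S → IsEdgeSet Δ fun x => S (f.symm x) := by
    rintro Γ Δ e f hf hf' S ⟨u, v, h, h'⟩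
    refine ⟨e u, e v, e.map_adj_iff.2 h, fun x => ?_⟩
    change S (f.symm x) ↔ _
    rw [h']
    obtain ⟨y, rfl⟩ := f.surjective x
    rw [Equiv.symm_apply_apply]
    induction y using Fin.addCases with
    | left w =>
      rw [hf]
      simp only [Fin.val_castAdd, ← Fin.ext_iff, e.injective.eq_iff]
      have := w.isLt
      have := (e w).isLt
      omega
    | right q =>
      rw [hf']
      simp only [Fin.val_natAdd]
      omega
  let f : Equiv.Perm (Fin (n + d)) :=
    (finSumFinEquiv.symm.trans (Equiv.sumCongr e.toEquiv (Equiv.refl _))).trans finSumFinEquiv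
  have hf : ∀ u, f (Fin.castAdd d u) = Fin.castAdd d (e u) := by
    intro u; simp [f]
  have hf' : ∀ q, f (Fin.natAdd n q) = Fin.natAdd n q := by
    intro q; simp [f]
  refine ⟨f, fun S => ⟨key e f hf hf' S, fun hS => ?_⟩⟩
  have := key e.symm f.symm (fun u => by rw [Equiv.symm_apply_eq, hf]; simp)
    (fun q => by rw [Equiv.symm_apply_eq, hf']) _ hS
  simpa using this

/-- Each added point lies in every edge set or in none, for both graphs. So `f` may be assumed to
fix all added points; then it permutes the vertices, and edge sets translate back into edges. -/
theorem iso_of_mapsSets {f : Equiv.Perm (Fin (n + d))}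
    (h : MapsSets f (IsEdgeSet Γ) (IsEdgeSet Δ)) : Nonempty (Γ ≃g Δ) := by
  obtain ⟨f, hf, hfix⟩ := exists_mapsSets_fixing (Finset.univ.map (Fin.natAddEmb n)) (by
    intro p hp
    obtain ⟨q, -, rfl⟩ := Finset.mem_map.1 hp
    by_cases hq : n + 3 ≤ (Fin.natAddEmb n q).val
    · exact .inl ⟨fun S hS => (hS.iff_of_le (by simp)).2 hq,
        fun S hS => (hS.iff_of_le (by simp)).2 hq⟩
    · exact .inr ⟨fun S hS => mt (hS.iff_of_le (by simp)).1 hq,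
        fun S hS => mt (hS.iff_of_le (by simp)).1 hq⟩) h
  have hfix' : ∀ q, f (Fin.natAdd n q) = Fin.natAdd n q := fun q =>
    hfix _ (Finset.mem_map.2 ⟨q, Finset.mem_univ q, rfl⟩)
  have hlt : ∀ g : Equiv.Perm (Fin (n + d)), (∀ q, g (Fin.natAdd n q) = Fin.natAdd n q) →
      ∀ u, ∃ v, g (Fin.castAdd d u) = Fin.castAdd d v := by
    intro g hg u
    generalize hx : g (Fin.castAdd d u) = x
    induction x using Fin.addCases with
    | left v => exact ⟨v, rfl⟩
    | right q =>
      rw [← hg q] at hx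
      have := congrArg Fin.val (g.injective hx)
      simp at this
      omega
  choose e he using hlt f hfix'
  choose e' he' using hlt f.symm fun q => by rw [Equiv.symm_apply_eq, hfix']
  have hinj := Fin.castAdd_injective n d
  refine ⟨⟨⟨e, e', fun u => hinj (by rw [← he', ← he, Equiv.symm_apply_apply]),
    fun u => hinj (by rw [← he, ← he', Equiv.apply_symm_apply])⟩, ?_⟩⟩
  intro u v
  change Δ.Adj (e u) (e v) ↔ _
  rw [← isEdgeSet_edge (d := d), ← isEdgeSet_edge (d := d), hf]
  refine iff_of_eq (congrArg _ (funext fun x => propext ?_))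
  obtain ⟨y, rfl⟩ := f.surjective x
  rw [Equiv.symm_apply_apply]
  induction y using Fin.addCases with
  | left w =>
    rw [he]
    have hinj' : Function.Injective e := fun a b h => hinj (f.injective (by rw [he, he, h]))
    simp only [Fin.val_castAdd, ← Fin.ext_iff, hinj'.eq_iff]
    have := w.isLt
    have := (e w).isLt
    omega
  | right q =>
    rw [hfix']
    simp only [Fin.val_natAdd]
    omega

/-! ### Assignments for graphs -/

open Classical in
/-- The assignment to the `t`-sets that represents a graph. -/
noncomputable def graphAssignment (t : ℕ) (Γ : SimpleGraph (Fin n)) (d : ℕ)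
    (ω : JohnsonDomain (n + d) t) : Bool :=
  decide (IsEdgeSet Γ fun x => x ∈ (ω : Finset (Fin (n + d))))

theorem mem_smul {k t : ℕ} {σ : Equiv.Perm (Fin k)} {ω : JohnsonDomain k t} {x : Fin k} :
    x ∈ ((σ • ω : JohnsonDomain k t) : Finset (Fin k)) ↔ σ.symm x ∈ (ω : Finset (Fin k)) := by
  rw [Set.powersetCard.coe_smul, ← Finset.inv_smul_mem_iff]
  rfl

theorem mem_assignmentOrbit {k t : ℕ} {θ τ : JohnsonDomain k t → Bool} :
    τ ∈ assignmentOrbit (johnsonGroup k t) θ ↔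
      ∃ σ : Equiv.Perm (Fin k), τ = fun ω => θ (σ • ω) := by
  constructor
  · rintro ⟨_, ⟨σ, rfl⟩, rfl⟩
    exact ⟨σ⁻¹, by rw [← map_inv]; rfl⟩
  · rintro ⟨σ, rfl⟩
    exact ⟨_, ⟨σ⁻¹, rfl⟩, by rw [← map_inv, inv_inv]; rfl⟩

/-- Of the `t + 1` added points the first three are padding; the remaining `t - 2` complete the two
ends of an edge to a `t`-set. -/
theorem card_core (n : ℕ) {t : ℕ} (ht : 1 < t) :
    (Finset.univ.filter fun x : Fin (n + (t + 1)) => n + 3 ≤ x.val).card = t - 2 := by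
  obtain ⟨g, hg⟩ : ∃ g : Fin (t - 2) ↪ Fin (n + (t + 1)), ∀ q, (g q).val = n + 3 + q.val :=
    ⟨⟨fun q => ⟨n + 3 + q.val, by omega⟩, fun p q h => by simpa [Fin.ext_iff] using h⟩, fun _ => rfl⟩
  have h : (Finset.univ.filter fun x : Fin (n + (t + 1)) => n + 3 ≤ x.val) =
      Finset.univ.map g := by
    ext x
    simp only [Finset.mem_filter, Finset.mem_univ, true_and, Fin.ext_iff, Finset.mem_map, hg]
    refine ⟨fun h => ⟨⟨x.val - (n + 3), by omega⟩, Nat.add_sub_cancel' h⟩, ?_⟩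
    rintro ⟨q, h⟩; omega
  rw [h, Finset.card_map, Finset.card_univ, Fintype.card_fin]

theorem card_edge_set {t : ℕ} (ht : 1 < t) {u v : Fin n} (huv : u ≠ v) :
    (Finset.univ.filter fun x : Fin (n + (t + 1)) =>
      x.val = u ∨ x.val = v ∨ n + 3 ≤ x.val).card = t := by
  have h : (Finset.univ.filter fun x : Fin (n + (t + 1)) =>
      x.val = u ∨ x.val = v ∨ n + 3 ≤ x.val) = insert (Fin.castAdd (t + 1) u)
      (insert (Fin.castAdd (t + 1) v) (Finset.univ.filter fun x => n + 3 ≤ x.val)) := by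
    ext x
    simp [Fin.ext_iff]
  rw [h, Finset.card_insert_of_notMem, Finset.card_insert_of_notMem, card_core n ht]
  · omega
  · simp; omega
  · simp [Fin.ext_iff]
    exact ⟨fun h => huv (Fin.ext h), by omega⟩

/-- An assignment in the orbit is a composition with some `σ`, and equality of assignments says that
`σ` matches the edge sets of `Δ` with those of `Γ`. Passing between predicates and `t`-sets is
harmless because all edge sets have `t` elements. -/
theorem iso_iff_mem_orbit {t : ℕ} (ht : 1 < t) : Nonempty (Γ ≃g Δ) ↔
    graphAssignment t Δ (t + 1) ∈
      assignmentOrbit (johnsonGroup (n + (t + 1)) t) (graphAssignment t Γ (t + 1)) := by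
  rw [mem_assignmentOrbit]
  constructor
  · rintro ⟨e⟩
    obtain ⟨f, hf⟩ := exists_mapsSets_of_iso (d := t + 1) e.symm
    refine ⟨f, funext fun ω => ?_⟩
    simp only [graphAssignment, decide_eq_decide, mem_smul]
    exact hf _
  · rintro ⟨σ, h⟩
    refine (iso_of_mapsSets (d := t + 1) (f := σ) fun S => ?_).map fun e => e.symm
    classical
    have hcard : ∀ {Γ : SimpleGraph (Fin n)} {S : Fin (n + (t + 1)) → Prop}, IsEdgeSet Γ S →
        (Finset.univ.filter S).card = t := by
      rintro Γ S ⟨u, v, huv, hS⟩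
      refine Eq.trans ?_ (card_edge_set ht huv.ne)
      congr 1
      ext x
      simp [hS]
    have key : ∀ S : Fin (n + (t + 1)) → Prop, (Finset.univ.filter S).card = t →
        (IsEdgeSet Δ S ↔ IsEdgeSet Γ (fun x => S (σ.symm x))) := by
      intro S hS
      have := congrFun h ⟨Finset.univ.filter S, hS⟩
      simp only [graphAssignment, decide_eq_decide, mem_smul] at this
      simpa using this
    refine ⟨fun hS => (key S (hcard hS)).1 hS, fun hS => (key S ?_).2 hS⟩
    refine Eq.trans ?_ (hcard hS)
    rw [← Finset.card_map σ.toEmbedding]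
    congr 1
    ext x
    simp

end SymBreak

namespace SymBreak

open Prog

/-! ### Sets as words -/

/-- The points in the order in which the words of the initial tables list them. -/
def labels (n d : ℕ) : List (Fin (n + d)) :=
  ((List.finRange n).map (Fin.castAdd d)).reverse ++ (List.finRange d).map (Fin.natAdd n)

/-- The end of the words that represent edges. -/
def tailWord (t : ℕ) : List Bool := (List.finRange (t + 1)).map fun q => decide (3 ≤ q.val)

@[simp] theorem length_tailWord (t : ℕ) : (tailWord t).length = t + 1 := by simp [tailWord]

variable {n d t : ℕ}

theorem labels_perm : (labels n d).Perm (List.finRange (n + d)) := by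
  rw [List.perm_ext_iff_of_nodup]
  · intro x
    simp only [labels, List.mem_append, List.mem_reverse, List.mem_map, List.mem_finRange,
      true_and, iff_true]
    induction x using Fin.addCases with
    | left u => exact .inl ⟨u, rfl⟩
    | right q => exact .inr ⟨q, rfl⟩
  · rw [labels, List.nodup_append]
    refine ⟨List.nodup_reverse.2 ((List.nodup_finRange n).map (Fin.castAdd_injective n d)),
      (List.nodup_finRange d).map (Fin.natAdd_injective d n), ?_⟩
    simp only [List.mem_reverse, List.mem_map]
    rintro _ ⟨u, -, rfl⟩ _ ⟨q, -, rfl⟩ h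
    have := congrArg Fin.val h
    simp at this
    omega
  · exact List.nodup_finRange _

theorem exists_perm_of_perm {k : ℕ} {l : List (Fin k)} (h : l.Perm (List.finRange k)) :
    ∃ σ : Equiv.Perm (Fin k), l = (List.finRange k).map σ := by
  have hlen : l.length = k := by simpa using h.length_eq
  have hl : l.Nodup := h.nodup_iff.2 (List.nodup_finRange k)
  have hinj : Function.Injective fun i : Fin k => l[i.val]'(by omega) := by
    intro i j hij
    exact Fin.ext (hl.getElem_inj_iff.1 hij)
  refine ⟨Equiv.ofBijective _ (Finite.injective_iff_bijective.1 hinj), ?_⟩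
  apply List.ext_getElem
  · simp [hlen]
  · intro i h₁ h₂
    simp

theorem range_eq_map_finRange (n : ℕ) : List.range n = (List.finRange n).map Fin.val := by
  apply List.ext_getElem <;> simp

theorem append_eq_append_iff_of_length {α : Type} {l₁ l₂ r₁ r₂ : List α}
    (h : l₁.length = l₂.length) : l₁ ++ r₁ = l₂ ++ r₂ ↔ l₁ = l₂ ∧ r₁ = r₂ :=
  ⟨fun h' => List.append_inj h' h, fun ⟨h₁, h₂⟩ => by rw [h₁, h₂]⟩

/-- A word splits into the values at the vertices, backwards, and those at the added points. Ending
in `tailWord t` means containing the core and no padding point. -/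
theorem labels_map_eq_append {f : Fin (n + (t + 1)) → Bool} {v : List Bool} (hv : v.length = n) :
    (labels n (t + 1)).map f = v ++ tailWord t ↔
      ((List.finRange n).map fun u => f (Fin.castAdd (t + 1) u)).reverse = v ∧
      ∀ x, n ≤ x.val → (f x = true ↔ n + 3 ≤ x.val) := by
  rw [labels, tailWord, List.map_append, List.map_reverse, List.map_map, List.map_map,
    append_eq_append_iff_of_length (by simp [hv])]
  refine and_congr Iff.rfl ?_
  rw [List.map_inj_left]
  constructor
  · intro h x hx
    induction x using Fin.addCases with
    | left u => simp at hx; omega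
    | right q =>
      have := h q (List.mem_finRange q)
      simp only [Function.comp_apply] at this
      rw [this]
      simp
  · intro h q _
    have := h (Fin.natAdd n q) (by simp)
    rw [Bool.eq_iff_iff, Function.comp_apply, this]
    simp

theorem labels_map_eq {f : Fin (n + (t + 1)) → Bool} {i j : Fin n} :
    (labels n (t + 1)).map f = pairVec n i j ++ tailWord t ↔
      ∀ x, f x = true ↔ (x.val = i ∨ x.val = j ∨ n + 3 ≤ x.val) := by
  rw [labels_map_eq_append (by simp [pairVec]), pairVec, List.reverse_inj, range_eq_map_finRange,
    List.map_map, List.map_inj_left]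
  constructor
  · rintro ⟨h₁, h₂⟩ x
    by_cases hx : n ≤ x.val
    · rw [h₂ x hx]; omega
    · have := h₁ ⟨x.val, by omega⟩ (List.mem_finRange _)
      have e : Fin.castAdd (t + 1) (⟨x.val, by omega⟩ : Fin n) = x := rfl
      rw [e] at this
      rw [this]
      simp
      omega
  · intro h
    refine ⟨fun u _ => ?_, fun x hx => by rw [h]; omega⟩
    rw [Bool.eq_iff_iff, h]
    simp
    omega

/-- A matrix is the adjacency matrix of a graph. -/
def Represents (A : ℕ → ℕ → Bool) (Γ : SimpleGraph (Fin n)) : Prop :=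
  ∀ u v : Fin n, A u v = true ↔ Γ.Adj u v

variable {A B : ℕ → ℕ → Bool} {Γ Δ : SimpleGraph (Fin n)}

/-- The word of a set in the initial tables. -/
def setWord {k : ℕ} (ℓ : List (Fin k)) (ω : JohnsonDomain k t) : List Bool :=
  ℓ.map fun x => decide (x ∈ (ω : Finset (Fin k)))

theorem setWord_eq_pairVec {ω : JohnsonDomain (n + (t + 1)) t} {i j : Fin n}
    (h : setWord (labels n (t + 1)) ω = pairVec n i j ++ tailWord t) :
    graphAssignment t Γ (t + 1) ω = true ↔ Γ.Adj i j := by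
  rw [setWord, labels_map_eq] at h
  simp only [decide_eq_true_eq] at h
  simp only [graphAssignment, decide_eq_true_eq, h]
  exact isEdgeSet_edge

theorem mem_matEntries_fin {b : Bool} {c tail : List Bool} :
    (b, c) ∈ matEntries tail A n n ↔ ∃ i j : Fin n,
      (b = false ∧ c = pairVec n i i ++ tail) ∨ (b = A i j ∧ c = pairVec n i j ++ tail) := by
  rw [mem_matEntries]
  constructor
  · rintro ⟨i, hi, j, hj, h⟩
    exact ⟨⟨i, hi⟩, ⟨j, hj⟩, by simpa [bitEntries] using h⟩
  · rintro ⟨i, j, h⟩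
    exact ⟨i, i.isLt, j, j.isLt, by simpa [bitEntries] using h⟩

/-- The table never lies about a `t`-set, whatever was guessed: guessed entries are negative and
have a wrong end for an edge set. The entries from the matrix are correct because `Γ` has no loops
and `A` represents it. -/
theorem graphAssignment_of_mem (hA : Represents A Γ) {G : List (Bool × List Bool)}
    (hG : IsNegative (tailWord t) n G) {b : Bool} {ω : JohnsonDomain (n + (t + 1)) t}
    (h : (b, setWord (labels n (t + 1)) ω) ∈ G ++ matEntries (tailWord t) A n n) :
    graphAssignment t Γ (t + 1) ω = b := by
  rcases List.mem_append.1 h with h | h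
  · obtain ⟨v, p, hp, hv, h⟩ := hG _ h
    rw [mem_otherWords] at hp
    obtain ⟨rfl, h'⟩ := Prod.mk.inj h
    rw [← Bool.not_eq_true]
    simp only [graphAssignment, decide_eq_true_eq]
    rintro ⟨u, w, -, hE⟩
    have := (labels_map_eq (f := fun x => decide (x ∈ (ω : Finset _))) (i := u) (j := w)).2
      (by simpa using hE)
    rw [← setWord, h'] at this
    exact hp.2 (List.append_inj_right this (by simp [pairVec, hv]))
  · obtain ⟨i, j, ⟨rfl, h'⟩ | ⟨rfl, h'⟩⟩ := mem_matEntries_fin.1 h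
    · rw [← Bool.not_eq_true, setWord_eq_pairVec h']
      exact Γ.loopless.irrefl i
    · rw [Bool.eq_iff_iff, setWord_eq_pairVec h', hA]

/-- A positive entry can only come from a one in the matrix, hence from an edge, whose ends are
distinct; so its word has exactly `t` ones. For negative entries this may fail. -/
theorem exists_setWord_of_mem (ht : 1 < t) (hA : Represents A Γ) {G : List (Bool × List Bool)}
    (hG : IsNegative (tailWord t) n G) {c : List Bool}
    (h : (true, c) ∈ G ++ matEntries (tailWord t) A n n) :
    ∃ ω : JohnsonDomain (n + (t + 1)) t, c = setWord (labels n (t + 1)) ω := by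
  rcases List.mem_append.1 h with h | h
  · obtain ⟨v, p, hp, hv, h⟩ := hG _ h
    simp at h
  · obtain ⟨i, j, ⟨h', -⟩ | ⟨h', rfl⟩⟩ := mem_matEntries_fin.1 h
    · simp at h'
    · have hij := ((hA i j).1 h'.symm).ne
      refine ⟨⟨_, card_edge_set ht hij⟩, ?_⟩
      rw [setWord, eq_comm, labels_map_eq]
      simp

/-- Negative entries for all sets that cannot represent edges. -/
noncomputable def negativeEntries (n t : ℕ) : List (Bool × List Bool) :=
  ((Finset.univ : Finset (JohnsonDomain (n + (t + 1)) t)).toList.map fun ω =>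
    (false, setWord (labels n (t + 1)) ω)).filter fun e => e.2.drop n ≠ tailWord t

theorem isNegative_negativeEntries : IsNegative (tailWord t) n (negativeEntries n t) := by
  intro e he
  simp only [negativeEntries, ne_eq, decide_not, List.mem_filter, List.mem_map, Finset.mem_toList,
    Finset.mem_univ, true_and, Bool.not_eq_eq_eq_not, Bool.not_true, decide_eq_false_iff_not] at he
  obtain ⟨⟨ω, rfl⟩, h⟩ := he
  have hlen : (setWord (labels n (t + 1)) ω).length = n + (t + 1) := by simp [setWord, labels]
  refine ⟨(setWord (labels n (t + 1)) ω).take n, (setWord (labels n (t + 1)) ω).drop n,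
    mem_otherWords.2 ⟨?_, h⟩, ?_, ?_⟩
  · simp [hlen]
  · simp [hlen]
  · simp

theorem length_negativeEntries : (negativeEntries n t).length ≤ (n + (t + 1)).choose t := by
  refine (List.length_filter_le _ _).trans ?_
  rw [List.length_map, Finset.length_toList, Finset.card_univ, ← Nat.card_eq_fintype_card,
    Set.powersetCard.card, Nat.card_eq_fintype_card, Fintype.card_fin]

/-- The table decides every `t`-set. Sets whose words have a wrong end are among `negativeEntries`;
the others consist of the core and two vertices and are covered by the matrix. -/
theorem mem_table_of_graphAssignment (ht : 1 < t) (hA : Represents A Γ)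
    (ω : JohnsonDomain (n + (t + 1)) t) :
    (graphAssignment t Γ (t + 1) ω, setWord (labels n (t + 1)) ω) ∈
      negativeEntries n t ++ matEntries (tailWord t) A n n := by
  by_cases h : (setWord (labels n (t + 1)) ω).drop n = tailWord t
  · obtain ⟨i, j, hij⟩ : ∃ i j : Fin n,
        setWord (labels n (t + 1)) ω = pairVec n i j ++ tailWord t := by
      have hlen : (setWord (labels n (t + 1)) ω).length = n + (t + 1) := by simp [setWord, labels]
      have h₁ := List.take_append_drop n (setWord (labels n (t + 1)) ω)
      rw [h] at h₁
      have h₂ := ((labels_map_eq_append (by simp [hlen])).1 h₁.symm).2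
      simp only [decide_eq_true_eq] at h₂
      have h₃ := Finset.card_filter_add_card_filter_not (s := (ω : Finset (Fin (n + (t + 1)))))
        (fun x => n ≤ x.val)
      have h₄ : (ω : Finset (Fin (n + (t + 1)))).filter (fun x => n ≤ x.val) =
          Finset.univ.filter fun x => n + 3 ≤ x.val := by
        ext x
        simp only [Finset.mem_filter, Finset.mem_univ, true_and]
        constructor
        · rintro ⟨hx, hx'⟩; exact (h₂ x hx').1 hx
        · intro hx; exact ⟨(h₂ x (by omega)).2 hx, by omega⟩
      -- The set contains the whole core, that is `t - 2` points, and no padding point; so exactly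
      -- two of its points are vertices.
      rw [h₄, card_core n ht, Set.powersetCard.card_eq ω] at h₃
      obtain ⟨u, v, -, huv⟩ := Finset.card_eq_two.1 (by omega : ((ω : Finset
        (Fin (n + (t + 1)))).filter (fun x => ¬ n ≤ x.val)).card = 2)
      have hmem : ∀ x, x ∈ (ω : Finset (Fin (n + (t + 1)))) ∧ ¬ n ≤ x.val ↔ x = u ∨ x = v := by
        intro x
        have := congrArg (fun s => x ∈ s) huv
        simpa using this
      have hu := ((hmem u).2 (.inl rfl)).2
      have hv := ((hmem v).2 (.inr rfl)).2
      refine ⟨⟨u, by omega⟩, ⟨v, by omega⟩, ?_⟩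
      rw [setWord, labels_map_eq]
      intro x
      simp only [decide_eq_true_eq, ← Fin.ext_iff]
      by_cases hx : n ≤ x.val
      · rw [h₂ x hx]
        have : x ≠ u := fun h => hu (h ▸ hx)
        have : x ≠ v := fun h => hv (h ▸ hx)
        tauto
      · have := hmem x
        have : ¬ n + 3 ≤ x.val := by omega
        tauto
    refine List.mem_append_right _ (mem_matEntries_fin.2 ⟨i, j, .inr ⟨?_, hij⟩⟩)
    rw [Bool.eq_iff_iff, setWord_eq_pairVec hij, hA]
  · have hmem : (false, setWord (labels n (t + 1)) ω) ∈ negativeEntries n t := by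
      simp only [negativeEntries, ne_eq, decide_not, List.mem_filter, List.mem_map,
        Finset.mem_toList, Finset.mem_univ, true_and, Bool.not_eq_eq_eq_not, Bool.not_true,
        decide_eq_false_iff_not]
      exact ⟨⟨ω, rfl⟩, h⟩
    rw [graphAssignment_of_mem hA isNegative_negativeEntries (List.mem_append_left _ hmem)]
    exact List.mem_append_left _ hmem

end SymBreak

namespace SymBreak

open Prog

/-! ### Formulas as lists of words -/

theorem rotates_injective {α : Type} (ops : List Bool) :
    Function.Injective (rotates ops : List α → List α) := by
  have h : ∀ o, Function.Injective (rotate o : List α → List α) := by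
    intro o l l' hl
    have hlen : l.length = l'.length := by
      rw [← (rotate_perm o l).length_eq, hl, (rotate_perm o l').length_eq]
    rcases o with _ | _ <;> rcases l with _ | ⟨a, _ | ⟨b, l⟩⟩ <;>
      rcases l' with _ | ⟨a', _ | ⟨b', l'⟩⟩ <;> simp [rotate] at hl hlen ⊢ <;> try exact hl
    all_goals tauto
  induction ops with
  | nil => exact fun _ _ h => h
  | cons o ops ih => exact ih.comp (h o)

variable {n k t : ℕ}

/-- Rearranging the letters of all words is the same as letting a permutation act on the sets. This
translates rotations of tables into the Johnson action. -/
theorem setWord_map {ℓ : List (Fin k)} {σ : Equiv.Perm (Fin k)} {ω : JohnsonDomain k t} :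
    setWord (ℓ.map σ) ω = setWord ℓ (σ⁻¹ • ω) := by
  rw [setWord, setWord, List.map_map]
  refine List.map_congr_left fun x _ => ?_
  simp only [Function.comp_apply, mem_smul]
  rfl

/-- The literals of a formula, as table entries. -/
def formulaLits (ψ : Std.Sat.CNF (JohnsonDomain k t)) : List (List (Bool × List Bool)) :=
  ψ.clauses.toList.map fun C => C.map fun l => (l.2, setWord (List.finRange k) l.1)

theorem encodeCNF_eq (ψ : Std.Sat.CNF (JohnsonDomain k t)) :
    encodeCNF ψ = (formulaLits ψ).flatMap clauseWord := by
  rw [encodeCNF, formulaLits, List.flatMap_map]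
  congr 1
  funext C
  rw [clauseWord, List.flatMap_map]
  congr 2
  funext l
  rw [encodeLiteral, litWord, setWord, List.ofFn_eq_map, List.map_map]
  rfl

theorem length_of_mem_formulaLits {ψ : Std.Sat.CNF (JohnsonDomain k t)} :
    ∀ C ∈ formulaLits ψ, ∀ q ∈ C, q.2.length = k := by
  intro C hC q hq
  obtain ⟨D, -, rfl⟩ := List.mem_map.1 hC
  obtain ⟨l, -, rfl⟩ := List.mem_map.1 hq
  simp [setWord]

theorem eval_eq_true_iff {Ω : Type} {ψ : Std.Sat.CNF Ω} {θ : Ω → Bool} :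
    ψ.eval θ = true ↔ ∀ C ∈ ψ.clauses.toList, ∃ l ∈ C, θ l.1 = l.2 := by
  rw [Std.Sat.CNF.eval, ← Array.all_toList, List.all_eq_true]
  simp only [Std.Sat.CNF.Clause.eval, List.any_eq_true, beq_iff_eq]

/-- The table is regarded as a partial assignment: it has to be correct for this lemma and complete
for the next one. -/
theorem eval_of_satisfies {ψ : Std.Sat.CNF (JohnsonDomain k t)} {E : List (Bool × List Bool)}
    {θ : JohnsonDomain k t → Bool}
    (hE : ∀ b ω, (b, setWord (List.finRange k) ω) ∈ E → θ ω = b)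
    (h : Satisfies (formulaLits ψ) E) : ψ.eval θ = true := by
  rw [eval_eq_true_iff]
  intro C hC
  obtain ⟨q, hq, hqE⟩ := h _ (List.mem_map_of_mem hC)
  obtain ⟨l, hl, rfl⟩ := List.mem_map.1 hq
  exact ⟨l, hl, hE _ _ hqE⟩

theorem satisfies_of_eval {ψ : Std.Sat.CNF (JohnsonDomain k t)} {E : List (Bool × List Bool)}
    {θ : JohnsonDomain k t → Bool}
    (hE : ∀ ω, (θ ω, setWord (List.finRange k) ω) ∈ E)
    (h : ψ.eval θ = true) : Satisfies (formulaLits ψ) E := by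
  rw [eval_eq_true_iff] at h
  intro D hD
  obtain ⟨C, hC, rfl⟩ := List.mem_map.1 hD
  obtain ⟨l, hl, hθ⟩ := h C hC
  exact ⟨_, List.mem_map_of_mem hl, hθ ▸ hE l.1⟩

/-! ### Differing graphs -/

variable {A B : ℕ → ℕ → Bool} {Γ Δ : SimpleGraph (Fin n)}

theorem rotates_setWord {ops : List Bool} {σ : Equiv.Perm (Fin (n + (t + 1)))}
    (hσ : rotates ops (labels n (t + 1)) = (List.finRange _).map σ)
    (ω : JohnsonDomain (n + (t + 1)) t) :
    rotates ops (setWord (labels n (t + 1)) ω) = setWord (List.finRange _) (σ⁻¹ • ω) := by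
  rw [← setWord_map, ← hσ, setWord, rotates_map]
  rfl

theorem mem_rotWords {ops : List Bool} {E : List (Bool × List Bool)} {b : Bool} {c : List Bool} :
    (b, rotates ops c) ∈ rotWords ops E ↔ (b, c) ∈ E := by
  simp only [rotWords, List.mem_map, Prod.mk.injEq, Prod.exists]
  constructor
  · rintro ⟨_, _, h, rfl, h'⟩
    rwa [← rotates_injective ops h']
  · intro h
    exact ⟨_, _, h, rfl, rfl⟩

/-- In the rotated table, read with the points in their natural order, the value at `ω` is the value
of the original table at `σ • ω`. So a table for `θ` becomes one for `fun ω => θ (σ • ω)`, another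
assignment in the orbit. -/
theorem mem_rotWords_setWord {ops : List Bool} {σ : Equiv.Perm (Fin (n + (t + 1)))}
    (hσ : rotates ops (labels n (t + 1)) = (List.finRange _).map σ)
    {E : List (Bool × List Bool)} {b : Bool} {ω : JohnsonDomain (n + (t + 1)) t} :
    (b, setWord (List.finRange _) ω) ∈ rotWords ops E ↔
      (b, setWord (labels n (t + 1)) (σ • ω)) ∈ E := by
  rw [← mem_rotWords (ops := ops) (E := E), rotates_setWord hσ, inv_smul_smul]

theorem exists_setWord_of_mem_rotWords (ht : 1 < t) (hA : Represents A Γ)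
    {G : List (Bool × List Bool)} (hG : IsNegative (tailWord t) n G) {ops : List Bool}
    {c : List Bool} (h : (true, c) ∈ rotWords ops (G ++ matEntries (tailWord t) A n n)) :
    ∃ ω : JohnsonDomain (n + (t + 1)) t, c = setWord (List.finRange _) ω := by
  obtain ⟨σ, hσ⟩ := exists_perm_of_perm ((rotates_perm ops (labels n (t + 1))).trans labels_perm)
  obtain ⟨⟨b, c'⟩, h₁, h'⟩ := List.mem_map.1 h
  obtain ⟨rfl, rfl⟩ := Prod.mk.inj h'
  obtain ⟨ω, rfl⟩ := exists_setWord_of_mem ht hA hG h₁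
  exact ⟨_, rotates_setWord hσ ω⟩

theorem isNegative_nil {tail : List Bool} : IsNegative tail n [] := by simp [IsNegative]

/-- One of two opposite entries is positive, so their common word belongs to a `t`-set, for which
the table gives only the true value. -/
theorem not_contra (ht : 1 < t) (hA : Represents A Γ) :
    ¬ Contra (matEntries (tailWord t) A n n) (matEntries (tailWord t) A n n) := by
  rintro ⟨b, c, h₁, h₂⟩
  obtain ⟨ω, rfl⟩ : ∃ ω : JohnsonDomain (n + (t + 1)) t, c = setWord (labels n (t + 1)) ω := by
    cases b
    · exact exists_setWord_of_mem ht hA isNegative_nil h₂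
    · exact exists_setWord_of_mem ht hA isNegative_nil h₁
  have h₃ := graphAssignment_of_mem hA (G := []) isNegative_nil h₁
  rw [graphAssignment_of_mem hA (G := []) isNegative_nil h₂] at h₃
  cases b <;> simp at h₃

theorem IsCompleteSBP.eq_of_eval {Ω : Type} {G : Subgroup (Equiv.Perm Ω)} {ψ : Std.Sat.CNF Ω}
    (h : IsCompleteSBP G ψ) {θ τ τ' : Ω → Bool} (hτ : τ ∈ assignmentOrbit G θ)
    (hτ' : τ' ∈ assignmentOrbit G θ) (h₁ : ψ.eval τ = true) (h₂ : ψ.eval τ' = true) : τ = τ' := by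
  obtain ⟨τ₀, -, -, h₀⟩ := h θ
  have key : ∀ τ ∈ assignmentOrbit G θ, ψ.eval τ = true → τ = τ₀ := by
    intro τ hτ h₁
    by_contra hne
    rw [h₀ τ hτ hne] at h₁
    cases h₁
  rw [key τ hτ h₁, key τ' hτ' h₂]

/-- The two rotated tables describe satisfying assignments from a single orbit, and `ψ` has only one
there. Hence the tables cannot disagree on a `t`-set. -/
theorem not_differ_of_iso (ht : 1 < t) {ψ : Std.Sat.CNF (JohnsonDomain (n + (t + 1)) t)}
    (hψ : IsCompleteSBP (johnsonGroup (n + (t + 1)) t) ψ) (hA : Represents A Γ)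
    (hB : Represents B Δ) (hiso : Nonempty (Γ ≃g Δ)) :
    ¬ Differ (tailWord t) (formulaLits ψ) n (matEntries (tailWord t) A n n)
      (matEntries (tailWord t) B n n) := by
  rintro (h | h | ⟨G, ops, G', ops', hG, hG', h₁, h₂, b, c, hb, hb'⟩)
  · exact not_contra ht hA h
  · exact not_contra ht hB h
  obtain ⟨σ, hσ⟩ := exists_perm_of_perm ((rotates_perm ops (labels n (t + 1))).trans labels_perm)
  obtain ⟨σ', hσ'⟩ := exists_perm_of_perm ((rotates_perm ops' (labels n (t + 1))).trans labels_perm)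
  have h₃ : ∀ b ω, (b, setWord (List.finRange _) ω) ∈
      rotWords ops (G ++ matEntries (tailWord t) A n n) →
      graphAssignment t Γ (t + 1) (σ • ω) = b := fun b ω h =>
    graphAssignment_of_mem hA hG ((mem_rotWords_setWord hσ).1 h)
  have h₄ : ∀ b ω, (b, setWord (List.finRange _) ω) ∈
      rotWords ops' (G' ++ matEntries (tailWord t) B n n) →
      graphAssignment t Δ (t + 1) (σ' • ω) = b := fun b ω h =>
    graphAssignment_of_mem hB hG' ((mem_rotWords_setWord hσ').1 h)
  obtain ⟨ρ, hρ⟩ := mem_assignmentOrbit.1 ((iso_iff_mem_orbit ht).1 hiso)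
  have heq := hψ.eq_of_eval (θ := graphAssignment t Γ (t + 1)) (mem_assignmentOrbit.2 ⟨σ, rfl⟩)
    (mem_assignmentOrbit.2 ⟨ρ * σ', by simp only [hρ, mul_smul]⟩)
    (eval_of_satisfies h₃ h₁) (eval_of_satisfies h₄ h₂)
  -- Guessed words need not be characteristic vectors of `t`-sets, but the positive one of the two
  -- opposite entries is.
  obtain ⟨ω, rfl⟩ : ∃ ω : JohnsonDomain (n + (t + 1)) t, c = setWord (List.finRange _) ω := by
    cases b
    · exact exists_setWord_of_mem_rotWords ht hB hG' hb'
    · exact exists_setWord_of_mem_rotWords ht hA hG hb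
  have h₅ := congrFun heq ω
  rw [h₃ _ _ hb, h₄ _ _ hb'] at h₅
  cases b <;> simp at h₅

/-- The certificate for a graph. -/
theorem exists_ops (ht : 1 < t) {ψ : Std.Sat.CNF (JohnsonDomain (n + (t + 1)) t)}
    (hA : Represents A Γ) (σ : Equiv.Perm (Fin (n + (t + 1))))
    (h : ψ.eval (fun ω => graphAssignment t Γ (t + 1) (σ • ω)) = true) :
    ∃ ops : List Bool, ops.length ≤ (n + (t + 1)) * (n + (t + 1)) ∧
      (∀ ω : JohnsonDomain (n + (t + 1)) t,
        (graphAssignment t Γ (t + 1) (σ • ω), setWord (List.finRange _) ω) ∈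
          rotWords ops (negativeEntries n t ++ matEntries (tailWord t) A n n)) ∧
      Satisfies (formulaLits ψ)
        (rotWords ops (negativeEntries n t ++ matEntries (tailWord t) A n n)) := by
  have hperm : (labels n (t + 1)).Perm ((List.finRange _).map σ) := by
    refine labels_perm.trans ?_
    rw [List.perm_ext_iff_of_nodup (List.nodup_finRange _)
      ((List.nodup_finRange _).map σ.injective)]
    intro x
    simp only [List.mem_finRange, List.mem_map, true_and, true_iff]
    exact σ.surjective x
  obtain ⟨ops, h₁, hσ⟩ := exists_rotates hperm
  have h₂ : ∀ ω : JohnsonDomain (n + (t + 1)) t,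
        (graphAssignment t Γ (t + 1) (σ • ω), setWord (List.finRange _) ω) ∈
          rotWords ops (negativeEntries n t ++ matEntries (tailWord t) A n n) := fun ω =>
    (mem_rotWords_setWord hσ).2 (mem_table_of_graphAssignment ht hA _)
  exact ⟨ops, by simpa [labels] using h₁, h₂, satisfies_of_eval h₂ h⟩

/-- Each orbit contains a satisfying assignment, and the orbits of non-isomorphic graphs are
different; so the two satisfying assignments differ at some `t`-set, and there the complete tables
have opposite entries. -/
theorem exists_certificate (ht : 1 < t) {ψ : Std.Sat.CNF (JohnsonDomain (n + (t + 1)) t)}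
    (hψ : IsCompleteSBP (johnsonGroup (n + (t + 1)) t) ψ) (hA : Represents A Γ)
    (hB : Represents B Δ) (hiso : ¬ Nonempty (Γ ≃g Δ)) :
    ∃ ops ops' : List Bool, ops.length ≤ (n + (t + 1)) * (n + (t + 1)) ∧
      ops'.length ≤ (n + (t + 1)) * (n + (t + 1)) ∧
      Satisfies (formulaLits ψ)
        (rotWords ops (negativeEntries n t ++ matEntries (tailWord t) A n n)) ∧
      Satisfies (formulaLits ψ)
        (rotWords ops' (negativeEntries n t ++ matEntries (tailWord t) B n n)) ∧
      Contra (rotWords ops (negativeEntries n t ++ matEntries (tailWord t) A n n))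
        (rotWords ops' (negativeEntries n t ++ matEntries (tailWord t) B n n)) := by
  obtain ⟨_, hτ, h₁, -⟩ := hψ (graphAssignment t Γ (t + 1))
  obtain ⟨_, hτ', h₂, -⟩ := hψ (graphAssignment t Δ (t + 1))
  obtain ⟨σ, rfl⟩ := mem_assignmentOrbit.1 hτ
  obtain ⟨σ', rfl⟩ := mem_assignmentOrbit.1 hτ'
  obtain ⟨ops, h₃, h₄, h₅⟩ := exists_ops ht hA σ h₁
  obtain ⟨ops', h₃', h₄', h₅'⟩ := exists_ops ht hB σ' h₂
  obtain ⟨ω, hω⟩ : ∃ ω : JohnsonDomain (n + (t + 1)) t,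
      graphAssignment t Γ (t + 1) (σ • ω) ≠ graphAssignment t Δ (t + 1) (σ' • ω) := by
    by_contra! h
    refine hiso ((iso_iff_mem_orbit ht).2 (mem_assignmentOrbit.2 ⟨σ * σ'⁻¹, funext fun ω => ?_⟩))
    rw [mul_smul, h, smul_inv_smul]
  refine ⟨ops, ops', h₃, h₃', h₅, h₅', _, _, h₄ ω, ?_⟩
  rw [Bool.not_eq.2 hω]
  exact h₄' ω

/-- A matrix that does not represent a graph gives contradictory entries. -/
theorem exists_represents_or_contra (A : ℕ → ℕ → Bool) (n : ℕ) (tail : List Bool) :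
    (∃ Γ : SimpleGraph (Fin n), Represents A Γ) ∨
      Contra (matEntries tail A n n) (matEntries tail A n n) := by
  by_cases h₁ : ∃ i : Fin n, A i i = true
  · obtain ⟨i, hi⟩ := h₁
    exact .inr ⟨false, _, mem_matEntries_fin.2 ⟨i, i, .inl ⟨rfl, rfl⟩⟩,
      mem_matEntries_fin.2 ⟨i, i, .inr ⟨by simp [hi], rfl⟩⟩⟩
  by_cases h₂ : ∃ i j : Fin n, A i j ≠ A j i
  · obtain ⟨i, j, h⟩ := h₂
    refine .inr ⟨A i j, _, mem_matEntries_fin.2 ⟨i, j, .inr ⟨rfl, rfl⟩⟩,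
      mem_matEntries_fin.2 ⟨j, i, .inr ⟨Bool.not_eq.2 h, ?_⟩⟩⟩
    -- The word of a pair does not depend on the order, so the matrix elements at `(i, j)` and `(j,
    -- i)` yield entries for the same word.
    simp only [pairVec, Bool.or_comm]
  push Not at h₁ h₂
  exact .inl ⟨⟨fun i j => A i j = true, ⟨fun i j h => by rw [h₂ j i]; exact h⟩,
    ⟨fun i => h₁ i⟩⟩, fun u v => Iff.rfl⟩

end SymBreak

namespace SymBreak

open Prog

/-! ### Polynomial bounds -/

/-- The function is bounded by a polynomial. -/
def PolyBdd (f : ℕ → ℕ) : Prop := ∃ q : Polynomial ℕ, ∀ n, f n ≤ q.eval n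

namespace PolyBdd

variable {f g : ℕ → ℕ}

theorem const (c : ℕ) : PolyBdd fun _ => c := ⟨Polynomial.C c, fun n => by simp⟩

theorem id : PolyBdd fun n => n := ⟨Polynomial.X, fun n => by simp⟩

theorem add (hf : PolyBdd f) (hg : PolyBdd g) : PolyBdd fun n => f n + g n := by
  obtain ⟨p, hp⟩ := hf
  obtain ⟨q, hq⟩ := hg
  exact ⟨p + q, fun n => by rw [Polynomial.eval_add]; exact Nat.add_le_add (hp n) (hq n)⟩

theorem mul (hf : PolyBdd f) (hg : PolyBdd g) : PolyBdd fun n => f n * g n := by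
  obtain ⟨p, hp⟩ := hf
  obtain ⟨q, hq⟩ := hg
  exact ⟨p * q, fun n => by rw [Polynomial.eval_mul]; exact Nat.mul_le_mul (hp n) (hq n)⟩

theorem pow (hf : PolyBdd f) (e : ℕ) : PolyBdd fun n => f n ^ e := by
  obtain ⟨p, hp⟩ := hf
  exact ⟨p ^ e, fun n => by rw [Polynomial.eval_pow]; exact Nat.pow_le_pow_left (hp n) e⟩

theorem mono (hg : PolyBdd g) (h : ∀ n, f n ≤ g n) : PolyBdd f := by
  obtain ⟨q, hq⟩ := hg
  exact ⟨q, fun n => (h n).trans (hq n)⟩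

/-- The induction runs over the set of exponents and does not use that this set is a range. -/
theorem eval (hf : PolyBdd f) (p : Polynomial ℕ) : PolyBdd fun n => p.eval (f n) := by
  simp only [Polynomial.eval_eq_sum_range]
  induction Finset.range (p.natDegree + 1) using Finset.induction_on with
  | empty => simpa using const 0
  | insert a s ha ih =>
    simp only [Finset.sum_insert ha]
    exact ((const _).mul (hf.pow a)).add ih

/-- Here it matters that `t` is fixed: the size of the domain is polynomial in the number of points.
-/
theorem choose (hf : PolyBdd f) (t : ℕ) : PolyBdd fun n => (f n).choose t :=
  (hf.pow t).mono fun _ => Nat.choose_le_pow _ _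

variable {c : ℕ → ℕ}

theorem loopCost (hf : PolyBdd f) (hc : PolyBdd c) : PolyBdd fun n => loopCost (f n) (c n) :=
  (hf.add (const 1)).mul ((hc.add ((const 14).mul hf)).add (const 30))

theorem badCost : PolyBdd badCost :=
  ((((const 2).mul (id.loopCost (id.loopCost (const 1)))).add (id.loopCost (const 1))).add
    (const 20)).add ((const 10).mul id)

theorem runCost (tm : Turing.FinTM2) (d : ℕ) (hc : PolyBdd c) :
    PolyBdd fun n => runCost tm n d (c n) :=
  ((((id.loopCost (const 1)).add (const _)).add (hc.mul (const _))).add (const _)).add (const _)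

theorem formulaCost {k T N : ℕ → ℕ} (hk : PolyBdd k) (hT : PolyBdd T) (hN : PolyBdd N) :
    PolyBdd fun n => formulaCost (k n) (T n) (N n) :=
  (hN.mul ((hN.mul (((((const 22).mul hT).add ((const 40).mul hk)).add (const 80)).add
    (const 1))).add (const 9))).add (const 3)

theorem phaseCost (tm : Turing.FinTM2) (tail : List Bool) {N : ℕ → ℕ} (hN : PolyBdd N)
    (hc : PolyBdd c) : PolyBdd fun n => phaseCost tm tail n (N n) (c n) := by
  have hk : PolyBdd fun n => n + tail.length := id.add (const _)
  have hrun := hc.runCost tm tail.length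
  refine ((((hN.mul ?_).add ((hk.mul hk).mul ((hN.mul (((const 20).mul hk).add (const 80))).add
    (const 12)))).add hrun).add (hk.formulaCost (hN.mul (hk.add (const 2))) hrun)).add (const 10)
  exact ((((id.loopCost (const 2)).add (const _)).add (const _)).add (const 8)).add (const 1)

theorem mainCost (tm : Turing.FinTM2) (tail : List Bool) {N : ℕ → ℕ} (hN : PolyBdd N)
    (hc : PolyBdd c) : PolyBdd fun n => mainCost tm tail n (N n) (c n) := by
  refine ((((((id.mul (const 8)).add badCost).add ((const 2).mul (id.loopCost (id.loopCost ?_)))).add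
    (id.loopCost (const 3))).add ((const 2).mul (hN.phaseCost tm tail hc))).add
    ((const 40).mul (hN.mul ((id.add (const _)).add (const 2))))).add (const 100)
  exact (((const 70).mul id).add (const _)).add (const 70)

end PolyBdd

theorem eval_mono (p : Polynomial ℕ) {m n : ℕ} (h : m ≤ n) : p.eval m ≤ p.eval n := by
  simp only [Polynomial.eval_eq_sum_range]
  gcongr

/-! ### Graphs as words -/

variable {n t : ℕ} {A B : ℕ → ℕ → Bool} {Γ Δ : SimpleGraph (Fin n)}

theorem matBits_eq_flatMap : matBits A n 0 =
    (List.range n).flatMap fun i => (List.range n).map (A i) := by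
  simp [matBits, rowBits, List.range_eq_range']

theorem length_matBits : (matBits A n 0).length = n * n := by
  simp [matBits_eq_flatMap]

/-- Any word of this length is a matrix, symmetric or not. Hence the format of the input can be
checked by lengths alone, and symmetry is left to the tables. -/
theorem exists_matBits {l : List Bool} (h : l.length = n * n) : ∃ A, l = matBits A n 0 := by
  simp only [matBits_eq_flatMap]
  have key : ∀ m (l : List Bool), l.length = m * n →
      ∃ A : ℕ → ℕ → Bool, l = (List.range m).flatMap fun i => (List.range n).map (A i) := by
    intro m
    induction m with
    | zero => intro l hl; exact ⟨fun _ _ => false, by simpa using hl⟩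
    | succ m ih =>
      intro l hl
      rw [Nat.succ_mul] at hl
      obtain ⟨A, hA⟩ := ih (l.drop n) (by simp [hl])
      refine ⟨fun i => Nat.casesOn i (fun j => l.getD j false) A, ?_⟩
      rw [List.range_succ_eq_map, List.flatMap_cons, List.flatMap_map, ← hA]
      conv_lhs => rw [← List.take_append_drop n l]
      congr 1
      apply List.ext_getElem
      · simp; omega
      · intro i h₁ h₂
        simp at h₁
        simp [h₁.2]
  exact key n l h

theorem encodeGraph_eq (hA : Represents A Γ) :
    encodeGraph Γ = List.replicate n true ++ false :: matBits A n 0 := by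
  classical
  unfold encodeGraph
  rw [matBits_eq_flatMap, range_eq_map_finRange, List.flatMap_map]
  congr 3
  funext i
  rw [List.map_map]
  refine List.map_congr_left fun j _ => ?_
  rw [Function.comp_apply, Bool.eq_iff_iff, hA, decide_eq_true_eq]

theorem exists_represents (Γ : SimpleGraph (Fin n)) : ∃ A, Represents A Γ := by
  classical
  exact ⟨fun i j => if h : i < n ∧ j < n then decide (Γ.Adj ⟨i, h.1⟩ ⟨j, h.2⟩) else false,
    fun u v => by simp⟩

theorem exists_eq_replicate_append (x : List Bool) :
    ∃ n r, x = List.replicate n true ++ r ∧ r.head? ≠ some true := by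
  induction x with
  | nil => exact ⟨0, [], rfl, by simp⟩
  | cons b x ih =>
    cases b
    · exact ⟨0, false :: x, rfl, by simp⟩
    · obtain ⟨n, r, rfl, hr⟩ := ih
      exact ⟨n + 1, r, rfl, hr⟩

theorem unaryEncodeNat_eq (k : ℕ) : Computability.unaryEncodeNat k = List.replicate k true := by
  induction k with
  | zero => rfl
  | succ k ih => rw [Computability.unaryEncodeNat, ih]; rfl

theorem initStacks_eq_stage {tm : Turing.FinTM2} (x : Word) :
    initStacks Reg.x Letter.bit x = (stage 0 x fun _ => [] : Regs tm).st := by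
  funext k
  by_cases hk : k = Reg.x
  · subst hk; simp [initStacks, stage, bits]
  · rw [initStacks, Function.update_of_ne hk]
    cases k <;> simp_all [stage, zeros, table, Regs.st]

/-- What a generator of symmetry breaking predicates provides for graphs on `n` vertices. -/
theorem exists_formula {M : Turing.TM2ComputableAux Bool (Option Bool)} {p : Polynomial ℕ}
    (h : ∀ k : ℕ, t < k → ∃ ψ : Std.Sat.CNF (JohnsonDomain k t),
      IsCompleteSBP (johnsonGroup k t) ψ ∧
      Nonempty (Turing.TM2OutputsInTime M.tm
        ((Computability.unaryEncodeNat k).map M.inputAlphabet.symm)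
        (some ((encodeCNF ψ).map M.outputAlphabet.symm)) (p.eval (k.choose t)))) (n : ℕ) :
    ∃ ψ : Std.Sat.CNF (JohnsonDomain (n + (t + 1)) t),
      IsCompleteSBP (johnsonGroup (n + (t + 1)) t) ψ ∧
      Nonempty (Turing.TM2OutputsInTime M.tm
        (List.replicate (n + (tailWord t).length) (M.inputAlphabet.symm true))
        (some (((formulaLits ψ).flatMap clauseWord).map M.outputAlphabet.symm))
        (p.eval ((n + (t + 1)).choose t))) := by
  obtain ⟨ψ, h₁, h₂⟩ := h (n + (t + 1)) (by omega)
  refine ⟨ψ, h₁, ?_⟩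
  rw [unaryEncodeNat_eq, List.map_replicate, encodeCNF_eq] at h₂
  rwa [length_tailWord]

end SymBreak

/-! ### The theorem -/

open SymBreak Prog in
theorem theorem2 (t : ℕ) (ht : 1 < t) (h : SymBreak.JohnsonSBPInPolyTime t) :
    SymBreak.GI ∈ SymBreak.coNP := by
  obtain ⟨M, p, h⟩ := h
  have := M.tm.kFin
  have hF : ∀ {n} (ψ : Std.Sat.CNF (JohnsonDomain (n + (t + 1)) t)),
      ∀ C ∈ formulaLits ψ, ∀ q ∈ C, q.2.length = n + (tailWord t).length := fun ψ C hC q hq => by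
    rw [length_tailWord, length_of_mem_formulaLits C hC q hq]
  have hk : PolyBdd fun n => (n + (t + 1)).choose t := (PolyBdd.id.add (.const _)).choose t
  -- A completed table has at most one guessed entry for each `t`-set and two entries for each
  -- element of the matrix.
  obtain ⟨P, hP⟩ := (hk.add (PolyBdd.id.mul (PolyBdd.id.mul (.const 2)))).mainCost M.tm (tailWord t)
    (hk.eval p)
  refine mem_NP (mainProg (tailWord t) (M.inputAlphabet.symm true) M.outputAlphabet.symm)
    Reg.x Letter.bit GIᶜ P ?_ ?_
  · intro x hx
    obtain ⟨n, r, rfl, hr⟩ := exists_eq_replicate_append x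
    rw [initStacks_eq_stage]
    suffices ∃ s', To (mainProg (tailWord t) (M.inputAlphabet.symm true) M.outputAlphabet.symm)
        (mainCost M.tm (tailWord t) n ((n + (t + 1)).choose t + n * (n * 2))
          (p.eval ((n + (t + 1)).choose t)))
        (stage 0 (List.replicate n true ++ r) fun _ => []).st s' by
      obtain ⟨s', c, hc, hrun⟩ := this
      -- The costs are measured in the number `n` of leading ones, which is at most the length of
      -- the input.
      exact ⟨c, hc.trans ((hP n).trans (eval_mono P (by simp))), s', hrun⟩
    by_cases hform : ∃ A B : List Bool, A.length = n * n ∧ B.length = n * n ∧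
        r = false :: (A ++ (List.replicate n true ++ false :: B))
    · obtain ⟨A, B, hA, hB, rfl⟩ := hform
      obtain ⟨A, rfl⟩ := exists_matBits hA
      obtain ⟨B, rfl⟩ := exists_matBits hB
      obtain ⟨ψ, hψ, ⟨hM⟩⟩ := exists_formula h n
      refine to_mainProg (by simp; omega) hM (hF ψ) ?_ (Nat.le_add_left _ _)
      rcases exists_represents_or_contra A n (tailWord t) with ⟨Γ, hΓ⟩ | hc
      · rcases exists_represents_or_contra B n (tailWord t) with ⟨Δ, hΔ⟩ | hc
        · have hiso : ¬ Nonempty (Γ ≃g Δ) := fun hiso =>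
            hx ⟨n, n, Γ, Δ, by simp [encodeGraph_eq hΓ, encodeGraph_eq hΔ], hiso⟩
          obtain ⟨ops, ops', h₁, h₂, h₃, h₄, h₅⟩ := exists_certificate ht hψ hΓ hΔ hiso
          have hlen : ∀ A, (negativeEntries n t ++ matEntries (tailWord t) A n n).length ≤
              (n + (t + 1)).choose t + n * (n * 2) := fun A => by
            rw [List.length_append, length_matEntries]
            exact Nat.add_le_add_right length_negativeEntries _
          refine .inr (.inr ⟨_, ops, _, ops', isNegative_negativeEntries,
            isNegative_negativeEntries, ?_, ?_, hlen A, hlen B, h₃, h₄, h₅⟩)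
          · rwa [length_tailWord]
          · rwa [length_tailWord]
        · exact .inr (.inl hc)
      · exact .inl hc
    · refine to_mainProg_malformed hr fun A B hA hB hr => hform ⟨A, B, hA, hB, hr⟩
  · rintro _ c s' hrun ⟨n, m, Γ, Δ, rfl, ⟨e⟩⟩
    -- Isomorphic graphs have equally many vertices, so rejecting inputs with two different numbers
    -- loses nothing.
    obtain rfl : n = m := by simpa using Fintype.card_congr e.toEquiv
    obtain ⟨A, hA⟩ := exists_represents Γ
    obtain ⟨B, hB⟩ := exists_represents Δ
    obtain ⟨ψ, hψ, ⟨hM⟩⟩ := exists_formula h n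
    rw [initStacks_eq_stage, encodeGraph_eq hA, encodeGraph_eq hB, List.append_assoc,
      List.cons_append] at hrun
    exact not_differ_of_iso ht hψ hA hB ⟨e⟩ (mainProg_sound M.outputAlphabet.symm.injective hM
      (hF ψ) length_matBits length_matBits ⟨c, hrun⟩)
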